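/- **Setting.** Let $\Gamma$ be a connected graph (self-loops and parallel lines allowed) with $V$ vertices, $I$ oriented internal lines, each scalar or fermionic, and $L=I-V+1$ independent loops. Let $T>0$, and let $p=(p_v)$ be real external Euclidean energies entering the vertices, with $\sum_v p_v=0$. To a scalar line $i$ belongs the propagator $\Delta_i(k,E)=\frac{1}{k^2+E^2}$, to a fermionic one the matrix $\Delta_i(k,E)=\frac{m_i+ik\gamma^0-\mathbf k_i\cdot\boldsymbol\gamma}{k^2+E^2}$ with mass $m_i$ and spatial momentum $\mathbf k_i$ held fixed and gamma matrices satisfying $\{\gamma^\mu,\gamma^\nu\}=2\eta^{\mu\nu}$; the spin indices of the product $\prod_i\Delta_i$ are contracted with an arbitrary fixed tensor (vertex matrices and external spin components; a constant for scalar graphs). For $E=(E_1,\dots,E_I)$ with all $E_i>0$ let $$D(p,E,T)=\Big(\prod_{i=1}^I 2E_i\Big)\,T^L\sum_{n\in\mathbb Z^I}\delta(p,k)\prod_{i=1}^I\Delta_i(k_i,E_i),$$ where $k_i=2\pi T n_i$ for scalar and $k_i=2\pi T(n_i+\frac12)$ for fermionic lines, $\delta(p,k)$ is $1$ if energy is conserved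 at every vertex and $0$ otherwise, and the sum is the limit as $M\to\infty$ of the sums over $|n_i|\le M$. Let $D_0(p,E)$ be the corresponding zero-temperature function $$D_0(p,E)=\Big(\prod_{i=1}^I 2E_i\Big)\int\prod_{l\notin\mathcal T}\frac{dk_l}{2\pi}\,\prod_{i=1}^I\Delta_i(k_i,E_i),$$ the integral (the limit as $\Lambda\to\infty$ of the integrals over $|k_l|\le\Lambda$) being over the $L$ energies of the lines outside a spanning tree $\mathcal T$, with the energies of the other lines determined by energy conservation. On functions of $E$ let $\hat{\mathcal S}_i$ be the reflection $E_i\mapsto -E_i$ and $N_i$ the multiplication by $(e^{E_i/T}-1)^{-1}$ if line $i$ is scalar and by $-(e^{E_i/T}+1)^{-1}$ if it is fermionic. The thermal operator is $$\hat{\mathcal O}(E,T)=1+\sum_{k=1}^{L}\ \sideset{}{'}\sum_{\{i_1,\dots,i_k\}}\ \prod_{l=1}^k N_{i_l}(1+\hat{\mathcal S}_{i_l}),$$ the primed sum being over the sets of $k$ distinct lines whose removal leaves the graph connected. **Theorem 2 (Simpler form of the Thermal Operator).** For positive $E$ the limit defining $D_0(p,E)$ exists and equals a rational function of $E$ without poles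 at positive $E$. Denote by $D_0(p,E)$ also this rational function (at energies of arbitrary sign). When acting on $D_0(p,E)$, the thermal operator can be replaced by the unrestricted product $$\hat{\mathcal O}_\star(E,T)=\prod_{i=1}^I\,[\,1+N_i(1+\hat{\mathcal S}_i)\,].$$ That is, for all $E$ with $E_i>0$ such that $D_0(p,\cdot)$ has no pole at any of the points $(\pm E_1,\dots,\pm E_I)$, $$\hat{\mathcal O}(E,T)\,D_0(p,E)=\hat{\mathcal O}_\star(E,T)\,D_0(p,E),$$ and if moreover the external energies are Matsubara frequencies ($p_v/(2\pi T)$ is an integer if the number of ends of internal fermionic lines at $v$ is even, and an integer plus $\frac12$ if it is odd), then the sum defining $D(p,E,T)$ converges and $$D(p,E,T)=\hat{\mathcal O}_\star(E,T)\,D_0(p,E).$$ -/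

import Mathlib

open scoped Topology

/-- A (mixed scalar / Dirac) Feynman graph with vertex set `V` and set of internal lines `Line`.
Self-loops and parallel lines are allowed.  Every line is oriented (for a fermionic line along its
fermion arrow); `k i` will be the Euclidean energy flowing along line `i` from `src i` to `tgt i`.
The remaining fields are the data which stay fixed when the energies vary: masses, spatial momenta,
the gamma matrices, and the tensor `spin` with which the pairs of spin indices of the fermionic
propagators are contracted (vertex matrices, external spin components, fermion-loop signs).
For a scalar graph `spin` is just one constant. -/
structure FeynmanGraph (V Line : Type*) where
  src : Line → V
  tgt : Line → V
  fermionic : Finset Line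
  mass : Line → ℝ
  momentum : Line → Fin 3 → ℝ
  gamma : Fin 4 → Matrix (Fin 4) (Fin 4) ℂ
  clifford : ∀ μ ν : Fin 4, gamma μ * gamma ν + gamma ν * gamma μ =
    if μ = ν then (if μ = 0 then 2 else -2) else 0
  spin : ({i : Line // i ∈ fermionic} → Fin 4 × Fin 4) → ℂ

set_option linter.unusedSectionVars false

noncomputable section

namespace FeynmanGraph

variable {V Line : Type*} [Fintype V] [DecidableEq V] [Fintype Line] [DecidableEq Line]

/-! ### Topology of the graph -/

/-- The graph which keeps all vertices and only the lines in `s` is connected. -/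
def ConnectedBy (G : FeynmanGraph V Line) (s : Finset Line) : Prop :=
  (SimpleGraph.fromRel fun u v => ∃ i ∈ s, G.src i = u ∧ G.tgt i = v).Connected

/-- A tree of the graph: lines joining all vertices into a connected graph without loops
(that is, a connecting set of exactly `|V| - 1` lines). -/
def IsSpanningTree (G : FeynmanGraph V Line) (t : Finset Line) : Prop :=
  G.ConnectedBy t ∧ t.card + 1 = Fintype.card V

/-- The number `L = I - V + 1` of independent loops (of a connected graph). -/
def loops (_G : FeynmanGraph V Line) : ℕ := Fintype.card Line + 1 - Fintype.card V

/-- Conservation of energy at every vertex; `p v` is the external energy entering `v`. -/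
def IsConserved (G : FeynmanGraph V Line) (p : V → ℝ) (k : Line → ℝ) : Prop :=
  ∀ v, p v + ∑ i with G.tgt i = v, k i = ∑ i with G.src i = v, k i

/-! ### Propagators -/

/-- The scalar propagator `1 / (k² + E²)`. -/
def scalarPropagator (k E : ℝ) : ℂ := ((1 / (k ^ 2 + E ^ 2) : ℝ) : ℂ)

/-- The fermionic propagator `(m + i k γ⁰ - 𝐤·𝛄) / (k² + E²)` of line `i`. -/
def fermionPropagator (G : FeynmanGraph V Line) (i : Line) (k E : ℝ) :
    Matrix (Fin 4) (Fin 4) ℂ :=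
  ((1 / (k ^ 2 + E ^ 2) : ℝ) : ℂ) •
    ((G.mass i : ℂ) • (1 : Matrix (Fin 4) (Fin 4) ℂ) + (Complex.I * (k : ℂ)) • G.gamma 0
      - ∑ j : Fin 3, (G.momentum i j : ℂ) • G.gamma j.succ)

/-- The product of all the propagators, with spin indices contracted with `G.spin`. -/
def propagators (G : FeynmanGraph V Line) (k E : Line → ℝ) : ℂ :=
  ∑ s : {i : Line // i ∈ G.fermionic} → Fin 4 × Fin 4,
    G.spin s * ∏ i : Line,
      if h : i ∈ G.fermionic then
        G.fermionPropagator i (k i) (E i) (s ⟨i, h⟩).1 (s ⟨i, h⟩).2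
      else scalarPropagator (k i) (E i)

/-- `γ_E = ∏ 2 E_i`. -/
def gammaE (_G : FeynmanGraph V Line) (E : Line → ℝ) : ℂ := ∏ i, (2 * (E i : ℂ))

/-! ### The `D`-function at temperature `T` -/

/-- The Matsubara frequencies: `2πT n` (scalar line), `2πT (n + 1/2)` (fermionic line). -/
def matsubara (G : FeynmanGraph V Line) (T : ℝ) (n : Line → ℤ) (i : Line) : ℝ :=
  if i ∈ G.fermionic then 2 * Real.pi * T * ((n i : ℝ) + 1 / 2) else 2 * Real.pi * T * (n i : ℝ)

/-- The external energies are Matsubara frequencies: `p v` is `2πT` times an integer or a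
half-integer, according to whether the number of ends of internal fermionic lines at `v` (which has
the parity of the number of external fermions at `v`) is even or odd. -/
def IsMatsubaraExternal (G : FeynmanGraph V Line) (T : ℝ) (p : V → ℝ) : Prop :=
  ∀ v, ∃ n : ℤ, p v = 2 * Real.pi * T * ((n : ℝ) +
    (((G.fermionic.filter fun i => G.src i = v).card +
      (G.fermionic.filter fun i => G.tgt i = v).card : ℕ) : ℝ) / 2)

open scoped Classical in
/-- The normalized Matsubara sum `γ_E T^L ∑ ∏ Δ(k_i, E_i) δ(p, k)` with every `n_i` running
from `-M` to `M`. -/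
def partialD (G : FeynmanGraph V Line) (T : ℝ) (p : V → ℝ) (E : Line → ℝ) (M : ℕ) : ℂ :=
  G.gammaE E * (T : ℂ) ^ G.loops *
    ∑ n ∈ Fintype.piFinset fun _ : Line => Finset.Icc (-(M : ℤ)) (M : ℤ),
      if G.IsConserved p (G.matsubara T n) then G.propagators (G.matsubara T n) E else 0

/-- The Matsubara sum (each `n_i` running from `-∞` to `∞`) converges and `D(p, E, T) = d`. -/
def HasD (G : FeynmanGraph V Line) (T : ℝ) (p : V → ℝ) (E : Line → ℝ) (d : ℂ) : Prop :=
  Filter.Tendsto (G.partialD T p E) Filter.atTop (𝓝 d)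

/-! ### The `D`-function at zero temperature -/

open scoped Classical in
/-- The energies of all lines in terms of the energies `q` of the lines outside the tree `t`:
the solution of the conservation laws which equals `q` outside `t`. -/
def flow (G : FeynmanGraph V Line) (t : Finset Line) (p : V → ℝ) (q : {i : Line // i ∉ t} → ℝ) :
    Line → ℝ :=
  if h : ∃ k : Line → ℝ, G.IsConserved p k ∧ ∀ l : {i : Line // i ∉ t}, k l = q l
  then h.choose else 0

/-- The zero-temperature energy integral `γ_E ∫ ∏ dk_l / (2π) ∏ Δ(k_i, E_i)` over the `L`
independent energies `k_l`, `l ∉ t`, with cutoff `|k_l| ≤ Λ`. -/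
def partialD₀ (G : FeynmanGraph V Line) (t : Finset Line) (p : V → ℝ) (E : Line → ℝ) (Λ : ℝ) : ℂ :=
  G.gammaE E * (1 / (2 * Real.pi) : ℂ) ^ G.loops *
    ∫ q in Set.Icc (fun _ : {i : Line // i ∉ t} => -Λ) (fun _ => Λ), G.propagators (G.flow t p q) E

/-- The function of arbitrary real energies given by the fraction `num / den`. -/
def ratFun (num den : MvPolynomial Line ℂ) (E : Line → ℝ) : ℂ :=
  MvPolynomial.eval (fun i => (E i : ℂ)) num / MvPolynomial.eval (fun i => (E i : ℂ)) den

/-- `num / den` is the zero-temperature function `E ↦ D₀(p, E)`: it has no poles at positive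
energies, and there it is the value of the zero-temperature energy integral.  As the positive
energies form an open set, this determines the rational function; its values at energies of
arbitrary signs are those to which the reflection operators refer. -/
def IsD₀ (G : FeynmanGraph V Line) (t : Finset Line) (p : V → ℝ)
    (num den : MvPolynomial Line ℂ) : Prop :=
  ∀ E : Line → ℝ, (∀ i, 0 < E i) →
    MvPolynomial.eval (fun i => (E i : ℂ)) den ≠ 0 ∧
    Filter.Tendsto (G.partialD₀ t p E) Filter.atTop (𝓝 (ratFun num den E))

/-! ### The thermal operators -/

/-- The reflection operator `f(E_i, x) ↦ f(-E_i, x)`. -/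
def S (i : Line) : Module.End ℂ ((Line → ℝ) → ℂ) where
  toFun f E := f (Function.update E i (-E i))
  map_add' _ _ := rfl
  map_smul' _ _ := rfl

/-- The signed occupation number: Bose-Einstein for scalar lines, minus Fermi-Dirac for fermionic
ones. -/
def occupation (G : FeynmanGraph V Line) (T : ℝ) (i : Line) (x : ℝ) : ℝ :=
  if i ∈ G.fermionic then -(1 / (Real.exp (x / T) + 1)) else 1 / (Real.exp (x / T) - 1)

/-- Multiplication by `N_i = N(E_i)`. -/
def N (G : FeynmanGraph V Line) (T : ℝ) (i : Line) : Module.End ℂ ((Line → ℝ) → ℂ) where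
  toFun f E := (G.occupation T i (E i) : ℂ) * f E
  map_add' f g := by ext E; simp [mul_add]
  map_smul' c f := by ext E; simp [mul_left_comm]

/-- The operator `N_i (1 + S_i)`. -/
def lineOp (G : FeynmanGraph V Line) (T : ℝ) (i : Line) : Module.End ℂ ((Line → ℝ) → ℂ) :=
  G.N T i * (1 + S i)

theorem lineOp_apply (G : FeynmanGraph V Line) (T : ℝ) (i : Line) (f : (Line → ℝ) → ℂ)
    (E : Line → ℝ) :
    G.lineOp T i f E =
      (G.occupation T i (E i) : ℂ) * (f E + f (Function.update E i (-E i))) := rfl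

theorem lineOp_commute (G : FeynmanGraph V Line) (T : ℝ) {i j : Line} (hij : i ≠ j) :
    Commute (G.lineOp T i) (G.lineOp T j) := by
  refine LinearMap.ext fun f => funext fun E => ?_
  simp only [Module.End.mul_apply, lineOp_apply, Function.update_of_ne hij,
    Function.update_of_ne hij.symm, Function.update_comm hij]
  ring

/-- The product `∏_{i ∈ s} N_i (1 + S_i)`. -/
def lineOpProd (G : FeynmanGraph V Line) (T : ℝ) (s : Finset Line) :
    Module.End ℂ ((Line → ℝ) → ℂ) :=
  s.noncommProd (G.lineOp T) fun _ _ _ _ h => G.lineOp_commute T h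

open scoped Classical in
/-- The thermal operator: `1` plus the sum, over `k = 1, …, L` and over the sets `s` of `k` lines
whose removal leaves the graph connected, of `∏_{i ∈ s} N_i (1 + S_i)`. -/
def thermalOp (G : FeynmanGraph V Line) (T : ℝ) : Module.End ℂ ((Line → ℝ) → ℂ) :=
  1 + ∑ k ∈ Finset.Icc 1 G.loops,
    ∑ s ∈ (Finset.powersetCard k (Finset.univ : Finset Line)).filter (fun s => G.ConnectedBy sᶜ),
      G.lineOpProd T s

/-- The simpler operator `∏_{i=1}^I [1 + N_i (1 + S_i)]`. -/
def thermalOpStar (G : FeynmanGraph V Line) (T : ℝ) : Module.End ℂ ((Line → ℝ) → ℂ) :=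
  (Finset.univ : Finset Line).noncommProd (fun i => 1 + G.lineOp T i) fun _ _ _ _ h =>
    (Commute.one_left _).add_left ((Commute.one_right _).add_right (G.lineOp_commute T h))

end FeynmanGraph

end

/-! Attach a Euclidean time to every vertex, the root `r` having time 0. For fixed spin indices, 2E
times a propagator is the Fourier transform of `lineFun`, the function (c ∓ e d) exp(-e|x|) of the
time difference x along the line, and energy conservation is what integration over the vertex times
produces. Hence the zero-temperature function is an integral over all vertex times of a product of
`lineFun`s and an external phase (`tendsto_partialD₀`). Likewise the Matsubara sum is an integral
over times in (0, 1/T) of a product of thermal propagators (1 + N) lineFun(E) + N lineFun(-E)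
(`tendsto_partialD`). Fermionic propagators decay only like 1/k, so removing the cutoffs rests on
bounds for symmetric partial integrals and sums, uniform in time and cutoff, and on dominated
convergence.

Splitting the zero-temperature integral by the time ordering of the vertices gives time-ordered
perturbation theory: a sum over orderings of a numerator times inverse cut energies `cutE` of the
initial segments (`integral_timeFun_lineFun`). This is rational in E. It has no pole at positive E,
since the real part of a cut energy is the sum of the energies of the lines crossing the cut.

The unrestricted operator reproduces the Matsubara sum for the following reason. Expanding both
sides over the set u of reflected lines gives the same weights (`timeFun_thermalFun`,
`thermalOpStar_apply`). For an ordering starting at the root, the integral over the finite time box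
is a divided difference of an exponential, one term for each cut (`integral_corner`). Reflecting the
lines across the k-th cut turns the k-th term into the zero-temperature term of the ordering rotated
cyclically by k (`ordTerm_rotate`), while the KMS relation absorbs the exponential into the weight
(`thermalWeight_symmDiff_boundary`). The rotations of the orderings starting at the root exhaust all
orderings.

The two operators agree for a different reason. The additional terms of the unrestricted product
belong to sets of lines whose removal disconnects the graph. Such a set contains all lines B between
some vertex set A and its complement, and the product of 1 + S_i over B annihilates the
zero-temperature function (`sum_powerset_lineOrdSum_eq_zero`). After reindexing the reflections
separately in every ordering, a line of B carries the same exponential whichever end is earlier. Cut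
energies are then additive over A and its complement, the sum over shuffles factorizes, and the
total is multiplied by the energy of the full vertex set, which is zero (`ordW_univ_eq_zero`).

These identities are proved where no cut energy vanishes for any choice of signs. Such energies are
dense, and continuity carries the identities to all points admitted by the theorem. -/

noncomputable section

namespace FeynmanGraph

open MeasureTheory

/-! ### Vertex times and line coordinates -/

section Coordinates

variable {V J : Type*} [Fintype V] [DecidableEq V] [Fintype J]

/-- Extension by zero at the root `r`. -/
def rootExt {K : Type*} [Zero K] (r : V) (x : {v : V // v ≠ r} → K) (v : V) : K :=
  if h : v = r then 0 else x ⟨v, h⟩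

omit [Fintype V] in
theorem rootExt_root {K : Type*} [Zero K] (r : V) (x : {v : V // v ≠ r} → K) :
    rootExt r x r = 0 := by simp [rootExt]

omit [Fintype V] in
theorem rootExt_coe {K : Type*} [Zero K] (r : V) (x : {v : V // v ≠ r} → K)
    (v : {v : V // v ≠ r}) : rootExt r x v = x v := by simp [rootExt, v.2]

/-- The time differences along the lines `j`, running from `s j` to `t j`. -/
def edgeDiff {K : Type*} [AddGroup K] (s t : J → V) (r : V) (x : {v : V // v ≠ r} → K) (j : J) :
    K :=
  rootExt r x (t j) - rootExt r x (s j)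

/-- The lines `j`, running from `s j` to `t j`, join all vertices. -/
def Joins (s t : J → V) : Prop :=
  ∀ (K : Type) (f : V → K), (∀ j, f (s j) = f (t j)) → ∀ v w, f v = f w

-- Vanishing differences make the extended function constant on a connected graph, hence equal to
-- its root value 0. The group is arbitrary so that the argument also works over `ZMod q`.
omit [Fintype V] [Fintype J] in
theorem eq_zero_of_edgeDiff_eq_zero {K : Type} [AddGroup K] {s t : J → V} (h : Joins s t) (r : V)
    {x : {v : V // v ≠ r} → K} (hx : edgeDiff s t r x = 0) : x = 0 := by
  funext v
  have := h K (rootExt r x) (fun j => (sub_eq_zero.mp (congrFun hx j)).symm) v r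
  rwa [rootExt_root, rootExt_coe] at this

/-- The reduced incidence matrix. -/
def incidence (s t : J → V) (r : V) : Matrix J {v : V // v ≠ r} ℤ :=
  Matrix.of fun j v => (if t j = v then 1 else 0) - (if s j = v then 1 else 0)

omit [Fintype J] in
theorem incidence_map_mulVec {K : Type*} [CommRing K] (s t : J → V) (r : V)
    (x : {v : V // v ≠ r} → K) :
    ((incidence s t r).map (Int.cast : ℤ → K)).mulVec x = edgeDiff s t r x := by
  have key : ∀ w : V, ∑ v : {v : V // v ≠ r}, (if w = v then x v else 0) = rootExt r x w := by
    intro w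
    by_cases hw : w = r
    · subst hw
      rw [rootExt_root]
      exact Finset.sum_eq_zero fun v _ => if_neg (Ne.symm v.2)
    · rw [Finset.sum_eq_single ⟨w, hw⟩]
      · simp [rootExt, hw]
      · intro b _ hb
        exact if_neg fun h => hb (Subtype.ext h.symm)
      · simp
  funext j
  simp only [Matrix.mulVec, dotProduct, incidence, Matrix.map_apply, Matrix.of_apply, Int.cast_sub,
    Int.cast_ite, Int.cast_one, Int.cast_zero, sub_mul, ite_mul, one_mul, zero_mul,
    Finset.sum_sub_distrib, key, edgeDiff]

omit [Fintype J] in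
theorem incidence_submatrix_map_mulVec {K : Type*} [CommRing K] [Fintype J] (s t : J → V) (r : V)
    (e : J ≃ {v : V // v ≠ r}) (y : J → K) :
    (((incidence s t r).submatrix id e).map (Int.cast : ℤ → K)).mulVec y =
      edgeDiff s t r (y ∘ e.symm) := by
  rw [← incidence_map_mulVec]
  funext j
  simp only [Matrix.mulVec, dotProduct, Matrix.map_apply, Matrix.submatrix_apply, id]
  exact Fintype.sum_equiv e _ _ fun i => by simp

/-- If a prime q divided the determinant, the matrix would have a nonzero kernel vector over `ZMod
q`: a nonzero vertex labelling, zero at the root, constant along all lines. Connectedness excludes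
this for every q. -/
theorem isUnit_det_incidence [DecidableEq J] {s t : J → V} (h : Joins s t) (r : V)
    (e : J ≃ {v : V // v ≠ r}) : |((incidence s t r).submatrix id e).det| = 1 := by
  by_contra hne
  obtain ⟨q, hq, hdvd⟩ := Nat.exists_prime_and_dvd
    (n := ((incidence s t r).submatrix id e).det.natAbs) (by
      intro h1
      apply hne
      rw [Int.abs_eq_natAbs, h1]
      rfl)
  have := Fact.mk hq
  have hdet : (((incidence s t r).submatrix id e).map (Int.cast : ℤ → ZMod q)).det = 0 := by
    have := (Int.castRingHom (ZMod q)).map_det ((incidence s t r).submatrix id e)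
    have h2 : (((incidence s t r).submatrix id e).map (Int.cast : ℤ → ZMod q)) =
      (Int.castRingHom (ZMod q)).mapMatrix ((incidence s t r).submatrix id e) := rfl
    rw [h2, ← this]
    simp only [eq_intCast]
    exact (ZMod.intCast_zmod_eq_zero_iff_dvd _ q).mpr (Int.natCast_dvd.mpr hdvd)
  obtain ⟨y, hy0, hy⟩ := Matrix.exists_mulVec_eq_zero_iff.mpr hdet
  rw [incidence_submatrix_map_mulVec] at hy
  have := eq_zero_of_edgeDiff_eq_zero h r hy
  apply hy0
  funext j
  have := congrFun this (e j)
  simpa using this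

theorem exists_equiv_of_card (r : V) (hc : Fintype.card J + 1 = Fintype.card V) :
    Nonempty (J ≃ {v : V // v ≠ r}) := by
  refine ⟨Fintype.equivOfCardEq ?_⟩
  rw [Fintype.card_subtype_compl, Fintype.card_subtype_eq]
  omega

/-- The Jacobian is ±1 by unimodularity. This serves twice: for the lines of a spanning tree, and
for the path through the vertices in a given time order. -/
theorem measurePreserving_edgeDiff {s t : J → V} (h : Joins s t)
    (hc : Fintype.card J + 1 = Fintype.card V) (r : V) :
    MeasurePreserving (edgeDiff (K := ℝ) s t r) volume volume := by
  classical
  obtain ⟨e⟩ := exists_equiv_of_card r hc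
  set A := ((incidence s t r).submatrix id e).map (Int.cast : ℤ → ℝ) with hA
  have hdet : |A.det| = 1 := by
    have h1 := (Int.castRingHom ℝ).map_det ((incidence s t r).submatrix id e)
    have h2 : A = (Int.castRingHom ℝ).mapMatrix ((incidence s t r).submatrix id e) := rfl
    rw [h2, ← h1, eq_intCast, ← Int.cast_abs, isUnit_det_incidence h r e, Int.cast_one]
  have hmp : MeasurePreserving (Matrix.toLin' A) volume volume := by
    refine ⟨(LinearMap.continuous_of_finiteDimensional _).measurable, ?_⟩
    rw [Real.map_matrix_volume_pi_eq_smul_volume_pi (by intro h0; simp [h0] at hdet), abs_inv, hdet]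
    simp
  have hpc := volume_measurePreserving_piCongrLeft (fun _ : J => ℝ) e.symm
  have := hmp.comp hpc
  convert this using 1
  funext x
  rw [Function.comp_apply, Matrix.toLin'_apply, hA, incidence_submatrix_map_mulVec]
  congr 1
  funext v
  simp [MeasurableEquiv.coe_piCongrLeft, Equiv.piCongrLeft_apply]

omit [Fintype V] [Fintype J] in
theorem continuous_rootExt (r v : V) : Continuous fun x : {v : V // v ≠ r} → ℝ => rootExt r x v := by
  unfold rootExt
  split_ifs <;> fun_prop

omit [Fintype V] [Fintype J] in
theorem continuous_edgeDiff (s t : J → V) (r : V) : Continuous (edgeDiff (K := ℝ) s t r) :=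
  continuous_pi fun j => (continuous_rootExt r (t j)).sub (continuous_rootExt r (s j))

omit [Fintype V] [Fintype J] in
theorem edgeDiff_sub (s t : J → V) (r : V) (x y : {v : V // v ≠ r} → ℝ) :
    edgeDiff s t r (x - y) = edgeDiff s t r x - edgeDiff s t r y := by
  funext j
  simp only [edgeDiff, rootExt, Pi.sub_apply]
  split_ifs <;> ring

theorem measurableEmbedding_edgeDiff {s t : J → V} (h : Joins s t) (r : V) :
    MeasurableEmbedding (edgeDiff (K := ℝ) s t r) := by
  refine (continuous_edgeDiff s t r).measurableEmbedding fun x y hxy => ?_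
  have : edgeDiff s t r (x - y) = 0 := by rw [edgeDiff_sub, hxy, sub_self]
  exact sub_eq_zero.mp (eq_zero_of_edgeDiff_eq_zero h r this)

end Coordinates

end FeynmanGraph

end

noncomputable section

namespace FeynmanGraph

open MeasureTheory Filter Topology

/-! ### Propagators in imaginary time at zero temperature -/

/-- The Euclidean-time propagator with numerator data `c`, `d` and energy `e`. -/
def lineFun (c d : ℂ) (e x : ℝ) : ℂ :=
  (if 0 < x then c - e * d else if x < 0 then c + e * d else c) * Real.exp (-(e * |x|))

/-- The Fourier transform of `lineFun`. -/
def lineFourier (c d : ℂ) (e k : ℝ) : ℂ :=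
  2 * e * (c + Complex.I * k * d) / ((k ^ 2 + e ^ 2 : ℝ) : ℂ)

theorem lineFun_of_pos (c d : ℂ) (e : ℝ) {x : ℝ} (hx : 0 < x) :
    lineFun c d e x = (c - e * d) * Complex.exp (-e * x) := by
  simp [lineFun, hx, abs_of_pos hx]

theorem lineFun_of_neg (c d : ℂ) (e : ℝ) {x : ℝ} (hx : x < 0) :
    lineFun c d e x = (c + e * d) * Complex.exp (e * x) := by
  simp [lineFun, hx, hx.not_gt, abs_of_neg hx]

/-- The value at the jump is the mean of the one-sided limits, which is what symmetric cutoffs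
converge to. It matters because self-loops are evaluated at time difference 0. -/
theorem lineFun_zero (c d : ℂ) (e : ℝ) : lineFun c d e 0 = c := by
  simp [lineFun]

theorem measurable_lineFun (c d : ℂ) (e : ℝ) : Measurable (lineFun c d e) := by
  unfold lineFun
  refine Measurable.mul ?_ (by fun_prop)
  refine Measurable.ite measurableSet_Ioi measurable_const ?_
  exact Measurable.ite measurableSet_Iio measurable_const measurable_const

theorem integrableOn_lineFun_Ioi (c d : ℂ) {e : ℝ} (he : 0 < e) (k : ℝ) :
    IntegrableOn (fun x : ℝ => lineFun c d e x * Complex.exp (-(Complex.I * k * x))) (Set.Ioi 0) ∧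
    ∫ x in Set.Ioi (0 : ℝ), lineFun c d e x * Complex.exp (-(Complex.I * k * x)) =
      (c - e * d) / (e + Complex.I * k) := by
  have hre : (-e - Complex.I * k : ℂ).re < 0 := by simpa using he
  have heq : Set.EqOn (fun x : ℝ => (c - e * d) * Complex.exp ((-e - Complex.I * k) * x))
      (fun x : ℝ => lineFun c d e x * Complex.exp (-(Complex.I * k * x))) (Set.Ioi 0) := by
    intro x hx
    simp only []
    rw [lineFun_of_pos _ _ _ hx, mul_assoc, ← Complex.exp_add]
    ring_nf
  refine ⟨IntegrableOn.congr_fun ((integrableOn_exp_mul_complex_Ioi hre 0).const_mul (c - e * d))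
    heq measurableSet_Ioi, ?_⟩
  rw [← setIntegral_congr_fun measurableSet_Ioi heq, integral_const_mul,
    integral_exp_mul_complex_Ioi hre]
  have h1 : (-e - Complex.I * k : ℂ) ≠ 0 := fun h => by simp [h] at hre
  have h2 : (e + Complex.I * k : ℂ) ≠ 0 := fun h => h1 (by linear_combination -h)
  simp only [Complex.ofReal_zero, mul_zero, Complex.exp_zero]
  field_simp
  ring

theorem integrableOn_lineFun_Iio (c d : ℂ) {e : ℝ} (he : 0 < e) (k : ℝ) :
    IntegrableOn (fun x : ℝ => lineFun c d e x * Complex.exp (-(Complex.I * k * x))) (Set.Iio 0) ∧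
    ∫ x in Set.Iio (0 : ℝ), lineFun c d e x * Complex.exp (-(Complex.I * k * x)) =
      (c + e * d) / (e - Complex.I * k) := by
  have hre : 0 < (e - Complex.I * k : ℂ).re := by simpa using he
  have heq : Set.EqOn (fun x : ℝ => (c + e * d) * Complex.exp ((e - Complex.I * k) * x))
      (fun x : ℝ => lineFun c d e x * Complex.exp (-(Complex.I * k * x))) (Set.Iio 0) := by
    intro x hx
    simp only []
    rw [lineFun_of_neg _ _ _ hx, mul_assoc, ← Complex.exp_add]
    ring_nf
  refine ⟨IntegrableOn.congr_fun (((integrableOn_exp_mul_complex_Iic hre 0).mono_set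
    Set.Iio_subset_Iic_self).const_mul (c + e * d)) heq measurableSet_Iio, ?_⟩
  rw [← setIntegral_congr_fun measurableSet_Iio heq, integral_const_mul,
    ← integral_Iic_eq_integral_Iio, integral_exp_mul_complex_Iic hre]
  simp only [Complex.ofReal_zero, mul_zero, Complex.exp_zero]
  ring

theorem integrable_lineFun_mul_exp (c d : ℂ) {e : ℝ} (he : 0 < e) (k : ℝ) :
    Integrable fun x : ℝ => lineFun c d e x * Complex.exp (-(Complex.I * k * x)) := by
  have h := ((integrableOn_lineFun_Iio c d he k).1.congr_set_ae Iio_ae_eq_Iic.symm).union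
    (integrableOn_lineFun_Ioi c d he k).1
  rwa [Set.Iic_union_Ioi, integrableOn_univ] at h

theorem integrable_lineFun (c d : ℂ) {e : ℝ} (he : 0 < e) : Integrable (lineFun c d e) := by
  simpa using integrable_lineFun_mul_exp c d he 0

theorem add_I_mul_ne_zero {e : ℝ} (he : e ≠ 0) (k : ℝ) : (e + Complex.I * k : ℂ) ≠ 0 := by
  intro h
  have := congrArg Complex.re h
  simp at this
  exact he this

theorem sub_I_mul_ne_zero {e : ℝ} (he : e ≠ 0) (k : ℝ) : (e - Complex.I * k : ℂ) ≠ 0 := by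
  have := add_I_mul_ne_zero he (-k)
  intro h
  apply this
  rw [← h]
  push_cast
  ring

theorem sq_add_sq_factor (e k : ℝ) :
    ((k ^ 2 + e ^ 2 : ℝ) : ℂ) = (e + Complex.I * k) * (e - Complex.I * k) := by
  push_cast
  linear_combination (k : ℂ) ^ 2 * Complex.I_sq

theorem lineFourier_eq (c d : ℂ) {e : ℝ} (he : e ≠ 0) (k : ℝ) :
    lineFourier c d e k = (c + e * d) / (e - Complex.I * k) + (c - e * d) / (e + Complex.I * k) := by
  rw [lineFourier, sq_add_sq_factor]
  have h1 := add_I_mul_ne_zero he k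
  have h2 := sub_I_mul_ne_zero he k
  field_simp
  ring

theorem integral_lineFun_mul_exp (c d : ℂ) {e : ℝ} (he : 0 < e) (k : ℝ) :
    ∫ x : ℝ, lineFun c d e x * Complex.exp (-(Complex.I * k * x)) = lineFourier c d e k := by
  rw [← integral_add_compl (measurableSet_Iio (a := (0 : ℝ))) (integrable_lineFun_mul_exp c d he k),
    Set.compl_Iio, integral_Ici_eq_integral_Ioi, (integrableOn_lineFun_Iio c d he k).2,
    (integrableOn_lineFun_Ioi c d he k).2, lineFourier_eq c d he.ne']

/-- Fourier inversion, with the normalization used for energies. -/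
theorem integral_fourier_mul_exp {h g : ℝ → ℂ} (hc : Continuous h) (hi : Integrable h)
    (hg : ∀ k : ℝ, ∫ x : ℝ, h x * Complex.exp (-(Complex.I * k * x)) = g k) (hgi : Integrable g)
    (x : ℝ) : ∫ k : ℝ, g k * Complex.exp (Complex.I * k * x) = 2 * Real.pi * h x := by
  have hF : FourierTransform.fourier h = fun w : ℝ => g (2 * Real.pi * w) := by
    funext w
    rw [Real.fourier_eq', ← hg]
    refine integral_congr_ae (Eventually.of_forall fun v => ?_)
    simp only [smul_eq_mul, RCLike.inner_apply, conj_trivial]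
    rw [mul_comm]
    congr 2
    push_cast
    ring_nf
  have hpi : (0 : ℝ) < 2 * Real.pi := by positivity
  have hFi : Integrable (FourierTransform.fourier h) := by
    rw [hF]
    exact hgi.comp_mul_left' hpi.ne'
  have hinv := hi.fourierInv_fourier_eq hFi (v := x) hc.continuousAt
  rw [Real.fourierInv_eq', hF] at hinv
  have h2 := Measure.integral_comp_mul_left
    (fun k : ℝ => g k * Complex.exp (Complex.I * k * x)) (2 * Real.pi)
  have h3 : ∫ v : ℝ, Complex.exp (((2 * Real.pi * inner ℝ v x : ℝ) : ℂ) * Complex.I) •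
      g (2 * Real.pi * v) =
      ∫ v : ℝ, g (2 * Real.pi * v) * Complex.exp (Complex.I * (2 * Real.pi * v : ℝ) * x) := by
    refine integral_congr_ae (Eventually.of_forall fun v => ?_)
    simp only [smul_eq_mul, RCLike.inner_apply, conj_trivial]
    rw [mul_comm]
    congr 2
    push_cast
    ring_nf
  rw [h3, h2, abs_of_pos (by positivity), Complex.real_smul] at hinv
  rw [← hinv]
  push_cast
  have : (Real.pi : ℂ) ≠ 0 := by exact_mod_cast Real.pi_ne_zero
  rw [← mul_assoc, mul_inv_cancel₀ (mul_ne_zero two_ne_zero this), one_mul]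

/-! ### Fourier integrals with a symmetric cutoff: uniform bounds and limits -/

theorem integrable_one_div_sq_add_sq {e : ℝ} (he : e ≠ 0) :
    Integrable fun k : ℝ => 1 / (k ^ 2 + e ^ 2) := by
  have he2 : 0 < e ^ 2 := by positivity
  refine (integrable_inv_one_add_sq.const_mul (1 + 1 / e ^ 2)).mono'
    (Continuous.aestronglyMeasurable (Continuous.div (by fun_prop) (by fun_prop)
      fun k => by positivity)) (Eventually.of_forall fun k => ?_)
  have hk : 0 < k ^ 2 + e ^ 2 := by positivity
  rw [Real.norm_of_nonneg (by positivity), ← div_eq_mul_inv, div_le_div_iff₀ hk (by positivity)]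
  have : (1 + 1 / e ^ 2) * (k ^ 2 + e ^ 2) = 1 + k ^ 2 + e ^ 2 + k ^ 2 / e ^ 2 := by
    field_simp
    ring
  rw [this]
  have : 0 ≤ k ^ 2 / e ^ 2 := by positivity
  linarith

/-- The odd part `k / (k² + e²)` of a fermionic propagator. -/
def oddPart (e k : ℝ) : ℝ := k / (k ^ 2 + e ^ 2)

/-- The derivative of `oddPart`. -/
def oddPartDeriv (e k : ℝ) : ℝ := (e ^ 2 - k ^ 2) / (k ^ 2 + e ^ 2) ^ 2

theorem hasDerivAt_oddPart {e : ℝ} (he : e ≠ 0) (k : ℝ) :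
    HasDerivAt (oddPart e) (oddPartDeriv e k) k := by
  have hk : k ^ 2 + e ^ 2 ≠ 0 := by positivity
  have h := (hasDerivAt_id' k).fun_div ((hasDerivAt_pow 2 k).add_const (e ^ 2)) hk
  refine h.congr_deriv ?_
  rw [oddPartDeriv]
  congr 1
  push_cast
  ring

theorem continuous_oddPart {e : ℝ} (he : e ≠ 0) : Continuous (oddPart e) :=
  continuous_iff_continuousAt.mpr fun k => (hasDerivAt_oddPart he k).continuousAt

theorem continuous_oddPartDeriv {e : ℝ} (he : e ≠ 0) : Continuous (oddPartDeriv e) := by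
  unfold oddPartDeriv
  exact Continuous.div (by fun_prop) (by fun_prop) fun k => by positivity

theorem abs_oddPartDeriv_le {e : ℝ} (he : e ≠ 0) (k : ℝ) :
    |oddPartDeriv e k| ≤ 1 / (k ^ 2 + e ^ 2) := by
  have hk : 0 < k ^ 2 + e ^ 2 := by positivity
  rw [oddPartDeriv, abs_div, abs_of_pos (by positivity : 0 < (k ^ 2 + e ^ 2) ^ 2),
    div_le_div_iff₀ (by positivity) hk]
  have : |e ^ 2 - k ^ 2| ≤ k ^ 2 + e ^ 2 := abs_le.mpr ⟨by nlinarith [sq_nonneg e], by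
    nlinarith [sq_nonneg k]⟩
  nlinarith

theorem abs_oddPart_mul_le {e : ℝ} (k : ℝ) : |oddPart e k * k| ≤ 1 := by
  rw [oddPart, div_mul_eq_mul_div, ← sq, abs_of_nonneg (by positivity)]
  exact div_le_one_of_le₀ (by nlinarith [sq_nonneg e]) (by positivity)

theorem abs_oddPart_le {e : ℝ} {k : ℝ} (hk : 0 < k) : |oddPart e k| ≤ 1 / k := by
  have := abs_oddPart_mul_le (e := e) k
  rw [abs_mul, abs_of_pos hk] at this
  rwa [le_div_iff₀ hk]

theorem oddPart_neg (e k : ℝ) : oddPart e (-k) = -oddPart e k := by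
  simp [oddPart, neg_div]

/-- Integration by parts against the oscillating exponential. -/
theorem integral_oddPart_mul_exp {e : ℝ} (he : e ≠ 0) {x : ℝ} (hx : x ≠ 0) (a b : ℝ) :
    ∫ k in a..b, (oddPart e k : ℂ) * Complex.exp (Complex.I * k * x) =
      (oddPart e b * Complex.exp (Complex.I * b * x) -
        oddPart e a * Complex.exp (Complex.I * a * x) -
        ∫ k in a..b, (oddPartDeriv e k : ℂ) * Complex.exp (Complex.I * k * x)) /
        (Complex.I * x) := by
  have hIx : Complex.I * x ≠ 0 := mul_ne_zero Complex.I_ne_zero (by exact_mod_cast hx)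
  have hv : ∀ k : ℝ, HasDerivAt (fun k : ℝ => Complex.exp (Complex.I * k * x) / (Complex.I * x))
      (Complex.exp (Complex.I * k * x)) k := by
    intro k
    have h1 : HasDerivAt (fun k : ℝ => Complex.I * (k : ℂ) * x) (Complex.I * x) k := by
      have := ((Complex.ofRealCLM.hasDerivAt (x := k)).const_mul Complex.I).mul_const (x : ℂ)
      simpa using this
    have := (h1.cexp).div_const (Complex.I * x)
    rwa [mul_div_assoc, div_self hIx, mul_one] at this
  rw [intervalIntegral.integral_mul_deriv_eq_deriv_mul
    (u := fun k : ℝ => (oddPart e k : ℂ)) (u' := fun k : ℝ => (oddPartDeriv e k : ℂ))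
    (fun k _ => (hasDerivAt_oddPart he k).ofReal_comp) (fun k _ => hv k)
    ((Complex.continuous_ofReal.comp (continuous_oddPartDeriv he)).intervalIntegrable _ _)
    (by apply Continuous.intervalIntegrable; fun_prop)]
  simp_rw [← mul_div_assoc]
  rw [intervalIntegral.integral_div]
  ring

theorem norm_exp_I_mul_mul (k x : ℝ) : ‖Complex.exp (Complex.I * k * x)‖ = 1 := by
  have : Complex.I * k * x = ((k * x : ℝ) : ℂ) * Complex.I := by push_cast; ring
  rw [this, Complex.norm_exp_ofReal_mul_I]

/-- Integration by parts gains the factor 1/|x|. Both boundary terms and the integral of the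
derivative, dominated by 1/k², are at most 1/a = |x| each, whence 3. -/
theorem norm_integral_oddPart_mul_exp_le {e : ℝ} (he : e ≠ 0) {x a b : ℝ} (ha : 0 < a)
    (hab : a ≤ b) (hx : |x| * a = 1) :
    ‖∫ k in a..b, (oddPart e k : ℂ) * Complex.exp (Complex.I * k * x)‖ ≤ 3 := by
  have hx0 : x ≠ 0 := by rintro rfl; simp at hx
  have hxa : 1 / a = |x| := by rw [← hx]; field_simp
  rw [integral_oddPart_mul_exp he hx0, norm_div, norm_mul, Complex.norm_I, one_mul,
    Complex.norm_real, Real.norm_eq_abs, div_le_iff₀ (abs_pos.mpr hx0)]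
  have h1 : ‖(oddPart e b : ℂ) * Complex.exp (Complex.I * b * x)‖ ≤ |x| := by
    rw [norm_mul, norm_exp_I_mul_mul, mul_one, Complex.norm_real, Real.norm_eq_abs, ← hxa]
    exact (abs_oddPart_le (ha.trans_le hab)).trans (one_div_le_one_div_of_le ha hab)
  have h2 : ‖(oddPart e a : ℂ) * Complex.exp (Complex.I * a * x)‖ ≤ |x| := by
    rw [norm_mul, norm_exp_I_mul_mul, mul_one, Complex.norm_real, Real.norm_eq_abs, ← hxa]
    exact abs_oddPart_le ha
  have h3 : ‖∫ k in a..b, (oddPartDeriv e k : ℂ) * Complex.exp (Complex.I * k * x)‖ ≤ |x| := by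
    have hmem : ∀ k ∈ Set.uIcc a b, 0 < k := fun k hk => by
      rw [Set.uIcc_of_le hab] at hk
      exact ha.trans_le hk.1
    have hint : IntervalIntegrable (fun k : ℝ => 1 / k ^ 2) volume a b := by
      refine ContinuousOn.intervalIntegrable (ContinuousOn.div (by fun_prop) (by fun_prop) ?_)
      exact fun k hk => (pow_pos (hmem k hk) 2).ne'
    have hval : ∫ k in a..b, 1 / k ^ 2 = 1 / a - 1 / b := by
      have := intervalIntegral.integral_eq_sub_of_hasDerivAt (f := fun k : ℝ => -(k⁻¹))
        (f' := fun k : ℝ => 1 / k ^ 2) (a := a) (b := b) (fun k hk => by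
          have := (hasDerivAt_inv (hmem k hk).ne').neg
          rw [neg_neg, ← one_div] at this
          exact this) hint
      rw [this]
      simp only [one_div]
      ring
    calc _ ≤ ∫ k in a..b, 1 / k ^ 2 := by
          refine intervalIntegral.norm_integral_le_of_norm_le hab
            (Eventually.of_forall fun k hk => ?_) hint
          rw [norm_mul, norm_exp_I_mul_mul, mul_one, Complex.norm_real, Real.norm_eq_abs]
          refine (abs_oddPartDeriv_le he k).trans (one_div_le_one_div_of_le ?_ ?_)
          · have := ha.trans hk.1
            positivity
          · nlinarith [sq_nonneg e]
      _ ≤ |x| := by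
          rw [hval, hxa]
          have : 0 < 1 / b := by have := ha.trans_le hab; positivity
          linarith
  refine (norm_sub_le _ _).trans ?_
  have := norm_sub_le ((oddPart e b : ℂ) * Complex.exp (Complex.I * b * x))
    ((oddPart e a : ℂ) * Complex.exp (Complex.I * a * x))
  linarith

theorem integral_symm_oddPart {e : ℝ} (he : e ≠ 0) (x Λ : ℝ) :
    ∫ k in -Λ..Λ, (oddPart e k : ℂ) * Complex.exp (Complex.I * k * x) =
      ∫ k in (0 : ℝ)..Λ, ((oddPart e k : ℂ) * Complex.exp (Complex.I * k * x) -
        (oddPart e k : ℂ) * Complex.exp (Complex.I * k * (-x : ℝ))) := by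
  have hc : ∀ y : ℝ, Continuous fun k : ℝ => (oddPart e k : ℂ) * Complex.exp (Complex.I * k * y) :=
    fun y => (Complex.continuous_ofReal.comp (continuous_oddPart he)).mul (by fun_prop)
  rw [← intervalIntegral.integral_add_adjacent_intervals (b := 0) ((hc x).intervalIntegrable _ _)
    ((hc x).intervalIntegrable _ _), intervalIntegral.integral_sub ((hc x).intervalIntegrable _ _)
    ((hc (-x)).intervalIntegrable _ _)]
  have := intervalIntegral.integral_comp_neg (a := 0) (b := Λ)
    (fun k : ℝ => (oddPart e k : ℂ) * Complex.exp (Complex.I * k * x))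
  rw [neg_zero] at this
  rw [← this, sub_eq_add_neg, add_comm, ← intervalIntegral.integral_neg]
  congr 1
  refine intervalIntegral.integral_congr fun k _ => ?_
  simp only [oddPart_neg]
  push_cast
  rw [neg_mul]
  congr 3
  ring

/-- Pairing k with -k produces a sine. Up to 1/|x| the paired integrand is at most 2|x|,
contributing 2; beyond 1/|x| the two oscillating integrals contribute 3 each. Uniformity in x and Λ
is what dominated convergence will need. -/
theorem norm_integral_oddPart_le {e : ℝ} (he : e ≠ 0) (x : ℝ) {Λ : ℝ} (hΛ : 0 ≤ Λ) :
    ‖∫ k in -Λ..Λ, (oddPart e k : ℂ) * Complex.exp (Complex.I * k * x)‖ ≤ 8 := by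
  have hc : ∀ y : ℝ, Continuous fun k : ℝ => (oddPart e k : ℂ) * Complex.exp (Complex.I * k * y) :=
    fun y => (Complex.continuous_ofReal.comp (continuous_oddPart he)).mul (by fun_prop)
  have small : ∀ b : ℝ, 0 ≤ b → |x| * b ≤ 1 →
      ‖∫ k in (0 : ℝ)..b, ((oddPart e k : ℂ) * Complex.exp (Complex.I * k * x) -
        (oddPart e k : ℂ) * Complex.exp (Complex.I * k * (-x : ℝ)))‖ ≤ 2 := by
    intro b hb hxb
    have := intervalIntegral.norm_integral_le_of_norm_le_const (a := 0) (b := b) (C := 2 * |x|)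
      (f := fun k : ℝ => ((oddPart e k : ℂ) * Complex.exp (Complex.I * k * x) -
        (oddPart e k : ℂ) * Complex.exp (Complex.I * k * (-x : ℝ)))) (fun k hk => by
        rw [Set.uIoc_of_le hb] at hk
        have h1 : (oddPart e k : ℂ) * Complex.exp (Complex.I * k * x) -
            (oddPart e k : ℂ) * Complex.exp (Complex.I * k * (-x : ℝ)) =
            ((oddPart e k * (2 * Real.sin (k * x)) : ℝ) : ℂ) * Complex.I := by
          have e1 : Complex.I * k * x = ((k * x : ℝ) : ℂ) * Complex.I := by push_cast; ring
          have e2 : Complex.I * k * (-x : ℝ) = ((-(k * x) : ℝ) : ℂ) * Complex.I := by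
            push_cast; ring
          rw [e1, e2, Complex.exp_mul_I, Complex.exp_mul_I]
          push_cast
          rw [Complex.cos_neg, Complex.sin_neg]
          ring
        rw [h1, norm_mul, Complex.norm_I, mul_one, Complex.norm_real, Real.norm_eq_abs, abs_mul,
          abs_mul, abs_two]
        have h2 : |Real.sin (k * x)| ≤ |k * x| := Real.abs_sin_le_abs
        have h3 := abs_oddPart_mul_le (e := e) k
        rw [abs_mul] at h2 h3
        have := abs_nonneg (oddPart e k)
        nlinarith [mul_le_mul_of_nonneg_left h2 this, abs_nonneg x])
    refine this.trans ?_
    rw [sub_zero, abs_of_nonneg hb]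
    linarith
  rw [integral_symm_oddPart he]
  by_cases hx : |x| * Λ ≤ 1
  · exact (small Λ hΛ hx).trans (by norm_num)
  · push Not at hx
    have hx0 : 0 < |x| := by
      by_contra h0
      have : |x| = 0 := le_antisymm (not_lt.mp h0) (abs_nonneg x)
      rw [this, zero_mul] at hx
      linarith
    have ha : |x| * (1 / |x|) = 1 := by field_simp
    have hle : 1 / |x| ≤ Λ := by rw [div_le_iff₀ hx0]; linarith
    have hi : ∀ a b : ℝ, IntervalIntegrable (fun k : ℝ =>
        ((oddPart e k : ℂ) * Complex.exp (Complex.I * k * x) -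
        (oddPart e k : ℂ) * Complex.exp (Complex.I * k * (-x : ℝ)))) volume a b :=
      fun a b => ((hc x).sub (hc (-x))).intervalIntegrable _ _
    rw [← intervalIntegral.integral_add_adjacent_intervals (b := 1 / |x|) (hi _ _) (hi _ _)]
    refine (norm_add_le _ _).trans ?_
    have h1 := small (1 / |x|) (by positivity) ha.le
    rw [intervalIntegral.integral_sub (a := 1 / |x|) (b := Λ) ((hc x).intervalIntegrable _ _)
      ((hc (-x)).intervalIntegrable _ _)]
    have h2 := norm_integral_oddPart_mul_exp_le he (x := x) (b := Λ) (by positivity) hle ha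
    have h3 := norm_integral_oddPart_mul_exp_le he (x := -x) (b := Λ) (a := 1 / |x|)
      (by positivity) hle (by rw [abs_neg]; exact ha)
    have h4 := norm_sub_le (∫ k in (1 / |x|)..Λ, (oddPart e k : ℂ) * Complex.exp (Complex.I * k * x))
      (∫ k in (1 / |x|)..Λ, (oddPart e k : ℂ) * Complex.exp (Complex.I * k * (-x : ℝ)))
    linarith

/-- Plain Fourier inversion suffices here, as exp(-e|x|) is continuous with integrable transform.
The part with `d ≠ 0` has a jump and a transform decaying like 1/k, and is treated by integration by
parts. -/
theorem integral_even_mul_exp {e : ℝ} (he : 0 < e) (x : ℝ) :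
    ∫ k : ℝ, ((1 / (k ^ 2 + e ^ 2) : ℝ) : ℂ) * Complex.exp (Complex.I * k * x) =
      Real.pi / e * Real.exp (-(e * |x|)) := by
  have hec : (e : ℂ) ≠ 0 := by exact_mod_cast he.ne'
  have hfun : lineFun 1 0 e = fun x : ℝ => ((Real.exp (-(e * |x|)) : ℝ) : ℂ) := by
    funext x
    simp [lineFun]
  have hfou : ∀ k : ℝ, lineFourier 1 0 e k = 2 * e * ((1 / (k ^ 2 + e ^ 2) : ℝ) : ℂ) := by
    intro k
    simp only [lineFourier]
    push_cast
    ring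
  have h := integral_fourier_mul_exp (h := lineFun 1 0 e) (g := lineFourier 1 0 e)
    (by rw [hfun]; fun_prop) (integrable_lineFun 1 0 he) (integral_lineFun_mul_exp 1 0 he)
    (by
      simp only [funext hfou]
      exact ((integrable_one_div_sq_add_sq he.ne').ofReal (𝕜 := ℂ)).const_mul (2 * e : ℂ)) x
  simp_rw [hfou, hfun, mul_assoc, integral_const_mul] at h
  have h2 : (2 : ℂ) * (e * ∫ k : ℝ, ((1 / (k ^ 2 + e ^ 2) : ℝ) : ℂ) *
      Complex.exp (Complex.I * (k * x))) = 2 * (Real.pi * Real.exp (-(e * |x|))) := h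
  have h3 := mul_left_cancel₀ two_ne_zero h2
  simp_rw [mul_assoc]
  rw [div_mul_eq_mul_div, eq_div_iff hec, mul_comm, h3]

theorem integrable_abs_mul_exp {e : ℝ} (he : 0 < e) :
    Integrable fun x : ℝ => |x| * Real.exp (-(e * |x|)) := by
  have h : Integrable fun x : ℝ => (2 / e) * ‖lineFun 1 0 (e / 2) x‖ :=
    (integrable_lineFun 1 0 (half_pos he)).norm.const_mul _
  refine h.mono' (by fun_prop) (Eventually.of_forall fun x => ?_)
  have h1 : lineFun 1 0 (e / 2) x = ((Real.exp (-(e / 2 * |x|)) : ℝ) : ℂ) := by simp [lineFun]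
  rw [h1, Complex.norm_real, Real.norm_of_nonneg (Real.exp_pos _).le,
    Real.norm_of_nonneg (by positivity),
    show -(e * |x|) = -(e / 2 * |x|) + -(e / 2 * |x|) by ring, Real.exp_add, ← mul_assoc]
  refine mul_le_mul_of_nonneg_right ?_ (Real.exp_pos _).le
  have h2 : e / 2 * |x| ≤ Real.exp (e / 2 * |x|) := by
    have := Real.add_one_le_exp (e / 2 * |x|)
    linarith
  rw [Real.exp_neg, ← div_eq_mul_inv, div_le_iff₀ (Real.exp_pos _)]
  calc |x| = 2 / e * (e / 2 * |x|) := by field_simp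
    _ ≤ _ := mul_le_mul_of_nonneg_left h2 (by positivity)

theorem integral_Ioi_mul_exp {z : ℂ} (hz : 0 < z.re) :
    ∫ x in Set.Ioi (0 : ℝ), (x : ℂ) * Complex.exp (-(z * x)) = 1 / z ^ 2 := by
  have hz0 : z ≠ 0 := fun h => by simp [h] at hz
  have hnorm : ∀ x : ℝ, ‖Complex.exp (-(z * x))‖ = Real.exp (-(z.re * x)) := fun x => by
    rw [Complex.norm_exp]
    simp
  have hderiv : ∀ x : ℝ, HasDerivAt
      (fun x : ℝ => -((x / z + 1 / z ^ 2) * Complex.exp (-(z * x))))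
      (x * Complex.exp (-(z * x))) x := by
    intro x
    have h1 : HasDerivAt (fun x : ℝ => -(z * (x : ℂ))) (-z) x := by
      have := ((Complex.ofRealCLM.hasDerivAt (x := x)).const_mul z).fun_neg
      simpa using this
    have h2 : HasDerivAt (fun x : ℝ => ((x : ℂ) / z + 1 / z ^ 2)) (1 / z) x := by
      have := ((Complex.ofRealCLM.hasDerivAt (x := x)).div_const z).add_const (1 / z ^ 2)
      simpa using this
    refine (h2.fun_mul h1.cexp).fun_neg.congr_deriv ?_
    field_simp
    ring
  have hint : IntegrableOn (fun x : ℝ => (x : ℂ) * Complex.exp (-(z * x))) (Set.Ioi 0) := by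
    refine (integrable_abs_mul_exp hz).integrableOn.mono'
      (Continuous.aestronglyMeasurable (by fun_prop)) ?_
    filter_upwards [ae_restrict_mem measurableSet_Ioi] with x hx
    rw [norm_mul, hnorm, Complex.norm_real, Real.norm_eq_abs, abs_of_pos hx]
  have hlim : Tendsto (fun x : ℝ => -((x / z + 1 / z ^ 2) * Complex.exp (-(z * x)))) atTop
      (𝓝 0) := by
    have hb : ∀ n : ℕ, Tendsto (fun x : ℝ => x ^ n * Real.exp (-(z.re * x))) atTop (𝓝 0) := by
      intro n
      have := Real.tendsto_pow_mul_exp_neg_atTop_nhds_zero n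
      have h3 := (this.comp (tendsto_id.const_mul_atTop hz)).const_mul ((1 / z.re) ^ n)
      rw [mul_zero] at h3
      refine h3.congr fun x => ?_
      simp only [Function.comp, id]
      rw [← mul_assoc, ← mul_pow]
      congr 2
      field_simp
    rw [tendsto_zero_iff_norm_tendsto_zero]
    have h4 := ((hb 1).mul_const ‖1 / z‖).add ((hb 0).mul_const ‖1 / z ^ 2‖)
    rw [zero_mul, zero_mul, add_zero] at h4
    refine squeeze_zero' (Eventually.of_forall fun _ => norm_nonneg _) ?_ h4
    filter_upwards [eventually_gt_atTop 0] with x hx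
    rw [norm_neg, norm_mul, hnorm]
    have h5 : ‖(x : ℂ) / z + 1 / z ^ 2‖ ≤ x * ‖1 / z‖ + ‖1 / z ^ 2‖ := by
      refine (norm_add_le _ _).trans (add_le_add_left (le_of_eq ?_) _)
      rw [div_eq_mul_one_div, norm_mul, Complex.norm_real, Real.norm_of_nonneg hx.le]
    calc _ ≤ (x * ‖1 / z‖ + ‖1 / z ^ 2‖) * Real.exp (-(z.re * x)) :=
          mul_le_mul_of_nonneg_right h5 (Real.exp_pos _).le
      _ = _ := by ring
  rw [integral_Ioi_of_hasDerivAt_of_tendsto' (fun x _ => hderiv x) hint hlim]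
  simp

/-- The transform of |x| exp(-e|x|) is 1/(e+ik)² + 1/(e-ik)², twice `oddPartDeriv`, so inversion
applies. This is the absolutely convergent integral left after integrating the odd part by parts. -/
theorem integral_oddPartDeriv_mul_exp {e : ℝ} (he : 0 < e) (x : ℝ) :
    ∫ k : ℝ, (oddPartDeriv e k : ℂ) * Complex.exp (Complex.I * k * x) =
      Real.pi * |x| * Real.exp (-(e * |x|)) := by
  have hi : Integrable fun x : ℝ => ((|x| * Real.exp (-(e * |x|)) : ℝ) : ℂ) := 
    (integrable_abs_mul_exp he).ofReal
  have hg : ∀ k : ℝ, ∫ x : ℝ, ((|x| * Real.exp (-(e * |x|)) : ℝ) : ℂ) *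
      Complex.exp (-(Complex.I * k * x)) = 2 * (oddPartDeriv e k : ℂ) := by
    intro k
    have hik : Integrable fun x : ℝ => ((|x| * Real.exp (-(e * |x|)) : ℝ) : ℂ) *
        Complex.exp (-(Complex.I * k * x)) := by
      refine hi.mul_bdd (c := 1) (Continuous.aestronglyMeasurable (by fun_prop))
        (Eventually.of_forall fun y => ?_)
      have := norm_exp_I_mul_mul (-k) y
      push_cast at this
      rw [← this]
      apply le_of_eq
      congr 2
      ring
    rw [← intervalIntegral.integral_Iic_add_Ioi (b := (0 : ℝ)) hik.integrableOn hik.integrableOn]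
    have hpos : ∫ x in Set.Ioi (0 : ℝ), ((|x| * Real.exp (-(e * |x|)) : ℝ) : ℂ) *
        Complex.exp (-(Complex.I * k * x)) = 1 / (e + Complex.I * k) ^ 2 := by
      rw [← integral_Ioi_mul_exp (z := e + Complex.I * k) (by simpa using he)]
      refine setIntegral_congr_fun measurableSet_Ioi fun y hy => ?_
      simp only [abs_of_pos (Set.mem_Ioi.mp hy)]
      push_cast
      rw [mul_assoc, ← Complex.exp_add]
      congr 2
      ring
    have hneg : ∫ x in Set.Iic (0 : ℝ), ((|x| * Real.exp (-(e * |x|)) : ℝ) : ℂ) *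
        Complex.exp (-(Complex.I * k * x)) = 1 / (e - Complex.I * k) ^ 2 := by
      rw [← integral_Ioi_mul_exp (z := e - Complex.I * k) (by simpa using he)]
      rw [← neg_zero, ← integral_comp_neg_Ioi]
      rw [neg_zero]
      refine setIntegral_congr_fun measurableSet_Ioi fun y hy => ?_
      simp only [abs_neg, abs_of_pos (Set.mem_Ioi.mp hy)]
      push_cast
      rw [mul_assoc, ← Complex.exp_add]
      congr 2
      ring
    rw [hpos, hneg, oddPartDeriv, Complex.ofReal_div, Complex.ofReal_pow, sq_add_sq_factor]
    have h1 := add_I_mul_ne_zero he.ne' k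
    have h2 := sub_I_mul_ne_zero he.ne' k
    field_simp
    push_cast
    linear_combination 2 * (k : ℂ) ^ 2 * Complex.I_sq
  have hgi : Integrable fun k : ℝ => 2 * (oddPartDeriv e k : ℂ) := by
    refine Integrable.const_mul (Integrable.ofReal ?_) 2
    refine (integrable_one_div_sq_add_sq he.ne').mono'
      (continuous_oddPartDeriv he.ne').aestronglyMeasurable (Eventually.of_forall fun k => ?_)
    exact abs_oddPartDeriv_le he.ne' k
  have h := integral_fourier_mul_exp (by fun_prop) hi hg hgi x
  simp_rw [mul_assoc, integral_const_mul] at h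
  have h2 := mul_left_cancel₀ two_ne_zero h
  simp_rw [mul_assoc]
  rw [h2]
  push_cast
  ring

/-- The Fourier integral of the propagator with cutoff `Λ`. -/
def lineCutoff (c d : ℂ) (e Λ x : ℝ) : ℂ :=
  1 / (2 * Real.pi) * ∫ k in -Λ..Λ, lineFourier c d e k * Complex.exp (Complex.I * k * x)

theorem continuous_lineFourier (c d : ℂ) {e : ℝ} (he : e ≠ 0) : Continuous (lineFourier c d e) := by
  unfold lineFourier
  refine Continuous.div (by fun_prop) (by fun_prop) fun k => ?_
  have : k ^ 2 + e ^ 2 ≠ 0 := by positivity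
  exact_mod_cast this

theorem lineCutoff_eq (c d : ℂ) {e : ℝ} (he : e ≠ 0) (Λ x : ℝ) :
    lineCutoff c d e Λ x = e * c / Real.pi *
      (∫ k in -Λ..Λ, ((1 / (k ^ 2 + e ^ 2) : ℝ) : ℂ) * Complex.exp (Complex.I * k * x)) +
      Complex.I * e * d / Real.pi *
      (∫ k in -Λ..Λ, (oddPart e k : ℂ) * Complex.exp (Complex.I * k * x)) := by
  have hpi : (Real.pi : ℂ) ≠ 0 := by exact_mod_cast Real.pi_ne_zero
  have h1 : ∀ k : ℝ, lineFourier c d e k * Complex.exp (Complex.I * k * x) =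
      2 * e * c * (((1 / (k ^ 2 + e ^ 2) : ℝ) : ℂ) * Complex.exp (Complex.I * k * x)) +
      2 * Complex.I * e * d * ((oddPart e k : ℂ) * Complex.exp (Complex.I * k * x)) := by
    intro k
    simp only [lineFourier, oddPart]
    push_cast
    ring
  have hc1 : Continuous fun k : ℝ => ((1 / (k ^ 2 + e ^ 2) : ℝ) : ℂ) := by
    refine Complex.continuous_ofReal.comp (Continuous.div (by fun_prop) (by fun_prop) fun k => ?_)
    positivity
  have hc2 : Continuous fun k : ℝ => (oddPart e k : ℂ) :=
    Complex.continuous_ofReal.comp (continuous_oddPart he)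
  simp_rw [lineCutoff, h1]
  rw [intervalIntegral.integral_add (Continuous.intervalIntegrable (by fun_prop) _ _)
    (Continuous.intervalIntegrable (by fun_prop) _ _), intervalIntegral.integral_const_mul,
    intervalIntegral.integral_const_mul]
  ring

/-- At `x = 0` the symmetric integral vanishes by oddness. Otherwise the boundary terms are O(1/Λ)
and the remaining integral converges absolutely. -/
theorem tendsto_integral_oddPart {e : ℝ} (he : 0 < e) (x : ℝ) :
    Tendsto (fun Λ : ℝ => ∫ k in -Λ..Λ, (oddPart e k : ℂ) * Complex.exp (Complex.I * k * x)) atTop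
      (𝓝 (if x = 0 then 0 else Complex.I * Real.pi * (|x| / x) * Real.exp (-(e * |x|)))) := by
  by_cases hx : x = 0
  · rw [if_pos hx]
    refine tendsto_const_nhds.congr fun Λ => ?_
    rw [integral_symm_oddPart he.ne']
    simp [hx]
  · rw [if_neg hx]
    have hxc : (x : ℂ) ≠ 0 := by exact_mod_cast hx
    have hzero : ∀ s : ℝ, |s| = 1 → Tendsto (fun Λ : ℝ => (oddPart e (s * Λ) : ℂ) *
        Complex.exp (Complex.I * (s * Λ : ℝ) * x)) atTop (𝓝 0) := by
      intro s hs
      rw [tendsto_zero_iff_norm_tendsto_zero]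
      refine squeeze_zero' (Eventually.of_forall fun _ => norm_nonneg _) ?_
        (tendsto_inv_atTop_zero (𝕜 := ℝ))
      filter_upwards [eventually_gt_atTop 0] with Λ hΛ
      rw [norm_mul, norm_exp_I_mul_mul, mul_one, Complex.norm_real, Real.norm_eq_abs, ← one_div]
      rcases eq_or_eq_neg_of_abs_eq hs with h | h
      · rw [h, one_mul]
        exact abs_oddPart_le hΛ
      · rw [h, neg_one_mul, oddPart_neg, abs_neg]
        exact abs_oddPart_le hΛ
    have hint : Integrable fun k : ℝ => (oddPartDeriv e k : ℂ) * Complex.exp (Complex.I * k * x) := by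
      have h1 : Integrable fun k : ℝ => (oddPartDeriv e k : ℂ) := by
        refine Integrable.ofReal ?_
        refine (integrable_one_div_sq_add_sq he.ne').mono'
          (continuous_oddPartDeriv he.ne').aestronglyMeasurable (Eventually.of_forall fun k => ?_)
        exact abs_oddPartDeriv_le he.ne' k
      exact h1.mul_bdd (c := 1) (Continuous.aestronglyMeasurable (by fun_prop))
        (Eventually.of_forall fun y => (norm_exp_I_mul_mul y x).le)
    have h1 := intervalIntegral_tendsto_integral hint tendsto_neg_atTop_atBot tendsto_id
    rw [integral_oddPartDeriv_mul_exp he] at h1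
    have h2 := (((hzero 1 (by simp)).sub (hzero (-1) (by simp))).sub h1).div_const (Complex.I * x)
    have h3 : (0 - 0 - Real.pi * |x| * Real.exp (-(e * |x|)) : ℂ) / (Complex.I * x) =
        Complex.I * Real.pi * (|x| / x) * Real.exp (-(e * |x|)) := by
      rw [div_eq_iff (mul_ne_zero Complex.I_ne_zero hxc)]
      field_simp
      rw [Complex.I_sq]
      ring
    rw [h3] at h2
    refine h2.congr fun Λ => ?_
    rw [integral_oddPart_mul_exp he.ne' hx]
    simp

theorem tendsto_lineCutoff (c d : ℂ) {e : ℝ} (he : 0 < e) (x : ℝ) :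
    Tendsto (fun Λ : ℝ => lineCutoff c d e Λ x) atTop (𝓝 (lineFun c d e x)) := by
  have hpi : (Real.pi : ℂ) ≠ 0 := by exact_mod_cast Real.pi_ne_zero
  have hec : (e : ℂ) ≠ 0 := by exact_mod_cast he.ne'
  have hint : Integrable fun k : ℝ => ((1 / (k ^ 2 + e ^ 2) : ℝ) : ℂ) *
      Complex.exp (Complex.I * k * x) :=
    ((integrable_one_div_sq_add_sq he.ne').ofReal (𝕜 := ℂ)).mul_bdd (c := 1)
      (Continuous.aestronglyMeasurable (by fun_prop))
      (Eventually.of_forall fun y => (norm_exp_I_mul_mul y x).le)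
  have h1 := intervalIntegral_tendsto_integral hint tendsto_neg_atTop_atBot tendsto_id
  rw [integral_even_mul_exp he] at h1
  have h2 := (h1.const_mul (e * c / Real.pi : ℂ)).add
    ((tendsto_integral_oddPart he x).const_mul (Complex.I * e * d / Real.pi : ℂ))
  simp_rw [lineCutoff_eq c d he.ne']
  convert h2 using 1
  congr 1
  -- The sign |x|/x of the odd limit, times I² = -1, produces the jump c ∓ e d; at 0 only the even
  -- part c survives.
  rcases lt_trichotomy x 0 with hx | hx | hx
  · have hxc : (x : ℂ) ≠ 0 := by exact_mod_cast hx.ne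
    simp only [lineFun, hx, hx.not_gt, hx.ne, if_true, if_false, abs_of_neg hx]
    push_cast
    field_simp
    rw [Complex.I_sq]
    ring_nf
  · subst hx
    simp [lineFun]
    field_simp
  · have hxc : (x : ℂ) ≠ 0 := by exact_mod_cast hx.ne'
    simp only [lineFun, hx, hx.ne', if_true, if_false, abs_of_pos hx]
    field_simp
    rw [Complex.I_sq]
    ring_nf

theorem exists_norm_lineCutoff_le (c d : ℂ) {e : ℝ} (he : 0 < e) :
    ∃ C : ℝ, ∀ Λ x : ℝ, 0 ≤ Λ → ‖lineCutoff c d e Λ x‖ ≤ C := by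
  refine ⟨‖(e * c / Real.pi : ℂ)‖ * (∫ k : ℝ, 1 / (k ^ 2 + e ^ 2)) +
    ‖(Complex.I * e * d / Real.pi : ℂ)‖ * 8, fun Λ x hΛ => ?_⟩
  rw [lineCutoff_eq c d he.ne']
  refine (norm_add_le _ _).trans (add_le_add ?_ ?_)
  · rw [norm_mul]
    refine mul_le_mul_of_nonneg_left ?_ (norm_nonneg _)
    have hle : -Λ ≤ Λ := by linarith
    calc _ ≤ ∫ k in -Λ..Λ, 1 / (k ^ 2 + e ^ 2) := by
          refine intervalIntegral.norm_integral_le_of_norm_le hle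
            (Eventually.of_forall fun k _ => ?_)
            (integrable_one_div_sq_add_sq he.ne').intervalIntegrable
          rw [norm_mul, norm_exp_I_mul_mul, mul_one, Complex.norm_real,
            Real.norm_of_nonneg (by positivity)]
      _ ≤ _ := by
          rw [intervalIntegral.integral_of_le hle]
          exact setIntegral_le_integral (integrable_one_div_sq_add_sq he.ne')
            (Eventually.of_forall fun k => by
              simp only [Pi.zero_apply]
              positivity)
  · rw [norm_mul]
    exact mul_le_mul_of_nonneg_left (norm_integral_oddPart_le he.ne' x hΛ) (norm_nonneg _)

end FeynmanGraph

end

noncomputable section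

namespace FeynmanGraph

open MeasureTheory Filter Topology

/-! ### Propagators in imaginary time at positive temperature -/

theorem sum_Icc_neg_succ {A : Type*} [AddCommGroup A] (f : ℤ → A) (M : ℕ) :
    ∑ n ∈ Finset.Icc (-((M + 1 : ℕ) : ℤ)) ((M + 1 : ℕ) : ℤ), f n =
      ∑ n ∈ Finset.Icc (-(M : ℤ)) (M : ℤ), f n + f (M + 1) + f (-(M + 1)) := by
  have h1 : Finset.Icc (-((M + 1 : ℕ) : ℤ)) ((M + 1 : ℕ) : ℤ) =
      insert ((M : ℤ) + 1) (insert (-((M : ℤ) + 1)) (Finset.Icc (-(M : ℤ)) (M : ℤ))) := by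
    ext x
    simp only [Finset.mem_Icc, Finset.mem_insert]
    push_cast
    omega
  rw [h1, Finset.sum_insert, Finset.sum_insert]
  · abel
  · simp
  · simp only [Finset.mem_insert, Finset.mem_Icc, not_or]
    omega

theorem tendsto_Icc_neg : Tendsto (fun M : ℕ => Finset.Icc (-(M : ℤ)) (M : ℤ)) atTop atTop := by
  refine tendsto_atTop_finset_of_monotone (fun a b hab => ?_) fun n => ⟨n.natAbs, ?_⟩
  · exact Finset.Icc_subset_Icc (by simpa using hab) (by simpa using hab)
  · rw [Finset.mem_Icc]
    omega

/-- Comparison with the Abel mean: at radius r the full series is the imaginary part of -log(1 - r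
e^{iθ}), at most π in modulus. For r = M/(M+1), cutting the tail costs at most 1, and so does
undoing the damping of the first M terms. -/
theorem abs_sum_sin_div_le (θ : ℝ) (M : ℕ) :
    |∑ n ∈ Finset.range (M + 1), Real.sin (n * θ) / n| ≤ 2 + Real.pi := by
  set r : ℝ := M / (M + 1) with hr
  have hM : (0 : ℝ) < M + 1 := by positivity
  have hr0 : 0 ≤ r := by positivity
  have hr1 : r < 1 := by rw [hr, div_lt_one hM]; linarith
  have hr2 : 1 - r = 1 / (M + 1) := by rw [hr]; field_simp; ring
  have hz : ‖(r : ℂ) * Complex.exp (θ * Complex.I)‖ < 1 := by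
    rw [norm_mul, Complex.norm_exp_ofReal_mul_I, mul_one, Complex.norm_real,
      Real.norm_of_nonneg hr0]
    exact hr1
  have hs := Complex.hasSum_im (Complex.hasSum_taylorSeries_neg_log hz)
  have hterm : ∀ n : ℕ, (((r : ℂ) * Complex.exp (θ * Complex.I)) ^ n / n).im =
      r ^ n * (Real.sin (n * θ) / n) := by
    intro n
    have h1 : ((r : ℂ) * Complex.exp (θ * Complex.I)) ^ n / n =
        ((r ^ n / n : ℝ) : ℂ) * Complex.exp ((n * θ : ℝ) * Complex.I) := by
      rw [mul_pow, ← Complex.exp_nat_mul]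
      push_cast
      ring_nf
    rw [h1, Complex.im_ofReal_mul, Complex.exp_ofReal_mul_I_im]
    ring
  simp_rw [hterm] at hs
  have hA : |(-Complex.log (1 - r * Complex.exp (θ * Complex.I))).im| ≤ Real.pi := by
    rw [Complex.neg_im, abs_neg, Complex.log_im]
    exact Complex.abs_arg_le_pi _
  rw [← hs.tsum_eq, ← hs.summable.sum_add_tsum_nat_add (M + 1)] at hA
  have hsin : ∀ n : ℕ, |Real.sin (n * θ) / n| ≤ 1 / n := fun n => by
    rw [abs_div, Nat.abs_cast]
    exact div_le_div_of_nonneg_right (Real.abs_sin_le_one _) (Nat.cast_nonneg n)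
  have htail : |∑' n : ℕ, r ^ (n + (M + 1)) * (Real.sin ((n + (M + 1) : ℕ) * θ) /
      (n + (M + 1) : ℕ))| ≤ 1 := by
    have hg : HasSum (fun n : ℕ => (1 / (M + 1)) * r ^ n) ((1 / (M + 1)) * (1 - r)⁻¹) :=
      (hasSum_geometric_of_lt_one hr0 hr1).mul_left _
    have hone : (1 / (M + 1) : ℝ) * (1 - r)⁻¹ = 1 := by
      rw [hr2]
      field_simp
    rw [hone] at hg
    rw [← Real.norm_eq_abs]
    refine tsum_of_norm_bounded hg fun n => ?_
    rw [Real.norm_eq_abs, abs_mul, abs_of_nonneg (pow_nonneg hr0 _), mul_comm]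
    refine mul_le_mul ((hsin _).trans ?_) ?_ (pow_nonneg hr0 _) (by positivity)
    · refine one_div_le_one_div_of_le hM ?_
      push_cast
      have : (0 : ℝ) ≤ n := Nat.cast_nonneg n
      linarith
    · exact pow_le_pow_of_le_one hr0 hr1.le (by omega)
  have hhead : |∑ n ∈ Finset.range (M + 1), Real.sin (n * θ) / n -
      ∑ n ∈ Finset.range (M + 1), r ^ n * (Real.sin (n * θ) / n)| ≤ 1 := by
    rw [← Finset.sum_sub_distrib]
    calc _ ≤ ∑ n ∈ Finset.range (M + 1), |Real.sin (n * θ) / n - r ^ n * (Real.sin (n * θ) / n)| :=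
          Finset.abs_sum_le_sum_abs _ _
      _ ≤ ∑ n ∈ Finset.range (M + 1), (1 / (M + 1) : ℝ) := by
          refine Finset.sum_le_sum fun n _ => ?_
          rw [← one_sub_mul, abs_mul]
          rcases Nat.eq_zero_or_pos n with h0 | hpos
          · subst h0
            simp
            positivity
          have h1 : 1 - r ^ n ≤ n * (1 - r) := by
            have := one_add_mul_le_pow (a := r - 1) (by linarith) n
            rw [add_sub_cancel] at this
            linarith
          have h2 : 0 ≤ 1 - r ^ n := sub_nonneg.mpr (pow_le_one₀ hr0 hr1.le)
          rw [abs_of_nonneg h2]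
          have hn : (0 : ℝ) < n := Nat.cast_pos.mpr hpos
          calc _ ≤ (n * (1 - r)) * (1 / n) :=
                mul_le_mul h1 (hsin n) (abs_nonneg _) (h2.trans h1)
            _ = 1 / (M + 1) := by rw [hr2]; field_simp
      _ = 1 := by
          rw [Finset.sum_const, Finset.card_range, nsmul_eq_mul]
          push_cast
          field_simp
  rw [abs_le] at *
  constructor <;> linarith [hA.1, hA.2, htail.1, htail.2, hhead.1, hhead.2]

/-- Pointwise convergence of a Fourier series with given summable coefficients. -/
theorem hasSum_fourier_of_integral {β : ℝ} (hβ : 0 < β) {h : ℝ → ℂ} (hc : Continuous h)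
    (hper : h 0 = h β) {q : ℤ → ℂ}
    (hq : ∀ n : ℤ, ∫ x in (0 : ℝ)..β, Complex.exp (-(2 * Real.pi * Complex.I * n * x / β)) * h x =
      β * q n) (hs : Summable q) {x : ℝ} (hx : x ∈ Set.Icc 0 β) :
    HasSum (fun n : ℤ => q n * Complex.exp (2 * Real.pi * Complex.I * n * x / β)) (h x) := by
  have : Fact (0 < β) := ⟨hβ⟩
  have hβc : (β : ℂ) ≠ 0 := by exact_mod_cast hβ.ne'
  let f : C(AddCircle β, ℂ) := ⟨AddCircle.liftIco β 0 h,
    AddCircle.liftIco_continuous (by rw [zero_add]; exact hper) hc.continuousOn⟩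
  have hcoef : fourierCoeff f = q := by
    funext n
    have h1 : fourierCoeff (AddCircle.liftIco β 0 h) n = _ := fourierCoeff_liftIco_eq h n
    change fourierCoeff (AddCircle.liftIco β 0 h) n = q n
    rw [h1, fourierCoeffOn_eq_integral]
    simp only [fourier_coe_apply, zero_add, sub_zero, smul_eq_mul]
    rw [Complex.real_smul]
    have h3 : ∀ y : ℝ, Complex.exp (2 * Real.pi * Complex.I * ((-n : ℤ) : ℂ) * y / β) =
        Complex.exp (-(2 * Real.pi * Complex.I * n * y / β)) := fun y => by
      congr 1
      push_cast
      ring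
    simp_rw [h3]
    rw [hq n]
    push_cast
    field_simp
  have hsum := has_pointwise_sum_fourier_series_of_summable (f := f) (by rw [hcoef]; exact hs)
    (x : AddCircle β)
  have hval : f (x : AddCircle β) = h x := by
    rcases hx.2.lt_or_eq with hlt | heq
    · exact AddCircle.liftIco_coe_apply (by rw [zero_add]; exact ⟨hx.1, hlt⟩)
    · rw [heq, ← hper]
      have h0 : ((β : ℝ) : AddCircle β) = ((0 : ℝ) : AddCircle β) := by
        rw [AddCircle.coe_period]
        rfl
      rw [h0]
      exact AddCircle.liftIco_coe_apply (by rw [zero_add]; exact ⟨le_rfl, hβ⟩)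
  rw [hval, hcoef] at hsum
  convert hsum using 2 with n
  rw [fourier_coe_apply, smul_eq_mul]

/-- The Matsubara frequencies. -/
def freq (T η : ℝ) (n : ℤ) : ℝ := 2 * Real.pi * T * (n + η)

/-! ### Matsubara sums of simple poles -/

theorem summable_one_div_sq_add_freq {T a : ℝ} (hT : 0 < T) (η : ℝ) :
    Summable fun n : ℤ => 1 / (a ^ 2 + freq T η n ^ 2) := by
  have h1 := ((Real.summable_one_div_int_add_rpow η 2).mpr (by norm_num)).mul_left
    (1 / (2 * Real.pi * T) ^ 2)
  refine Summable.of_norm_bounded_eventually h1 ?_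
  have hfin : {n : ℤ | (n : ℝ) + η = 0}.Finite := by
    refine Set.Subsingleton.finite fun m hm n hn => ?_
    simp only [Set.mem_ofPred_eq] at hm hn
    have : (m : ℝ) = n := by linarith
    exact_mod_cast this
  filter_upwards [hfin.compl_mem_cofinite] with n hn
  have hn0 : (n : ℝ) + η ≠ 0 := hn
  rw [Real.norm_of_nonneg (by positivity), one_div_mul_one_div]
  have h2 : |(n : ℝ) + η| ^ (2 : ℝ) = ((n : ℝ) + η) ^ 2 := by
    rw [Real.rpow_two, sq_abs]
  rw [h2, ← mul_pow]
  refine one_div_le_one_div_of_le ?_ ?_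
  · have := mul_ne_zero (mul_ne_zero (mul_ne_zero two_ne_zero Real.pi_ne_zero) hT.ne') hn0
    positivity
  · rw [freq]
    nlinarith [sq_nonneg a]

theorem normSq_sub_I_mul (a k : ℝ) : ‖(a - Complex.I * k : ℂ)‖ ^ 2 = a ^ 2 + k ^ 2 := by
  rw [← Complex.normSq_eq_norm_sq, Complex.normSq_apply]
  simp
  ring

theorem norm_mul_one_div_le (c : ℝ) (hc : 0 ≤ c) (u v : ℂ) :
    c * (1 / (‖u‖ * ‖v‖)) ≤ c * (1 / ‖u‖ ^ 2 + 1 / ‖v‖ ^ 2) := by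
  refine mul_le_mul_of_nonneg_left ?_ hc
  have := two_mul_le_add_sq (1 / ‖u‖) (1 / ‖v‖)
  have h2 : 1 / (‖u‖ * ‖v‖) = 1 / ‖u‖ * (1 / ‖v‖) := by rw [one_div_mul_one_div]
  have h3 : 0 ≤ 1 / ‖u‖ * (1 / ‖v‖) := by positivity
  rw [h2, ← one_div_pow, ← one_div_pow]
  linarith

theorem freq_sub_one (T η : ℝ) (n : ℤ) : freq T η (n - 1) = freq T η n - 2 * Real.pi * T := by
  simp only [freq]
  push_cast
  ring

/-- The Fourier coefficients of an exponential. -/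
def expCoeff (T η a : ℝ) (n : ℤ) : ℂ := 1 / (a - Complex.I * freq T η n)

theorem summable_expCoeff_sub {T a : ℝ} (hT : 0 < T) (ha : a ≠ 0) (η : ℝ) :
    Summable fun n : ℤ => expCoeff T η a n - expCoeff T η a (n - 1) := by
  have h1 := summable_one_div_sq_add_freq (a := a) hT η
  have h2 := h1.comp_injective (sub_left_injective (b := (1 : ℤ)))
  refine Summable.of_norm_bounded ((h1.add h2).mul_left (2 * Real.pi * T)) fun n => ?_
  have h3 : expCoeff T η a n - expCoeff T η a (n - 1) = (Complex.I * (2 * Real.pi * T : ℝ)) *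
      (1 / ((a - Complex.I * freq T η n) * (a - Complex.I * freq T η (n - 1)))) := by
    have := sub_I_mul_ne_zero ha (freq T η n)
    have := sub_I_mul_ne_zero ha (freq T η (n - 1))
    rw [expCoeff, expCoeff]
    field_simp
    rw [freq_sub_one]
    push_cast
    ring
  rw [h3, norm_mul, norm_mul, Complex.norm_I, one_mul, Complex.norm_real,
    Real.norm_of_nonneg (by positivity), norm_div, norm_one, norm_mul]
  refine (norm_mul_one_div_le _ (by positivity) _ _).trans (le_of_eq ?_)
  simp only [normSq_sub_I_mul, Function.comp]

theorem tendsto_expCoeff {T : ℝ} (hT : 0 < T) (η a : ℝ) (s : ℤ) (hs : |s| = 1) (t : ℤ) :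
    Tendsto (fun M : ℕ => expCoeff T η a (s * M + t)) atTop (𝓝 0) := by
  rw [tendsto_zero_iff_norm_tendsto_zero]
  have h1 : Tendsto (fun M : ℕ => 2 * Real.pi * T * (M - |(t : ℝ) + η|)) atTop atTop :=
    Tendsto.const_mul_atTop (by positivity)
      (tendsto_atTop_add_const_right _ _ tendsto_natCast_atTop_atTop)
  refine squeeze_zero' (Eventually.of_forall fun _ => norm_nonneg _) ?_
    (tendsto_inv_atTop_zero.comp h1)
  filter_upwards [h1.eventually_gt_atTop 0] with M hM
  rw [expCoeff, norm_div, norm_one, Function.comp, one_div]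
  refine inv_anti₀ hM ?_
  have h2 : |freq T η (s * M + t)| ≤ ‖(a - Complex.I * freq T η (s * M + t) : ℂ)‖ := by
    have := Complex.abs_im_le_norm (a - Complex.I * freq T η (s * M + t) : ℂ)
    simpa using this
  refine le_trans ?_ h2
  rw [freq, abs_mul, abs_of_pos (by positivity : 0 < 2 * Real.pi * T)]
  refine mul_le_mul_of_nonneg_left ?_ (by positivity)
  have h3 : |((s * M : ℤ) : ℝ)| = M := by
    rw [← Int.cast_abs, abs_mul, hs]
    simp
  have h4 := abs_sub_abs_le_abs_sub ((s * M : ℤ) : ℝ) (-((t : ℝ) + η))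
  rw [h3, abs_neg] at h4
  refine h4.trans (le_of_eq ?_)
  push_cast
  ring_nf

/-- Summation by parts against a geometric sequence. The coefficients `expCoeff` are only O(1/n),
but their differences are summable, and the two boundary terms will tend to 0. -/
theorem sum_telescope (Q E : ℤ → ℂ) (z : ℂ) (hE : ∀ n, E (n + 1) = z * E n) (M : ℕ) :
    ∑ n ∈ Finset.Icc (-(M : ℤ)) (M : ℤ), (Q n - Q (n - 1)) * E n =
      (1 - z) * ∑ n ∈ Finset.Icc (-(M : ℤ)) (M : ℤ), Q n * E n + Q M * E (M + 1) -
        Q (-M - 1) * E (-M) := by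
  induction M with
  | zero =>
    simp only [Nat.cast_zero, neg_zero, Finset.Icc_self, Finset.sum_singleton]
    rw [hE 0]
    ring_nf
  | succ m ih =>
    rw [sum_Icc_neg_succ, sum_Icc_neg_succ, ih]
    have h1 := hE (m + 1)
    have h2 : E (-m) = z * E (-(m + 1)) := by rw [← hE]; congr 1; ring
    push_cast
    rw [h1, h2, show (m : ℤ) + 1 - 1 = m by ring, show (-(m : ℤ) - 1) = -(m + 1) by ring]
    ring

theorem integral_exp_mul {z : ℂ} (hz : z ≠ 0) (b : ℝ) :
    ∫ x in (0 : ℝ)..b, Complex.exp (z * x) = (Complex.exp (z * b) - 1) / z := by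
  rw [integral_exp_mul_complex hz]
  simp

/-- The character of the circle by which a line function is multiplied when its argument is
shifted by `1 / T`. -/
structure IsStatistics (η ζ : ℝ) : Prop where
  exp_eq : Complex.exp (2 * Real.pi * Complex.I * η) = ζ
  sq_eq : ζ * ζ = 1

theorem IsStatistics.exp_freq {η ζ : ℝ} (h : IsStatistics η ζ) {T : ℝ} (hT : 0 < T) (n : ℤ) :
    Complex.exp (Complex.I * freq T η n * (1 / T : ℝ)) = ζ := by
  have hTc : (T : ℂ) ≠ 0 := by exact_mod_cast hT.ne'
  have h1 : Complex.I * freq T η n * (1 / T : ℝ) =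
      2 * Real.pi * Complex.I * η + n * (2 * Real.pi * Complex.I) := by
    simp only [freq]
    push_cast
    field_simp
    ring
  rw [h1, Complex.exp_add, Complex.exp_int_mul_two_pi_mul_I, mul_one, h.exp_eq]

theorem IsStatistics.exp_neg_freq {η ζ : ℝ} (h : IsStatistics η ζ) {T : ℝ} (hT : 0 < T) (n : ℤ) :
    Complex.exp (-(Complex.I * freq T η n * (1 / T : ℝ))) = ζ := by
  rw [Complex.exp_neg, h.exp_freq hT]
  have : (ζ : ℂ) * ζ = 1 := by exact_mod_cast h.sq_eq
  exact inv_eq_of_mul_eq_one_left this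

/-- The periodized exponential jumps at multiples of 1/T, so its Fourier series is not absolutely
convergent. Multiplication by 1 - exp(2πiTx) removes the jump and replaces the coefficients by their
summable differences. For 0 < x < 1/T this factor is nonzero and can be divided out again. -/
theorem tendsto_sum_expCoeff {η ζ : ℝ} (h : IsStatistics η ζ) {T a : ℝ} (hT : 0 < T) (ha : a ≠ 0)
    (hne : ζ * Real.exp (a / T) - 1 ≠ 0) {x : ℝ} (hx0 : 0 < x) (hx1 : x < 1 / T) :
    Tendsto (fun M : ℕ => T * ∑ n ∈ Finset.Icc (-(M : ℤ)) (M : ℤ),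
      expCoeff T η a n * Complex.exp (Complex.I * freq T η n * x)) atTop
      (𝓝 (((1 / (ζ * Real.exp (a / T) - 1) : ℝ) : ℂ) * Complex.exp (a * x))) := by
  have hTc : (T : ℂ) ≠ 0 := by exact_mod_cast hT.ne'
  have hpic : (Real.pi : ℂ) ≠ 0 := by exact_mod_cast Real.pi_ne_zero
  set D : ℂ := ((ζ * Real.exp (a / T) - 1 : ℝ) : ℂ) with hD
  have hDne : D ≠ 0 := by rw [hD]; exact_mod_cast hne
  set g : ℤ → ℝ → ℂ := fun m y => Complex.exp ((a - Complex.I * freq T η m) * y) with hg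
  have hgval : ∀ m : ℤ, ∫ y in (0 : ℝ)..(1 / T), g m y = D * expCoeff T η a m := by
    intro m
    rw [hg, integral_exp_mul (sub_I_mul_ne_zero ha _), expCoeff, sub_mul,
      sub_eq_add_neg (_ * _) (_ * _), Complex.exp_add, h.exp_neg_freq hT, hD]
    push_cast
    rw [show (a : ℂ) * (1 / T) = a / T by ring]
    ring
  have hmul : ∀ (n m : ℤ) (y : ℝ),
      Complex.exp (-(2 * Real.pi * Complex.I * n * y / (1 / T : ℝ))) * g m y = g (m + n) y := by
    intro n m y
    rw [hg, ← Complex.exp_add]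
    congr 1
    simp only [freq]
    push_cast
    field_simp
    ring
  have hcont : ∀ m : ℤ, Continuous (g m) := fun m => by
    simp only [hg]
    fun_prop
  have hsum := hasSum_fourier_of_integral (β := 1 / T) (by positivity)
    (h := fun y => g 0 y - g (-1) y) ((hcont 0).sub (hcont (-1)))
    (by
      have h1 : ∀ m : ℤ, g m (1 / T) = ζ * Complex.exp (a / T) := by
        intro m
        simp only [hg]
        rw [sub_mul, sub_eq_add_neg (_ * _) (_ * _), Complex.exp_add, h.exp_neg_freq hT, mul_comm]
        push_cast
        rw [show (a : ℂ) * (1 / T) = a / T by ring]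
      rw [h1, h1]
      simp [hg])
    (q := fun n => T * D * (expCoeff T η a n - expCoeff T η a (n - 1)))
    (by
      intro n
      simp_rw [mul_sub, hmul]
      rw [intervalIntegral.integral_sub ((hcont _).intervalIntegrable _ _)
        ((hcont _).intervalIntegrable _ _), hgval, hgval, zero_add,
        show -1 + n = n - 1 by ring]
      push_cast
      field_simp)
    ((summable_expCoeff_sub hT ha η).mul_left _) (x := x) ⟨hx0.le, hx1.le⟩
  set z : ℂ := Complex.exp (2 * Real.pi * Complex.I * T * x) with hz
  have hz1 : 1 - z ≠ 0 := by
    intro h0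
    have h1 : z = 1 := (sub_eq_zero.mp h0).symm
    rw [hz, Complex.exp_eq_one_iff] at h1
    obtain ⟨n, hn⟩ := h1
    have h2 : ((T * x : ℝ) : ℂ) = ((n : ℝ) : ℂ) := by
      have h3 : 2 * Real.pi * Complex.I ≠ 0 := Complex.two_pi_I_ne_zero
      apply mul_left_cancel₀ h3
      push_cast
      linear_combination hn
    have h3 : T * x = n := by exact_mod_cast h2
    have h4 : 0 < T * x := by positivity
    have h5 : T * x < 1 := by rwa [lt_div_iff₀ hT, mul_comm] at hx1
    rw [h3] at h4 h5
    have h6 : (0 : ℤ) < n := by exact_mod_cast h4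
    have h7 : n < (1 : ℤ) := by exact_mod_cast h5
    omega
  set E : ℤ → ℂ := fun n => Complex.exp (2 * Real.pi * Complex.I * n * x / (1 / T : ℝ)) with hE
  have hEs : ∀ n, E (n + 1) = z * E n := by
    intro n
    simp only [hE, hz]
    rw [← Complex.exp_add]
    congr 1
    push_cast
    field_simp
    ring
  have hEn : ∀ n, ‖E n‖ = 1 := by
    intro n
    simp only [hE]
    rw [show 2 * Real.pi * Complex.I * n * x / (1 / T : ℝ) =
      ((2 * Real.pi * n * x * T : ℝ) : ℂ) * Complex.I by push_cast; field_simp,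
      Complex.norm_exp_ofReal_mul_I]
  have hlim := hsum.comp tendsto_Icc_neg
  have hbd : ∀ (Q : ℕ → ℂ) (F : ℕ → ℂ), Tendsto Q atTop (𝓝 0) → (∀ n, ‖F n‖ = 1) →
      Tendsto (fun n => Q n * F n) atTop (𝓝 0) := by
    intro Q F hQ hF
    rw [tendsto_zero_iff_norm_tendsto_zero] at hQ ⊢
    simpa [norm_mul, hF] using hQ
  have hb1 := hbd (fun M : ℕ => expCoeff T η a M) (fun M => E (M + 1))
    (by simpa using tendsto_expCoeff hT η a 1 (by simp) 0) (fun _ => hEn _)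
  have hb2 := hbd (fun M : ℕ => expCoeff T η a (-M - 1)) (fun M => E (-M))
    (by simpa [sub_eq_add_neg] using tendsto_expCoeff hT η a (-1) (by simp) (-1)) (fun _ => hEn _)
  -- Add back the boundary terms of the summation by parts, divide by 1 - z, and restore the phase
  -- due to the frequency shift η.
  have hlim2 := (((hlim.div_const D).sub (hb1.const_mul (T : ℂ))).add
    (hb2.const_mul (T : ℂ))).mul_const
    ((1 - z)⁻¹ * Complex.exp (Complex.I * (2 * Real.pi * T * η : ℝ) * x))
  have hval : ((g 0 x - g (-1) x) / D - T * 0 + T * 0) *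
      ((1 - z)⁻¹ * Complex.exp (Complex.I * (2 * Real.pi * T * η : ℝ) * x)) =
      ((1 / (ζ * Real.exp (a / T) - 1) : ℝ) : ℂ) * Complex.exp (a * x) := by
    have hg0 : g 0 x * Complex.exp (Complex.I * (2 * Real.pi * T * η : ℝ) * x) =
        Complex.exp (a * x) := by
      simp only [hg]
      rw [← Complex.exp_add]
      congr 1
      simp only [freq]
      push_cast
      ring
    have hg1 : g (-1) x = z * g 0 x := by
      simp only [hg, hz]
      rw [← Complex.exp_add]
      congr 1
      simp only [freq]
      push_cast
      ring
    rw [hg1, ← hg0]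
    have : ((1 / (ζ * Real.exp (a / T) - 1) : ℝ) : ℂ) = 1 / D := by rw [hD]; push_cast; ring
    rw [this]
    field_simp
    ring
  rw [hval] at hlim2
  refine hlim2.congr fun M => ?_
  have htel := sum_telescope (expCoeff T η a) E z hEs M
  have hsumeq : ∑ n ∈ Finset.Icc (-(M : ℤ)) (M : ℤ), T * D * (expCoeff T η a n -
      expCoeff T η a (n - 1)) * E n = T * D * ((1 - z) *
      ∑ n ∈ Finset.Icc (-(M : ℤ)) (M : ℤ), expCoeff T η a n * E n +
      expCoeff T η a M * E (M + 1) - expCoeff T η a (-M - 1) * E (-M)) := by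
    rw [← htel, Finset.mul_sum]
    exact Finset.sum_congr rfl fun n _ => by ring
  have hfin : ∑ n ∈ Finset.Icc (-(M : ℤ)) (M : ℤ),
      expCoeff T η a n * Complex.exp (Complex.I * freq T η n * x) =
      (∑ n ∈ Finset.Icc (-(M : ℤ)) (M : ℤ), expCoeff T η a n * E n) *
        Complex.exp (Complex.I * (2 * Real.pi * T * η : ℝ) * x) := by
    rw [Finset.sum_mul]
    refine Finset.sum_congr rfl fun n _ => ?_
    simp only [hE]
    rw [mul_assoc (expCoeff T η a n), ← Complex.exp_add]
    congr 2
    simp only [freq]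
    push_cast
    field_simp
  simp only [Function.comp]
  rw [hsumeq, hfin]
  field_simp
  ring

/-- Subtracting the leading behaviour i/(ωn) leaves a summable sequence; the subtracted series is,
after pairing ±n, a multiple of the bounded sine series. -/
theorem exists_norm_sum_expCoeff_le {T a : ℝ} (hT : 0 < T) (ha : a ≠ 0) (η : ℝ) :
    ∃ C : ℝ, ∀ (M : ℕ) (x : ℝ), ‖∑ n ∈ Finset.Icc (-(M : ℤ)) (M : ℤ),
      expCoeff T η a n * Complex.exp (Complex.I * freq T η n * x)‖ ≤ C := by
  set ω : ℝ := 2 * Real.pi * T with hω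
  have hω0 : 0 < ω := by positivity
  have hωc : (ω : ℂ) ≠ 0 := by exact_mod_cast hω0.ne'
  -- At `n = 0` the subtracted quotient is 0 by the convention for division by zero.
  have hs : Summable fun n : ℤ => expCoeff T η a n - Complex.I / (ω * n) := by
    have h1 := summable_one_div_sq_add_freq (a := a) hT η
    have h2 : Summable fun n : ℤ => 1 / (n : ℝ) ^ 2 :=
      Real.summable_one_div_int_pow.mpr (by norm_num)
    refine Summable.of_norm_bounded_eventually
      ((h2.add h1).mul_left ((|a| + ω * |η|) / ω)) ?_
    filter_upwards [(Set.finite_singleton (0 : ℤ)).compl_mem_cofinite] with n hn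
    have hn0 : (n : ℂ) ≠ 0 := by exact_mod_cast hn
    have h3 : expCoeff T η a n - Complex.I / (ω * n) = ((-(Complex.I * a) - (ω * η : ℝ)) / ω) *
        (1 / (n * (a - Complex.I * freq T η n))) := by
      have := sub_I_mul_ne_zero ha (freq T η n)
      rw [expCoeff]
      field_simp
      rw [freq, ← hω]
      push_cast
      linear_combination (ω : ℂ) * (n + η) * Complex.I_sq
    rw [h3, norm_mul, norm_div, norm_div (1 : ℂ), norm_one, norm_mul, Complex.norm_real,
      Real.norm_of_nonneg hω0.le]
    have h4 : ‖(-(Complex.I * a) - (ω * η : ℝ) : ℂ)‖ ≤ |a| + ω * |η| := by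
      refine (norm_sub_le _ _).trans (le_of_eq ?_)
      rw [norm_neg, norm_mul, Complex.norm_I, one_mul, Complex.norm_real, Complex.norm_real,
        Real.norm_eq_abs, Real.norm_eq_abs, abs_mul, abs_of_pos hω0]
    refine (mul_le_mul_of_nonneg_right (div_le_div_of_nonneg_right h4 hω0.le)
      (by positivity)).trans ?_
    refine (norm_mul_one_div_le _ (by positivity) _ _).trans (le_of_eq ?_)
    rw [normSq_sub_I_mul, Complex.norm_intCast, sq_abs]
  refine ⟨(∑' n : ℤ, ‖expCoeff T η a n - Complex.I / (ω * n)‖) + 2 / ω * (2 + Real.pi),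
    fun M x => ?_⟩
  have hexp : ∀ n : ℤ, ‖Complex.exp (Complex.I * freq T η n * x)‖ = 1 := fun n =>
    norm_exp_I_mul_mul _ _
  have hsplit : ∑ n ∈ Finset.Icc (-(M : ℤ)) (M : ℤ),
      expCoeff T η a n * Complex.exp (Complex.I * freq T η n * x) =
      ∑ n ∈ Finset.Icc (-(M : ℤ)) (M : ℤ), (expCoeff T η a n - Complex.I / (ω * n)) *
        Complex.exp (Complex.I * freq T η n * x) +
      Complex.exp (Complex.I * (ω * η : ℝ) * x) * ∑ n ∈ Finset.Icc (-(M : ℤ)) (M : ℤ),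
        (Complex.I / (ω * n) * Complex.exp (((n * (ω * x) : ℝ) : ℂ) * Complex.I)) := by
    rw [Finset.mul_sum, ← Finset.sum_add_distrib]
    refine Finset.sum_congr rfl fun n _ => ?_
    have : Complex.exp (Complex.I * freq T η n * x) = Complex.exp (Complex.I * (ω * η : ℝ) * x) *
        Complex.exp (((n * (ω * x) : ℝ) : ℂ) * Complex.I) := by
      rw [← Complex.exp_add]
      congr 1
      rw [freq, ← hω]
      push_cast
      ring
    rw [this]
    ring
  have hsin : ∑ n ∈ Finset.Icc (-(M : ℤ)) (M : ℤ),
      (Complex.I / (ω * n) * Complex.exp (((n * (ω * x) : ℝ) : ℂ) * Complex.I)) =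
      ((-(2 / ω) * ∑ n ∈ Finset.range (M + 1), Real.sin (n * (ω * x)) / n : ℝ) : ℂ) := by
    clear hsplit
    induction M with
    | zero => simp
    | succ m ih =>
      rw [sum_Icc_neg_succ, ih, Finset.sum_range_succ (n := m + 1)]
      push_cast
      have hm : (m + 1 : ℂ) ≠ 0 := by exact_mod_cast Nat.succ_ne_zero m
      have e1 : -1 + -(m : ℂ) = -(m + 1) := by ring
      have e2 : (-((m : ℂ) + 1)) * (ω * x) * Complex.I = (-((m + 1) * (ω * x))) * Complex.I := by
        ring
      rw [e2, Complex.exp_mul_I, Complex.exp_mul_I, Complex.cos_neg, Complex.sin_neg]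
      field_simp
      ring_nf
      rw [Complex.I_sq]
      ring_nf
  rw [hsplit]
  refine (norm_add_le _ _).trans (add_le_add ?_ ?_)
  · refine (norm_sum_le _ _).trans ?_
    simp_rw [norm_mul, hexp, mul_one]
    exact hs.norm.sum_le_tsum _ fun _ _ => norm_nonneg _
  · rw [norm_mul, norm_exp_I_mul_mul, one_mul, hsin, Complex.norm_real, Real.norm_eq_abs, abs_mul,
      abs_neg, abs_of_pos (by positivity : 0 < 2 / ω)]
    exact mul_le_mul_of_nonneg_left (abs_sum_sin_div_le _ _) (by positivity)

/-! ### Occupation numbers and the thermal propagator -/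

/-- The signed occupation number of a line with statistics `ζ`. -/
def occ (ζ T x : ℝ) : ℝ := 1 / (ζ * Real.exp (x / T) - 1)

theorem occ_denom_ne_zero {ζ : ℝ} (hζ : ζ * ζ = 1) {T x : ℝ} (hT : 0 < T) (hx : x ≠ 0) :
    ζ * Real.exp (x / T) - 1 ≠ 0 := by
  intro h
  have h1 : ζ * Real.exp (x / T) = 1 := by linarith
  have h2 : Real.exp (x / T) * Real.exp (x / T) = 1 := by
    have : (ζ * Real.exp (x / T)) * (ζ * Real.exp (x / T)) = 1 := by rw [h1]; ring
    calc _ = (ζ * ζ) * (Real.exp (x / T) * Real.exp (x / T)) := by rw [hζ]; ring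
      _ = 1 := by rw [← this]; ring
  rw [← Real.exp_add, Real.exp_eq_one_iff] at h2
  have h3 : x / T = 0 := by linarith
  rw [div_eq_zero_iff] at h3
  rcases h3 with h3 | h3
  · exact hx h3
  · exact hT.ne' h3

/-- The KMS relation of a single line: a Boltzmann factor exchanges N and 1 + N up to the statistics
sign. Both the quasi-periodicity of the thermal propagator and the rotation of time orderings rest
on it. -/
theorem occ_kms {ζ : ℝ} (hζ : ζ * ζ = 1) {T x : ℝ} (hT : 0 < T) (hx : x ≠ 0) :
    occ ζ T x * Real.exp (x / T) = ζ * (1 + occ ζ T x) := by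
  have h := occ_denom_ne_zero hζ hT hx
  rw [occ]
  field_simp
  linear_combination (-Real.exp (x / T)) * hζ

theorem occ_neg {ζ : ℝ} (hζ : ζ * ζ = 1) {T x : ℝ} (hT : 0 < T) (hx : x ≠ 0) :
    occ ζ T (-x) = -(1 + occ ζ T x) := by
  have h := occ_denom_ne_zero hζ hT hx
  have h' := occ_denom_ne_zero hζ hT (neg_ne_zero.mpr hx)
  have he := (Real.exp_pos (x / T)).ne'
  rw [neg_div, Real.exp_neg] at h'
  have h'' : ζ - Real.exp (x / T) ≠ 0 := by
    intro h0
    apply h'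
    rw [sub_eq_zero.mp h0, mul_inv_cancel₀ he, sub_self]
  rw [occ, occ, neg_div, Real.exp_neg]
  field_simp
  linear_combination Real.exp (x / T) * hζ

theorem occ_kms' {ζ : ℝ} (hζ : ζ * ζ = 1) {T x : ℝ} (hT : 0 < T) (hx : x ≠ 0) :
    (1 + occ ζ T x) * Real.exp (-(x / T)) = ζ * occ ζ T x := by
  have h := occ_kms hζ hT hx
  have he := (Real.exp_pos (x / T)).ne'
  rw [Real.exp_neg]
  field_simp
  linear_combination (-ζ) * h - (1 + occ ζ T x) * hζ

theorem lineFourier_freq (c d : ℂ) {e : ℝ} (he : e ≠ 0) (T η : ℝ) (n : ℤ) :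
    lineFourier c d e (freq T η n) =
      (c + e * d) * expCoeff T η e n - (c - e * d) * expCoeff T η (-e) n := by
  rw [lineFourier_eq c d he, expCoeff, expCoeff]
  have h1 := add_I_mul_ne_zero he (freq T η n)
  have h2 := sub_I_mul_ne_zero he (freq T η n)
  have h3 : ((-e : ℝ) : ℂ) - Complex.I * freq T η n = -(e + Complex.I * freq T η n) := by
    push_cast
    ring
  rw [h3]
  field_simp
  ring

/-- The Matsubara sum of a propagator with cutoff `M`. -/
def thermalCutoff (c d : ℂ) (T η e : ℝ) (M : ℕ) (x : ℝ) : ℂ :=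
  T * ∑ n ∈ Finset.Icc (-(M : ℤ)) (M : ℤ),
    lineFourier c d e (freq T η n) * Complex.exp (Complex.I * freq T η n * x)

/-- The Euclidean-time propagator at temperature `T`. -/
def thermalFun (c d : ℂ) (T ζ e x : ℝ) : ℂ :=
  (1 + occ ζ T e : ℝ) * lineFun c d e x + (occ ζ T e : ℝ) * lineFun c d (-e) x

theorem thermalCutoff_eq (c d : ℂ) {e : ℝ} (he : e ≠ 0) (T η : ℝ) (M : ℕ) (x : ℝ) :
    thermalCutoff c d T η e M x =
      (c + e * d) * (T * ∑ n ∈ Finset.Icc (-(M : ℤ)) (M : ℤ),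
        expCoeff T η e n * Complex.exp (Complex.I * freq T η n * x)) -
      (c - e * d) * (T * ∑ n ∈ Finset.Icc (-(M : ℤ)) (M : ℤ),
        expCoeff T η (-e) n * Complex.exp (Complex.I * freq T η n * x)) := by
  rw [thermalCutoff]
  simp_rw [Finset.mul_sum, lineFourier_freq c d he]
  rw [← Finset.sum_sub_distrib]
  exact Finset.sum_congr rfl fun n _ => by ring

theorem exists_norm_thermalCutoff_le (c d : ℂ) {e T : ℝ} (he : e ≠ 0) (hT : 0 < T) (η : ℝ) :
    ∃ C : ℝ, ∀ (M : ℕ) (x : ℝ), ‖thermalCutoff c d T η e M x‖ ≤ C := by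
  obtain ⟨C₁, h₁⟩ := exists_norm_sum_expCoeff_le hT he η
  obtain ⟨C₂, h₂⟩ := exists_norm_sum_expCoeff_le hT (neg_ne_zero.mpr he) η
  refine ⟨‖c + e * d‖ * (T * C₁) + ‖c - e * d‖ * (T * C₂), fun M x => ?_⟩
  rw [thermalCutoff_eq c d he]
  refine (norm_sub_le _ _).trans (add_le_add ?_ ?_)
  all_goals
    rw [norm_mul, norm_mul, Complex.norm_real, Real.norm_of_nonneg hT.le]
    gcongr
    first
    | exact h₁ M x
    | exact h₂ M x

theorem tendsto_thermalCutoff_pos {η ζ : ℝ} (h : IsStatistics η ζ) (c d : ℂ) {e T x : ℝ}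
    (he : 0 < e) (hT : 0 < T) (hx0 : 0 < x) (hx1 : x < 1 / T) :
    Tendsto (fun M => thermalCutoff c d T η e M x) atTop (𝓝 (thermalFun c d T ζ e x)) := by
  have h1 := tendsto_sum_expCoeff h hT he.ne' (occ_denom_ne_zero h.sq_eq hT he.ne') hx0 hx1
  have h2 := tendsto_sum_expCoeff h hT (neg_ne_zero.mpr he.ne')
    (occ_denom_ne_zero h.sq_eq hT (neg_ne_zero.mpr he.ne')) hx0 hx1
  have h3 := (h1.const_mul (c + e * d)).sub (h2.const_mul (c - e * d))
  simp_rw [thermalCutoff_eq c d he.ne']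
  convert h3 using 1
  congr 1
  have h4 := occ_neg h.sq_eq hT he.ne'
  change _ = (c + e * d) * ((occ ζ T e : ℝ) * _) - (c - e * d) * ((occ ζ T (-e) : ℝ) * _)
  rw [h4, thermalFun, lineFun_of_pos _ _ _ hx0, lineFun_of_pos _ _ _ hx0]
  push_cast
  rw [neg_neg]
  ring

/-- The shift moves x from the negative to the positive branch, and the two KMS relations exchange
the terms with energies e and -e. -/
theorem thermalFun_add_period {ζ : ℝ} (hζ : ζ * ζ = 1) (c d : ℂ) {e T x : ℝ}
    (he : 0 < e) (hT : 0 < T) (hx0 : x < 0) (hx1 : -(1 / T) < x) :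
    thermalFun c d T ζ e (x + 1 / T) = ζ * thermalFun c d T ζ e x := by
  have hpos : 0 < x + 1 / T := by linarith
  rw [thermalFun, thermalFun, lineFun_of_pos _ _ _ hpos, lineFun_of_pos _ _ _ hpos,
    lineFun_of_neg _ _ _ hx0, lineFun_of_neg _ _ _ hx0]
  have h1 : ((occ ζ T e : ℝ) : ℂ) * Complex.exp (e / T) = ζ * (1 + (occ ζ T e : ℝ)) := by
    have := congrArg (fun r : ℝ => (r : ℂ)) (occ_kms hζ hT he.ne')
    push_cast at this
    exact this
  have h2 : (1 + ((occ ζ T e : ℝ) : ℂ)) * Complex.exp (-(e / T)) = ζ * (occ ζ T e : ℝ) := by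
    have := congrArg (fun r : ℝ => (r : ℂ)) (occ_kms' hζ hT he.ne')
    push_cast at this
    exact this
  have e1 : Complex.exp (-(e : ℂ) * ((x + 1 / T : ℝ) : ℂ)) =
      Complex.exp (-(e / T)) * Complex.exp (-(e : ℂ) * x) := by
    rw [← Complex.exp_add]
    congr 1
    push_cast
    ring
  have e2 : Complex.exp (-((-e : ℝ) : ℂ) * ((x + 1 / T : ℝ) : ℂ)) =
      Complex.exp (e / T) * Complex.exp ((e : ℂ) * x) := by
    rw [← Complex.exp_add]
    congr 1
    push_cast
    ring
  rw [e1, e2]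
  push_cast
  linear_combination (c + e * d) * Complex.exp (e * x) * h1 +
    (c - e * d) * Complex.exp (-e * x) * h2

theorem thermalCutoff_add_period {η ζ : ℝ} (h : IsStatistics η ζ) (c d : ℂ) {e T : ℝ} (x : ℝ)
    (hT : 0 < T) (M : ℕ) :
    thermalCutoff c d T η e M (x + 1 / T) = ζ * thermalCutoff c d T η e M x := by
  simp only [thermalCutoff]
  rw [mul_left_comm, Finset.mul_sum (a := (ζ : ℂ))]
  congr 1
  refine Finset.sum_congr rfl fun n _ => ?_
  rw [← h.exp_freq hT n, Complex.ofReal_add, mul_add, Complex.exp_add]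
  ring

theorem summable_expCoeff_pair {T e : ℝ} (hT : 0 < T) (η : ℝ) :
    Summable fun n : ℤ => lineFourier 1 0 e (freq T η n) := by
  have h1 := ((summable_one_div_sq_add_freq (a := e) hT η).mul_left (2 * e))
  have h2 : Summable fun n : ℤ => ((2 * e * (1 / (e ^ 2 + freq T η n ^ 2)) : ℝ) : ℂ) :=
    Complex.ofRealCLM.summable h1
  refine h2.congr fun n => ?_
  rw [lineFourier]
  push_cast
  rw [add_comm]
  ring

/-- With numerator 1 the coefficients are summable, so the Fourier series of N exp(ey) + (1 + N)
exp(-ey), with the shift phase split off, converges even at the endpoint 0; the KMS relations make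
the endpoint values match. -/
theorem tendsto_thermalCutoff_even_zero {η ζ : ℝ} (h : IsStatistics η ζ) {e T : ℝ}
    (he : 0 < e) (hT : 0 < T) :
    Tendsto (fun M => thermalCutoff 1 0 T η e M 0) atTop (𝓝 (1 + 2 * (occ ζ T e : ℝ))) := by
  have hTc : (T : ℂ) ≠ 0 := by exact_mod_cast hT.ne'
  set N : ℂ := ((occ ζ T e : ℝ) : ℂ) with hN
  have hk1 : N * (ζ * Complex.exp (e / T) - 1) = 1 := by
    have hd := occ_denom_ne_zero h.sq_eq hT he.ne'
    have : occ ζ T e * (ζ * Real.exp (e / T) - 1) = 1 := by rw [occ]; field_simp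
    have := congrArg (fun r : ℝ => (r : ℂ)) this
    push_cast at this
    exact this
  have hk2 : (1 + N) * (ζ * Complex.exp (-(e / T)) - 1) = -1 := by
    have h1 := occ_kms' h.sq_eq hT he.ne'
    have : (1 + occ ζ T e) * (ζ * Real.exp (-(e / T)) - 1) = -1 := by
      linear_combination ζ * h1 + occ ζ T e * h.sq_eq
    have := congrArg (fun r : ℝ => (r : ℂ)) this
    push_cast at this
    exact this
  set g : ℝ → ℤ → ℝ → ℂ := fun a m y => Complex.exp ((a - Complex.I * freq T η m) * y) with hg
  have hcont : ∀ a m, Continuous (g a m) := fun a m => by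
    simp only [hg]
    fun_prop
  have hgper : ∀ (a : ℝ) (m : ℤ), g a m (1 / T) = ζ * Complex.exp (a / T) := by
    intro a m
    simp only [hg]
    rw [sub_mul, sub_eq_add_neg (_ * _) (_ * _), Complex.exp_add, h.exp_neg_freq hT, mul_comm]
    push_cast
    rw [show (a : ℂ) * (1 / T) = a / T by ring]
  have hgval : ∀ (a : ℝ), a ≠ 0 → ∀ m : ℤ, ∫ y in (0 : ℝ)..(1 / T), g a m y =
      (ζ * Complex.exp (a / T) - 1) * expCoeff T η a m := by
    intro a ha m
    have h1 := hgper a m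
    simp only [hg] at h1 ⊢
    rw [integral_exp_mul (sub_I_mul_ne_zero ha _), expCoeff, h1]
    ring
  have hmul : ∀ (a : ℝ) (n : ℤ) (y : ℝ),
      Complex.exp (-(2 * Real.pi * Complex.I * n * y / (1 / T : ℝ))) * g a 0 y = g a n y := by
    intro a n y
    rw [hg, ← Complex.exp_add]
    congr 1
    simp only [freq]
    push_cast
    field_simp
    ring
  have hsum := hasSum_fourier_of_integral (β := 1 / T) (by positivity)
    (h := fun y => N * g e 0 y + (1 + N) * g (-e) 0 y) (by
      have := hcont e 0
      have := hcont (-e) 0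
      fun_prop)
    (by
      rw [hgper, hgper]
      push_cast
      rw [neg_div]
      simp only [hg, Complex.ofReal_zero, mul_zero, Complex.exp_zero]
      linear_combination -hk1 - hk2)
    (q := fun n => T * lineFourier 1 0 e (freq T η n))
    (by
      intro n
      have hfun : ∀ y : ℝ, Complex.exp (-(2 * Real.pi * Complex.I * n * y / (1 / T : ℝ))) *
          (N * g e 0 y + (1 + N) * g (-e) 0 y) = N * g e n y + (1 + N) * g (-e) n y := by
        intro y
        rw [← hmul e n, ← hmul (-e) n]
        ring
      simp_rw [hfun]
      rw [intervalIntegral.integral_add (((hcont _ _).intervalIntegrable _ _).const_mul _)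
        (((hcont _ _).intervalIntegrable _ _).const_mul _), intervalIntegral.integral_const_mul,
        intervalIntegral.integral_const_mul, hgval e he.ne', hgval (-e) (neg_ne_zero.mpr he.ne'),
        lineFourier_freq _ _ he.ne']
      push_cast
      rw [neg_div]
      field_simp
      linear_combination expCoeff T η e n * hk1 + expCoeff T η (-e) n * hk2)
    ((summable_expCoeff_pair hT η).mul_left _) (x := 0) ⟨le_rfl, by positivity⟩
  have hlim := hsum.comp tendsto_Icc_neg
  have hv : N * g e 0 0 + (1 + N) * g (-e) 0 0 = 1 + 2 * N := by
    simp [hg]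
    ring
  rw [hv] at hlim
  refine hlim.congr fun M => ?_
  simp only [Function.comp, thermalCutoff]
  rw [Finset.mul_sum]
  refine Finset.sum_congr rfl fun n _ => ?_
  simp

/-- Integer frequencies cancel exactly under n ↦ -n. Half-integer ones pair n with -1-n, which in
the symmetric range leaves the single term n = M; hence the decay hypothesis. -/
theorem sum_Icc_of_antisymm {f : ℤ → ℂ} (h : (∀ n, f (-n) = -f n) ∨ ∀ n, f (-1 - n) = -f n)
    (hf : Tendsto (fun M : ℕ => f M) atTop (𝓝 0)) :
    Tendsto (fun M : ℕ => ∑ n ∈ Finset.Icc (-(M : ℤ)) (M : ℤ), f n) atTop (𝓝 0) := by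
  rcases h with h | h
  · refine tendsto_const_nhds.congr fun M => ?_
    induction M with
    | zero =>
      have h0 := h 0
      rw [neg_zero] at h0
      simp only [Nat.cast_zero, neg_zero, Finset.Icc_self, Finset.sum_singleton]
      linear_combination -(1 / 2 : ℂ) * h0
    | succ m ih =>
      rw [sum_Icc_neg_succ, ← ih, h]
      ring
  · refine hf.congr fun M => ?_
    induction M with
    | zero => simp
    | succ m ih =>
      have := h m
      rw [sum_Icc_neg_succ, ← ih, show (-((m : ℤ) + 1)) = -1 - m by ring, this]
      push_cast
      ring

/-- The even part converges absolutely. The odd part cancels by symmetry of the frequencies, which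
is why only the shifts 0 and 1/2 are admitted. -/
theorem tendsto_thermalCutoff_zero {η ζ : ℝ} (h : IsStatistics η ζ) (hη : η = 0 ∨ η = 1 / 2)
    (c d : ℂ) {e T : ℝ} (he : 0 < e) (hT : 0 < T) :
    Tendsto (fun M => thermalCutoff c d T η e M 0) atTop (𝓝 (thermalFun c d T ζ e 0)) := by
  have hodd : Tendsto (fun M : ℕ => ∑ n ∈ Finset.Icc (-(M : ℤ)) (M : ℤ),
      (oddPart e (freq T η n) : ℂ)) atTop (𝓝 0) := by
    refine sum_Icc_of_antisymm ?_ ?_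
    · rcases hη with hη | hη
      · left
        intro n
        have : freq T η (-n) = -freq T η n := by
          rw [freq, freq, hη]
          push_cast
          ring
        rw [this, oddPart_neg]
        push_cast
        rfl
      · right
        intro n
        have : freq T η (-1 - n) = -freq T η n := by
          rw [freq, freq, hη]
          push_cast
          ring
        rw [this, oddPart_neg]
        push_cast
        rfl
    · have hrw : ∀ n : ℤ, (oddPart e (freq T η n) : ℂ) =
          -Complex.I / 2 * (expCoeff T η e n + expCoeff T η (-e) n) := by
        intro n
        rw [oddPart, expCoeff, expCoeff]
        have h1 := add_I_mul_ne_zero he.ne' (freq T η n)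
        have h2 := sub_I_mul_ne_zero he.ne' (freq T η n)
        have h3 : ((-e : ℝ) : ℂ) - Complex.I * freq T η n = -(e + Complex.I * freq T η n) := by
          push_cast
          ring
        have h4 : (freq T η n : ℂ) = -Complex.I / 2 *
            ((e + Complex.I * freq T η n) - (e - Complex.I * freq T η n)) := by
          linear_combination (freq T η n : ℂ) * Complex.I_sq
        rw [h3, Complex.ofReal_div, sq_add_sq_factor]
        calc _ = (-Complex.I / 2 * ((e + Complex.I * freq T η n) - (e - Complex.I * freq T η n))) /
              ((e + Complex.I * freq T η n) * (e - Complex.I * freq T η n)) := by rw [← h4]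
          _ = _ := by
            generalize (e + Complex.I * freq T η n : ℂ) = A at *
            generalize (e - Complex.I * freq T η n : ℂ) = B at *
            field_simp
            ring
      simp_rw [hrw]
      have h1 := tendsto_expCoeff hT η e 1 (by simp) 0
      have h2 := tendsto_expCoeff hT η (-e) 1 (by simp) 0
      simpa using (h1.add h2).const_mul (-Complex.I / 2)
  have h1 := ((tendsto_thermalCutoff_even_zero h he hT).const_mul c).add
    (hodd.const_mul (T * (2 * e * Complex.I * d)))
  have hv : c * (1 + 2 * (occ ζ T e : ℝ)) + T * (2 * e * Complex.I * d) * 0 =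
      thermalFun c d T ζ e 0 := by
    rw [thermalFun, lineFun_zero, lineFun_zero]
    push_cast
    ring
  rw [hv] at h1
  refine h1.congr fun M => ?_
  simp only [thermalCutoff]
  rw [mul_left_comm, mul_assoc (T : ℂ), ← mul_add, Finset.mul_sum,
    Finset.mul_sum, ← Finset.sum_add_distrib]
  congr 1
  refine Finset.sum_congr rfl fun n _ => ?_
  rw [lineFourier, lineFourier, oddPart, Complex.ofReal_zero, mul_zero, Complex.exp_zero]
  push_cast
  ring

theorem tendsto_thermalCutoff {η ζ : ℝ} (h : IsStatistics η ζ) (hη : η = 0 ∨ η = 1 / 2)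
    (c d : ℂ) {e T x : ℝ} (he : 0 < e) (hT : 0 < T) (hx : |x| < 1 / T) :
    Tendsto (fun M => thermalCutoff c d T η e M x) atTop (𝓝 (thermalFun c d T ζ e x)) := by
  rw [abs_lt] at hx
  rcases lt_trichotomy x 0 with hx0 | rfl | hx0
  · have h1 := tendsto_thermalCutoff_pos h c d he hT (x := x + 1 / T) (by linarith) (by linarith)
    simp_rw [thermalCutoff_add_period h c d x hT,
      thermalFun_add_period h.sq_eq c d he hT hx0 hx.1] at h1
    have h2 := h1.const_mul (ζ : ℂ)
    have hζ : (ζ : ℂ) * ζ = 1 := by exact_mod_cast h.sq_eq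
    simpa only [← mul_assoc, hζ, one_mul] using h2
  · exact tendsto_thermalCutoff_zero h hη c d he hT
  · exact tendsto_thermalCutoff_pos h c d he hT hx0 hx.2

end FeynmanGraph

end

noncomputable section

namespace FeynmanGraph

open MeasureTheory Filter Topology

set_option linter.unusedSectionVars false

variable {V Line : Type*} [Fintype V] [DecidableEq V] [Fintype Line] [DecidableEq Line]

/-! ### Energy conservation -/

theorem ConnectedBy.joins {G : FeynmanGraph V Line} {t : Finset Line} (h : G.ConnectedBy t) :
    Joins (fun j : {i // i ∈ t} => G.src j) (fun j : {i // i ∈ t} => G.tgt j) := by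
  intro K f hf v w
  obtain ⟨walk⟩ := h.preconnected v w
  induction walk with
  | nil => rfl
  | cons hadj _ ih =>
    refine Eq.trans ?_ ih
    rw [SimpleGraph.fromRel_adj] at hadj
    rcases hadj.2 with ⟨i, hi, h1, h2⟩ | ⟨i, hi, h1, h2⟩
    · rw [← h1, ← h2]
      exact hf ⟨i, hi⟩
    · rw [← h1, ← h2]
      exact (hf ⟨i, hi⟩).symm

/-- The energy entering the vertex `v` minus the energy leaving it. -/
def excess (G : FeynmanGraph V Line) (p : V → ℝ) (k : Line → ℝ) (v : V) : ℝ :=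
  p v + ∑ i with G.tgt i = v, k i - ∑ i with G.src i = v, k i

theorem isConserved_iff (G : FeynmanGraph V Line) (p : V → ℝ) (k : Line → ℝ) :
    G.IsConserved p k ↔ ∀ v, G.excess p k v = 0 :=
  forall_congr' fun _ => sub_eq_zero.symm

/-- Summation by parts on the graph: it trades phases at the vertices for energies times time
differences along the lines. -/
theorem sum_mul_excess (G : FeynmanGraph V Line) (p : V → ℝ) (k : Line → ℝ) (τ : V → ℝ) :
    ∑ v, τ v * G.excess p k v = ∑ v, p v * τ v + ∑ i, k i * (τ (G.tgt i) - τ (G.src i)) := by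
  have h : ∀ e : Line → V, ∑ v, τ v * ∑ i with e i = v, k i = ∑ i, k i * τ (e i) := by
    intro e
    rw [← Finset.sum_fiberwise Finset.univ e]
    refine Finset.sum_congr rfl fun v _ => ?_
    rw [Finset.mul_sum]
    refine Finset.sum_congr rfl fun i hi => ?_
    rw [(Finset.mem_filter.mp hi).2, mul_comm]
  simp only [excess, mul_sub, mul_add, Finset.sum_sub_distrib, Finset.sum_add_distrib, h]
  simp only [mul_comm (τ _)]
  ring

/-- Every line leaves one vertex and enters one, so the excesses add up to the total external energy
0, and conservation at the root follows from the others. -/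
theorem isConserved_of_ne (G : FeynmanGraph V Line) {p : V → ℝ} (hp : ∑ v, p v = 0)
    {k : Line → ℝ} (r : V) (h : ∀ v, v ≠ r → G.excess p k v = 0) : G.IsConserved p k := by
  rw [isConserved_iff]
  have h1 := G.sum_mul_excess p k fun _ => 1
  simp only [one_mul, mul_one, sub_self, mul_zero, Finset.sum_const_zero, add_zero, hp] at h1
  intro v
  by_cases hv : v = r
  · rw [Finset.sum_eq_single r (fun w _ hw => h w hw) (by simp)] at h1
    rw [hv, h1]
  · exact h v hv

omit [Fintype V] [DecidableEq V] in
theorem prod_split {A : Type*} [CommMonoid A] (t : Finset Line) (f : Line → A) :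
    ∏ i, f i = (∏ j : {i // i ∈ t}, f j) * ∏ l : {i // i ∉ t}, f l := by
  rw [← Fintype.prod_subtype_mul_prod_subtype (· ∈ t)]
  congr!

omit [Fintype V] [DecidableEq V] in
theorem sum_split {A : Type*} [AddCommMonoid A] (t : Finset Line) (f : Line → A) :
    ∑ i, f i = (∑ j : {i // i ∈ t}, f j) + ∑ l : {i // i ∉ t}, f l := by
  rw [← Fintype.sum_subtype_add_sum_subtype (· ∈ t)]
  congr!

theorem exists_isConserved (G : FeynmanGraph V Line) {t : Finset Line} (ht : G.IsSpanningTree t)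
    {p : V → ℝ} (hp : ∑ v, p v = 0) (q : {i : Line // i ∉ t} → ℝ) :
    ∃ k : Line → ℝ, G.IsConserved p k ∧ ∀ l : {i : Line // i ∉ t}, k l = q l := by
  obtain ⟨r⟩ := ht.1.nonempty
  obtain ⟨e⟩ := exists_equiv_of_card (J := {i // i ∈ t}) r (by simpa using ht.2)
  set A := ((incidence (fun j : {i // i ∈ t} => G.src j) (fun j => G.tgt j) r).submatrix id e).map
    (Int.cast : ℤ → ℝ) with hA
  have hdet : IsUnit A.det := by
    have h1 := (Int.castRingHom ℝ).map_det ((incidence (fun j : {i // i ∈ t} => G.src j)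
      (fun j => G.tgt j) r).submatrix id e)
    have h2 : A = (Int.castRingHom ℝ).mapMatrix ((incidence (fun j : {i // i ∈ t} => G.src j)
      (fun j => G.tgt j) r).submatrix id e) := rfl
    rw [h2, ← h1]
    have h3 := isUnit_det_incidence ht.1.joins r e
    exact (Int.isUnit_iff_abs_eq.mpr h3).map _
  -- `b` is the imbalance with the tree energies set to 0. The tree energies `y` cancel it at all
  -- vertices but the root, the tree incidence matrix being invertible.
  let b : V → ℝ := G.excess p fun i => if h : i ∉ t then q ⟨i, h⟩ else 0
  let y : {i // i ∈ t} → ℝ := Matrix.vecMul (fun j => -b (e j)) A⁻¹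
  have hy : Matrix.vecMul y A = fun j => -b (e j) := by
    rw [Matrix.vecMul_vecMul, Matrix.nonsing_inv_mul _ hdet, Matrix.vecMul_one]
  let k : Line → ℝ := fun i => if h : i ∈ t then y ⟨i, h⟩ else q ⟨i, h⟩
  refine ⟨k, G.isConserved_of_ne hp r fun v hv => ?_, fun l => by simp [k, l.2]⟩
  have h1 := congrFun hy (e.symm ⟨v, hv⟩)
  simp only [Matrix.vecMul, dotProduct, hA, Matrix.map_apply, Matrix.submatrix_apply, id,
    incidence, Matrix.of_apply, Equiv.apply_symm_apply] at h1
  have h2 : ∀ f : Line → V, ∑ i with f i = v, k i =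
      ∑ i with f i = v, (if h : i ∉ t then q ⟨i, h⟩ else 0) +
      ∑ j : {i // i ∈ t}, y j * (if f j = v then 1 else 0) := by
    intro f
    rw [Finset.sum_filter, Finset.sum_filter, sum_split t, sum_split t (fun i => if f i = v then
        (if h : i ∉ t then q ⟨i, h⟩ else 0) else 0)]
    have h3 : ∑ i : {i // i ∈ t}, (if f i = v then (if h : (i : Line) ∉ t then q ⟨i, h⟩ else 0)
        else 0) = 0 := Finset.sum_eq_zero fun i _ => by simp [i.2]
    have h4 : ∑ i : {i // i ∉ t}, (if f i = v then k i else 0) =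
        ∑ i : {i // i ∉ t}, (if f i = v then (if h : (i : Line) ∉ t then q ⟨i, h⟩ else 0)
        else 0) := Finset.sum_congr rfl fun i _ => by simp [k, i.2]
    rw [h3, h4, zero_add, add_comm]
    congr 1
    refine Finset.sum_congr rfl fun i _ => ?_
    simp [k, i.2]
  have h5 : G.excess p k v = b v + ∑ j : {i // i ∈ t}, y j *
      ((if G.tgt j = v then 1 else 0) - (if G.src j = v then 1 else 0)) := by
    simp only [excess, b, h2, mul_sub, Finset.sum_sub_distrib]
    ring
  rw [h5]
  push_cast at h1
  rw [h1]
  ring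

theorem flow_spec (G : FeynmanGraph V Line) {t : Finset Line} (ht : G.IsSpanningTree t)
    {p : V → ℝ} (hp : ∑ v, p v = 0) (q : {i : Line // i ∉ t} → ℝ) :
    G.IsConserved p (G.flow t p q) ∧ ∀ l : {i : Line // i ∉ t}, G.flow t p q l = q l := by
  have h := G.exists_isConserved ht hp q
  rw [flow, dif_pos h]
  exact h.choose_spec

/-! ### Spin components of the propagators -/

/-- The part of the numerator of a propagator which does not depend on the energy. -/
def numConst (G : FeynmanGraph V Line) (s : {i : Line // i ∈ G.fermionic} → Fin 4 × Fin 4)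
    (i : Line) : ℂ :=
  if h : i ∈ G.fermionic then
    ((G.mass i : ℂ) • (1 : Matrix (Fin 4) (Fin 4) ℂ) -
      ∑ j : Fin 3, (G.momentum i j : ℂ) • G.gamma j.succ) (s ⟨i, h⟩).1 (s ⟨i, h⟩).2
  else 1

/-- The coefficient of `i k` in the numerator of a propagator. -/
def numLin (G : FeynmanGraph V Line) (s : {i : Line // i ∈ G.fermionic} → Fin 4 × Fin 4)
    (i : Line) : ℂ :=
  if h : i ∈ G.fermionic then G.gamma 0 (s ⟨i, h⟩).1 (s ⟨i, h⟩).2 else 0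

/-- With spin indices fixed, every numerator has the form c + ikd, scalar lines having c = 1 and d =
0. Both kinds of lines are thereby treated alike, and `γ_E` supplies the factors 2E. -/
theorem gammaE_mul_propagators (G : FeynmanGraph V Line) (k E : Line → ℝ) :
    G.gammaE E * G.propagators k E =
      ∑ s, G.spin s * ∏ i, lineFourier (G.numConst s i) (G.numLin s i) (E i) (k i) := by
  rw [propagators, Finset.mul_sum]
  refine Finset.sum_congr rfl fun s _ => ?_
  rw [mul_left_comm, gammaE, ← Finset.prod_mul_distrib]
  congr 1
  refine Finset.prod_congr rfl fun i _ => ?_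
  by_cases h : i ∈ G.fermionic
  · simp only [h, dif_pos, fermionPropagator, lineFourier, numConst, numLin, Matrix.smul_apply,
      Matrix.sub_apply, Matrix.add_apply, smul_eq_mul]
    push_cast
    ring
  · simp only [h, dif_neg, not_false_eq_true, scalarPropagator, lineFourier, numConst, numLin]
    push_cast
    ring

/-- The integrand of the Euclidean-time representation. -/
def timeFun (G : FeynmanGraph V Line) (r : V) (p : V → ℝ) (g : Line → ℝ → ℂ)
    (τ : {v : V // v ≠ r} → ℝ) : ℂ :=
  Complex.exp (Complex.I * (∑ v, p v * rootExt r τ v : ℝ)) *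
    ∏ i, g i (edgeDiff G.src G.tgt r τ i)

/-! ### The zero-temperature function in Euclidean time -/

theorem continuous_lineCutoff (c d : ℂ) {e : ℝ} (he : e ≠ 0) (Λ : ℝ) :
    Continuous (lineCutoff c d e Λ) := by
  unfold lineCutoff
  refine Continuous.mul continuous_const ?_
  refine intervalIntegral.continuous_parametric_intervalIntegral_of_continuous' ?_ _ _
  have := continuous_lineFourier c d he
  fun_prop

theorem norm_exp_I_ofReal (x : ℝ) : ‖Complex.exp (Complex.I * x)‖ = 1 := by
  rw [mul_comm, Complex.norm_exp_ofReal_mul_I]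

theorem continuous_phase (r : V) (p : V → ℝ) : Continuous fun τ : {v : V // v ≠ r} → ℝ =>
    Complex.exp (Complex.I * (∑ v, p v * rootExt r τ v : ℝ)) := by
  have : Continuous fun τ : {v : V // v ≠ r} → ℝ => ∑ v, p v * rootExt r τ v :=
    continuous_finsetSum _ fun v _ => continuous_const.mul (continuous_rootExt r v)
  fun_prop

section ZeroTemperature

variable (G : FeynmanGraph V Line) {t : Finset Line} (ht : G.IsSpanningTree t) {p : V → ℝ}
  (hp : ∑ v, p v = 0) (r : V) (c d : Line → ℂ) {E : Line → ℝ} (hE : ∀ i, 0 < E i)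

/-- The product over the tree lines, including the phase of the external energies. -/
def treeFun (G : FeynmanGraph V Line) (t : Finset Line) (p : V → ℝ) (r : V) (c d : Line → ℂ)
    (E : Line → ℝ) (τ : {v : V // v ≠ r} → ℝ) : ℂ :=
  Complex.exp (Complex.I * (∑ v, p v * rootExt r τ v : ℝ)) *
    ∏ j : {i // i ∈ t}, lineFun (c j) (d j) (E j) (edgeDiff G.src G.tgt r τ j)

-- The time differences along a spanning tree are coordinates for the vertex times, so decay along
-- the tree lines alone gives integrability. The lines outside the tree only need to stay bounded.
include ht hE in
theorem integrable_treeFun : Integrable (treeFun G t p r c d E) := by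
  have h1 : Integrable fun x : {i // i ∈ t} → ℝ => ∏ j : {i // i ∈ t}, lineFun (c j) (d j) (E j) (x j) :=
    Integrable.fintype_prod fun j => integrable_lineFun (c j) (d j) (hE j)
  have h2 := ((measurePreserving_edgeDiff ht.1.joins (by simpa using ht.2) r).integrable_comp_emb
    (measurableEmbedding_edgeDiff ht.1.joins r)).mpr h1
  exact h2.bdd_mul (c := 1) (continuous_phase r p).aestronglyMeasurable
    (Eventually.of_forall fun τ => (norm_exp_I_ofReal _).le)

/-- The phase of the lines outside the tree. -/
def cotreePhase (G : FeynmanGraph V Line) (t : Finset Line) (r : V)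
    (z : ({i : Line // i ∉ t} → ℝ) × ({v : V // v ≠ r} → ℝ)) : ℂ :=
  ∏ l, Complex.exp (Complex.I * z.1 l * edgeDiff G.src G.tgt r z.2 l)

-- The tree factors are written as Fourier integrals over the tree time differences. Conservation
-- makes the vertex sum in `sum_mul_excess` vanish, which converts the tree phases into the external
-- phase and the phases of the independent energies.
include ht hp hE in
theorem prod_lineFourier_flow (q : {i : Line // i ∉ t} → ℝ) :
    ∏ i, lineFourier (c i) (d i) (E i) (G.flow t p q i) =
      ∫ τ, (∏ l : {i : Line // i ∉ t}, lineFourier (c l) (d l) (E l) (q l)) * treeFun G t p r c d E τ *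
        cotreePhase G t r (q, τ) := by
  obtain ⟨hcons, hq⟩ := G.flow_spec ht hp q
  set k := G.flow t p q with hk
  rw [prod_split t]
  have h1 : ∏ j : {i // i ∈ t}, lineFourier (c j) (d j) (E j) (k j) =
      ∫ x : {i // i ∈ t} → ℝ, ∏ j : {i // i ∈ t}, (lineFun (c j) (d j) (E j) (x j) *
        Complex.exp (-(Complex.I * k j * x j))) := by
    rw [volume_pi, integral_fintype_prod_eq_prod (fun (j : {i // i ∈ t}) (x : ℝ) =>
      lineFun (c j) (d j) (E j) x * Complex.exp (-(Complex.I * k j * x)))]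
    exact Finset.prod_congr rfl fun j _ => (integral_lineFun_mul_exp _ _ (hE j) _).symm
  rw [h1, ← (measurePreserving_edgeDiff ht.1.joins (by simpa using ht.2) r).integral_comp
    (measurableEmbedding_edgeDiff ht.1.joins r), mul_comm, ← integral_const_mul]
  refine integral_congr_ae (Eventually.of_forall fun τ => ?_)
  have h2 := G.sum_mul_excess p k (rootExt r τ)
  have h3 : ∑ v, rootExt r τ v * G.excess p k v = 0 :=
    Finset.sum_eq_zero fun v _ => by rw [(G.isConserved_iff p k).mp hcons v, mul_zero]
  rw [h3, sum_split t] at h2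
  have h4 : ∏ j : {i // i ∈ t}, Complex.exp (-(Complex.I * k j *
        edgeDiff (fun j : {i // i ∈ t} => G.src j) (fun j => G.tgt j) r τ j)) =
      Complex.exp (Complex.I * (∑ v, p v * rootExt r τ v : ℝ)) * cotreePhase G t r (q, τ) := by
    rw [cotreePhase, ← Complex.exp_sum, ← Complex.exp_sum, ← Complex.exp_add]
    congr 1
    have h5 := congrArg (fun x : ℝ => Complex.I * (x : ℂ)) h2
    simp only [mul_add, Complex.ofReal_add, Complex.ofReal_zero, mul_zero] at h5
    have h6 : ∑ l : {i : Line // i ∉ t}, Complex.I * (q l : ℂ) * edgeDiff G.src G.tgt r τ l =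
        Complex.I * ((∑ x : {i // i ∉ t},
          k x * (rootExt r τ (G.tgt x) - rootExt r τ (G.src x)) : ℝ) : ℂ) := by
      push_cast
      rw [Finset.mul_sum]
      refine Finset.sum_congr rfl fun l _ => ?_
      rw [hq l, edgeDiff]
      push_cast
      ring
    have h7 : ∑ j : {i // i ∈ t}, -(Complex.I * k j *
        edgeDiff (fun j : {i // i ∈ t} => G.src j) (fun j => G.tgt j) r τ j) =
        -(Complex.I * ((∑ x : {i // i ∈ t},
          k x * (rootExt r τ (G.tgt x) - rootExt r τ (G.src x)) : ℝ) : ℂ)) := by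
      push_cast
      rw [Finset.mul_sum, ← Finset.sum_neg_distrib]
      refine Finset.sum_congr rfl fun l _ => ?_
      rw [edgeDiff]
      push_cast
      ring
    rw [h6, h7]
    linear_combination h5
  have h8 : ∏ l : {i : Line // i ∉ t}, lineFourier (c l) (d l) (E l) (k l) =
      ∏ l : {i : Line // i ∉ t}, lineFourier (c l) (d l) (E l) (q l) :=
    Finset.prod_congr rfl fun l _ => by rw [hq l]
  simp only [Finset.prod_mul_distrib, h4, treeFun]
  rw [h8]
  simp only [edgeDiff]
  ring

include ht hE in
theorem integrable_cotree_tree (Λ : ℝ) :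
    Integrable (fun z : ({i : Line // i ∉ t} → ℝ) × ({v : V // v ≠ r} → ℝ) =>
      (∏ l : {i : Line // i ∉ t}, lineFourier (c l) (d l) (E l) (z.1 l)) * treeFun G t p r c d E z.2 *
        cotreePhase G t r z)
      ((volume.restrict (Set.Icc (fun _ => -Λ) (fun _ => Λ))).prod volume) := by
  have hc : Continuous fun q : {i : Line // i ∉ t} → ℝ =>
      ∏ l : {i : Line // i ∉ t}, lineFourier (c l) (d l) (E l) (q l) :=
    continuous_finsetProd _ fun l _ =>
      (continuous_lineFourier (c l) (d l) (hE l).ne').comp (continuous_apply l)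
  have h1 : IntegrableOn (fun q : {i : Line // i ∉ t} → ℝ =>
      ∏ l : {i : Line // i ∉ t}, lineFourier (c l) (d l) (E l) (q l)) (Set.Icc (fun _ => -Λ) (fun _ => Λ)) :=
    hc.continuousOn.integrableOn_compact isCompact_Icc
  refine (h1.mul_prod (integrable_treeFun G ht r c d hE)).mul_bdd (c := 1) ?_ ?_
  · refine Continuous.aestronglyMeasurable ?_
    refine continuous_finsetProd _ fun l _ => ?_
    have h2 : Continuous fun z : ({i : Line // i ∉ t} → ℝ) × ({v : V // v ≠ r} → ℝ) =>
        edgeDiff G.src G.tgt r z.2 l :=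
      (continuous_apply (l : Line)).comp ((continuous_edgeDiff G.src G.tgt r).comp continuous_snd)
    fun_prop
  · refine Eventually.of_forall fun z => ?_
    rw [cotreePhase, norm_prod]
    exact (Finset.prod_eq_one fun l _ => norm_exp_I_mul_mul _ _).le

include ht hp hE in
theorem integrableOn_prod_lineFourier_flow (Λ : ℝ) :
    IntegrableOn (fun q => ∏ i, lineFourier (c i) (d i) (E i) (G.flow t p q i))
      (Set.Icc (fun _ => -Λ) (fun _ => Λ)) := by
  obtain ⟨r⟩ := ht.1.nonempty
  simp_rw [IntegrableOn, prod_lineFourier_flow G ht hp r c d hE]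
  exact (integrable_cotree_tree G ht r c d hE Λ).integral_prod_left

-- With the cutoff in place Fubini applies, and for given times the integral over the independent
-- energies factorizes into one `lineCutoff` for each line outside the tree.
include ht hp hE in
theorem integral_prod_lineFourier_flow {Λ : ℝ} (hΛ : 0 ≤ Λ) :
    (1 / (2 * Real.pi) : ℂ) ^ G.loops * ∫ q in Set.Icc (fun _ : {i : Line // i ∉ t} => -Λ)
      (fun _ => Λ), ∏ i, lineFourier (c i) (d i) (E i) (G.flow t p q i) =
      ∫ τ, treeFun G t p r c d E τ * ∏ l : {i : Line // i ∉ t},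
        lineCutoff (c l) (d l) (E l) Λ (edgeDiff G.src G.tgt r τ l) := by
  have hloops : G.loops = Fintype.card {i : Line // i ∉ t} := by
    rw [Fintype.card_subtype_compl, loops, ← ht.2]
    simp
  have hswap := integral_integral_swap (f := fun q τ =>
    (∏ l : {i : Line // i ∉ t}, lineFourier (c l) (d l) (E l) (q l)) * treeFun G t p r c d E τ *
      cotreePhase G t r (q, τ)) (integrable_cotree_tree G ht r c d hE Λ)
  simp_rw [prod_lineFourier_flow G ht hp r c d hE]
  rw [hswap, ← integral_const_mul]
  refine integral_congr_ae (Eventually.of_forall fun τ => ?_)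
  simp only
  have h1 : ∀ q : {i : Line // i ∉ t} → ℝ,
      (∏ l : {i : Line // i ∉ t}, lineFourier (c l) (d l) (E l) (q l)) * treeFun G t p r c d E τ *
      cotreePhase G t r (q, τ) = treeFun G t p r c d E τ *
      ∏ l : {i : Line // i ∉ t}, (lineFourier (c l) (d l) (E l) (q l) *
        Complex.exp (Complex.I * q l * edgeDiff G.src G.tgt r τ l)) := by
    intro q
    rw [Finset.prod_mul_distrib, cotreePhase]
    ring
  simp_rw [h1]
  rw [integral_const_mul, mul_left_comm]
  congr 1
  rw [← Set.pi_univ_Icc, volume_pi, Measure.restrict_pi_pi,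
    integral_fintype_prod_eq_prod (fun (l : {i : Line // i ∉ t}) (x : ℝ) =>
      lineFourier (c l) (d l) (E l) x * Complex.exp (Complex.I * x * edgeDiff G.src G.tgt r τ l)),
    hloops, ← Finset.card_univ, ← Finset.prod_const, ← Finset.prod_mul_distrib]
  refine Finset.prod_congr rfl fun l _ => ?_
  rw [lineCutoff, intervalIntegral.integral_of_le (by linarith), integral_Icc_eq_integral_Ioc]

-- Dominated convergence: the tree factor is integrable, and the remaining factors are bounded
-- uniformly in the cutoff and the times.
include ht hp hE in
theorem tendsto_integral_prod_lineFourier_flow :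
    Tendsto (fun Λ : ℝ => (1 / (2 * Real.pi) : ℂ) ^ G.loops *
      ∫ q in Set.Icc (fun _ : {i : Line // i ∉ t} => -Λ) (fun _ => Λ),
        ∏ i, lineFourier (c i) (d i) (E i) (G.flow t p q i)) atTop
      (𝓝 (∫ τ, G.timeFun r p (fun i => lineFun (c i) (d i) (E i)) τ)) := by
  choose C hC using fun i => exists_norm_lineCutoff_le (c i) (d i) (hE i)
  have hlim : Tendsto (fun Λ : ℝ => ∫ τ, treeFun G t p r c d E τ * ∏ l : {i : Line // i ∉ t},
      lineCutoff (c l) (d l) (E l) Λ (edgeDiff G.src G.tgt r τ l)) atTop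
      (𝓝 (∫ τ, G.timeFun r p (fun i => lineFun (c i) (d i) (E i)) τ)) := by
    have hint := integrable_treeFun (p := p) G ht r c d hE
    refine tendsto_integral_filter_of_dominated_convergence
      (fun τ => ‖treeFun G t p r c d E τ‖ * ∏ l : {i : Line // i ∉ t}, C l) ?_ ?_
      (hint.norm.mul_const _) ?_
    · refine Eventually.of_forall fun Λ => hint.aestronglyMeasurable.mul ?_
      refine Continuous.aestronglyMeasurable (continuous_finsetProd _ fun l _ => ?_)
      exact (continuous_lineCutoff _ _ (hE l).ne' Λ).comp
        ((continuous_apply (l : Line)).comp (continuous_edgeDiff G.src G.tgt r))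
    · filter_upwards [eventually_ge_atTop 0] with Λ hΛ
      refine Eventually.of_forall fun τ => ?_
      rw [norm_mul, norm_prod]
      refine mul_le_mul_of_nonneg_left ?_ (norm_nonneg _)
      exact Finset.prod_le_prod (fun _ _ => norm_nonneg _) fun l _ => hC l Λ _ hΛ
    · refine Eventually.of_forall fun τ => ?_
      have h1 : G.timeFun r p (fun i => lineFun (c i) (d i) (E i)) τ =
          treeFun G t p r c d E τ * ∏ l : {i : Line // i ∉ t},
            lineFun (c l) (d l) (E l) (edgeDiff G.src G.tgt r τ l) := by
        rw [timeFun, treeFun, prod_split t, mul_assoc]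
      rw [h1]
      refine Tendsto.const_mul _ (tendsto_finsetProd Finset.univ fun l _ => ?_)
      exact tendsto_lineCutoff (c l) (d l) (hE l) _
  refine hlim.congr' ?_
  filter_upwards [eventually_ge_atTop 0] with Λ hΛ
  rw [integral_prod_lineFourier_flow G ht hp r c d hE hΛ]

include ht hp hE in
theorem tendsto_partialD₀ : Tendsto (G.partialD₀ t p E) atTop
    (𝓝 (∑ s, G.spin s * ∫ τ, G.timeFun r p
      (fun i => lineFun (G.numConst s i) (G.numLin s i) (E i)) τ)) := by
  have h := tendsto_finsetSum Finset.univ fun s _ =>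
    (tendsto_integral_prod_lineFourier_flow G ht hp r (G.numConst s) (G.numLin s) hE).const_mul
      (G.spin s)
  refine h.congr fun Λ => ?_
  have h1 : G.partialD₀ t p E Λ = (1 / (2 * Real.pi) : ℂ) ^ G.loops *
      ∫ q in Set.Icc (fun _ : {i : Line // i ∉ t} => -Λ) (fun _ => Λ),
        G.gammaE E * G.propagators (G.flow t p q) E := by
    rw [partialD₀, integral_const_mul]
    ring
  simp_rw [h1, gammaE_mul_propagators]
  rw [integral_finsetSum _ fun s _ =>
    (integrableOn_prod_lineFourier_flow G ht hp (G.numConst s) (G.numLin s) hE Λ).const_mul _,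
    Finset.mul_sum]
  refine Finset.sum_congr rfl fun s _ => ?_
  rw [integral_const_mul]
  ring

end ZeroTemperature

end FeynmanGraph

end

noncomputable section

namespace FeynmanGraph

open MeasureTheory Filter Topology

set_option linter.unusedSectionVars false

variable {V Line : Type*} [Fintype V] [DecidableEq V] [Fintype Line] [DecidableEq Line]

/-! ### The Matsubara sum in Euclidean time -/

/-- The shift of the Matsubara frequencies of a line. -/
def shift (G : FeynmanGraph V Line) (i : Line) : ℝ := if i ∈ G.fermionic then 1 / 2 else 0

/-- The periodicity sign of a line. -/
def statSign (G : FeynmanGraph V Line) (i : Line) : ℝ := if i ∈ G.fermionic then -1 else 1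

theorem isStatistics (G : FeynmanGraph V Line) (i : Line) :
    IsStatistics (G.shift i) (G.statSign i) := by
  by_cases h : i ∈ G.fermionic
  · refine ⟨?_, by simp [statSign, h]⟩
    simp only [shift, statSign, h, if_true]
    push_cast
    rw [show 2 * Real.pi * Complex.I * (1 / 2) = Real.pi * Complex.I by ring, Complex.exp_pi_mul_I]
  · refine ⟨?_, by simp [statSign, h]⟩
    simp [shift, statSign, h]

theorem shift_eq (G : FeynmanGraph V Line) (i : Line) : G.shift i = 0 ∨ G.shift i = 1 / 2 := by
  unfold shift
  split_ifs <;> simp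

theorem matsubara_eq (G : FeynmanGraph V Line) (T : ℝ) (n : Line → ℤ) (i : Line) :
    G.matsubara T n i = freq T (G.shift i) (n i) := by
  unfold matsubara freq shift
  split_ifs <;> simp

theorem occupation_eq (G : FeynmanGraph V Line) (T : ℝ) (i : Line) (x : ℝ) :
    G.occupation T i x = occ (G.statSign i) T x := by
  unfold occupation occ statSign
  split_ifs
  · rw [show -1 * Real.exp (x / T) - 1 = -(Real.exp (x / T) + 1) by ring, div_neg]
  · rw [one_mul]

theorem exists_excess_eq (G : FeynmanGraph V Line) {T : ℝ} {p : V → ℝ}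
    (hM : G.IsMatsubaraExternal T p) (n : Line → ℤ) (v : V) :
    ∃ m : ℤ, G.excess p (G.matsubara T n) v = 2 * Real.pi * T * m := by
  obtain ⟨n₀, hn₀⟩ := hM v
  have h : ∀ e : Line → V, ∑ i with e i = v, G.matsubara T n i =
      2 * Real.pi * T * (((∑ i with e i = v, n i : ℤ) : ℝ) +
        ((G.fermionic.filter fun i => e i = v).card : ℝ) / 2) := by
    intro e
    have h1 : ((G.fermionic.filter fun i => e i = v).card : ℝ) / 2 =
        ∑ i with e i = v, G.shift i := by
      simp only [shift]
      rw [← Finset.sum_filter, Finset.sum_const, nsmul_eq_mul, mul_one_div]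
      congr 3
      ext i
      simp [and_comm]
    rw [h1]
    push_cast
    rw [← Finset.sum_add_distrib, Finset.mul_sum]
    exact Finset.sum_congr rfl fun i _ => by rw [matsubara_eq, freq]
  -- If s fermionic lines leave `v` and t enter it, the half-integer parts are (s+t)/2 from `p v`,
  -- t/2 from the entering lines and -s/2 from the leaving ones: altogether the integer t.
  refine ⟨n₀ + ∑ i with G.tgt i = v, n i - ∑ i with G.src i = v, n i +
    (G.fermionic.filter fun i => G.tgt i = v).card, ?_⟩
  rw [excess, h, h, hn₀]
  push_cast
  ring

theorem integral_exp_freq {T : ℝ} (hT : 0 < T) (m : ℤ) :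
    T * ∫ x in Set.Ioo (0 : ℝ) (1 / T), Complex.exp (Complex.I * (2 * Real.pi * T * m : ℝ) * x) =
      if m = 0 then 1 else 0 := by
  have hTc : (T : ℂ) ≠ 0 := by exact_mod_cast hT.ne'
  have hβ : (0 : ℝ) ≤ 1 / T := by positivity
  rw [← integral_Ioc_eq_integral_Ioo, ← intervalIntegral.integral_of_le hβ]
  split_ifs with h
  · subst h
    simp
    field_simp
  · have hmc : (m : ℂ) ≠ 0 := by exact_mod_cast h
    have hpi : (Real.pi : ℂ) ≠ 0 := by exact_mod_cast Real.pi_ne_zero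
    have hne : Complex.I * (2 * Real.pi * T * m : ℝ) ≠ 0 := by
      push_cast
      simp [hTc, hmc, hpi]
    rw [integral_exp_mul hne]
    have : Complex.I * (2 * Real.pi * T * m : ℝ) * (1 / T : ℝ) = m * (2 * Real.pi * Complex.I) := by
      push_cast
      field_simp
    rw [this, Complex.exp_int_mul_two_pi_mul_I]
    simp

/-- The box of vertex times. -/
def timeBox (r : V) (β : ℝ) : Set ({v : V // v ≠ r} → ℝ) :=
  Set.univ.pi fun _ => Set.Ioo 0 β

theorem measurableSet_timeBox (r : V) (β : ℝ) : MeasurableSet (timeBox r β) :=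
  MeasurableSet.univ_pi fun _ => measurableSet_Ioo

theorem isFiniteMeasure_timeBox (r : V) (β : ℝ) :
    IsFiniteMeasure ((volume : Measure ({v : V // v ≠ r} → ℝ)).restrict (timeBox r β)) := by
  refine ⟨?_⟩
  rw [Measure.restrict_apply_univ]
  refine lt_of_le_of_lt (measure_mono (Set.pi_mono fun _ _ => Set.Ioo_subset_Icc_self)) ?_
  rw [Set.pi_univ_Icc]
  exact isCompact_Icc.measure_lt_top

theorem abs_edgeDiff_lt {r : V} {β : ℝ} (hβ : 0 < β) {τ : {v : V // v ≠ r} → ℝ}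
    (hτ : τ ∈ timeBox r β) (s t : Line → V) (i : Line) : |edgeDiff s t r τ i| < β := by
  have h : ∀ v : V, 0 ≤ rootExt r τ v ∧ rootExt r τ v < β := by
    intro v
    rw [rootExt]
    split_ifs with hv
    · exact ⟨le_rfl, hβ⟩
    · have := hτ ⟨v, hv⟩ trivial
      exact ⟨this.1.le, this.2⟩
  rw [edgeDiff, abs_lt]
  have h1 := h (t i)
  have h2 := h (s i)
  constructor <;> linarith

theorem sum_I_mul_mul {ι : Type*} [Fintype ι] (f g : ι → ℝ) :
    ∑ i, Complex.I * (f i : ℂ) * (g i : ℂ) = Complex.I * ((∑ i, f i * g i : ℝ) : ℂ) := by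
  push_cast
  rw [Finset.mul_sum]
  exact Finset.sum_congr rfl fun i _ => by ring

-- For Matsubara external energies every excess is 2πT times an integer, so each Kronecker delta is
-- the average of a phase over one period of the vertex time. The root needs none, its conservation
-- being automatic.
open scoped Classical in
theorem indicator_isConserved (G : FeynmanGraph V Line) {T : ℝ} (hT : 0 < T) {p : V → ℝ}
    (hp : ∑ v, p v = 0) (hM : G.IsMatsubaraExternal T p) (r : V) (n : Line → ℤ) :
    (if G.IsConserved p (G.matsubara T n) then (1 : ℂ) else 0) =
      (T : ℂ) ^ Fintype.card {v : V // v ≠ r} * ∫ τ in timeBox r (1 / T),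
        Complex.exp (Complex.I * (∑ v, p v * rootExt r τ v : ℝ)) *
        ∏ i, Complex.exp (Complex.I * freq T (G.shift i) (n i) *
          edgeDiff G.src G.tgt r τ i) := by
  choose m hm using G.exists_excess_eq hM n
  have h1 : ∀ τ : {v : V // v ≠ r} → ℝ,
      Complex.exp (Complex.I * (∑ v, p v * rootExt r τ v : ℝ)) *
        ∏ i, Complex.exp (Complex.I * freq T (G.shift i) (n i) *
          edgeDiff G.src G.tgt r τ i) =
      ∏ v : {v : V // v ≠ r}, Complex.exp (Complex.I * (2 * Real.pi * T * m v : ℝ) * τ v) := by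
    intro τ
    rw [← Complex.exp_sum, ← Complex.exp_sum, ← Complex.exp_add]
    congr 1
    have h2 := G.sum_mul_excess p (G.matsubara T n) (rootExt r τ)
    have h3 : ∑ v, rootExt r τ v * G.excess p (G.matsubara T n) v =
        ∑ v : {v : V // v ≠ r}, 2 * Real.pi * T * m v * τ v := by
      rw [← Fintype.sum_subtype_add_sum_subtype (· ≠ r)]
      have h4 : ∑ v : {v : V // ¬ v ≠ r}, rootExt r τ v * G.excess p (G.matsubara T n) v = 0 := by
        refine Finset.sum_eq_zero fun v _ => ?_
        rw [not_ne_iff.mp v.2, rootExt_root, zero_mul]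
      rw [h4, add_zero]
      refine Finset.sum_congr rfl fun v _ => ?_
      rw [rootExt_coe, hm, mul_comm]
    rw [h3] at h2
    have h5 := congrArg (fun x : ℝ => Complex.I * (x : ℂ)) h2
    simp only [Complex.ofReal_add, mul_add] at h5
    rw [sum_I_mul_mul, sum_I_mul_mul (fun v : {v : V // v ≠ r} => 2 * Real.pi * T * m v) τ, h5]
    simp only [matsubara_eq, edgeDiff]
  simp_rw [h1]
  rw [timeBox, volume_pi, Measure.restrict_pi_pi, integral_fintype_prod_eq_prod
    (fun (v : {v : V // v ≠ r}) (x : ℝ) => Complex.exp (Complex.I * (2 * Real.pi * T * m v : ℝ) * x)),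
    ← Finset.card_univ, ← Finset.prod_const, ← Finset.prod_mul_distrib]
  rw [Finset.prod_congr rfl fun (v : {v : V // v ≠ r}) _ => integral_exp_freq hT (m v)]
  have hT0 : 2 * Real.pi * T ≠ 0 := by positivity
  have h7 : G.IsConserved p (G.matsubara T n) ↔ ∀ v : {v : V // v ≠ r}, m v = 0 := by
    constructor
    · intro h v
      have := (G.isConserved_iff _ _).mp h v
      rw [hm, mul_eq_zero] at this
      exact_mod_cast this.resolve_left hT0
    · intro h
      refine G.isConserved_of_ne hp r fun v hv => ?_
      rw [hm, h ⟨v, hv⟩]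
      simp
  rw [Finset.prod_ite_zero]
  simp [h7]

section PositiveTemperature

variable (G : FeynmanGraph V Line) {T : ℝ} (hT : 0 < T) {p : V → ℝ}
  (hp : ∑ v, p v = 0) (hM : G.IsMatsubaraExternal T p) (r : V)
  (hcard : Fintype.card V ≤ Fintype.card Line + 1) (c d : Line → ℂ) {E : Line → ℝ}
  (hE : ∀ i, 0 < E i)

theorem continuous_thermalCutoff (c d : ℂ) (T η e : ℝ) (M : ℕ) :
    Continuous (thermalCutoff c d T η e M) := by
  unfold thermalCutoff
  fun_prop

theorem continuous_edgeDiff_apply (s t : Line → V) (i : Line) :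
    Continuous fun τ : {v : V // v ≠ r} → ℝ => edgeDiff s t r τ i :=
  (continuous_apply i).comp (continuous_edgeDiff s t r)

include hT hp hM hcard in
open scoped Classical in
theorem sum_isConserved (M : ℕ) :
    (T : ℂ) ^ G.loops * ∑ n ∈ Fintype.piFinset fun _ : Line => Finset.Icc (-(M : ℤ)) (M : ℤ),
      (if G.IsConserved p (G.matsubara T n) then
        ∏ i, lineFourier (c i) (d i) (E i) (G.matsubara T n i) else 0) =
      ∫ τ in timeBox r (1 / T),
        G.timeFun r p (fun i => thermalCutoff (c i) (d i) T (G.shift i) (E i) M) τ := by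
  -- L powers from the normalization and V - 1 from the Kronecker deltas make I, one factor T for
  -- the `thermalCutoff` of each line.
  have hpow : (T : ℂ) ^ G.loops * (T : ℂ) ^ Fintype.card {v : V // v ≠ r} =
      (T : ℂ) ^ Fintype.card Line := by
    rw [← pow_add, Fintype.card_subtype_compl, Fintype.card_subtype_eq, loops]
    congr 1
    have : 0 < Fintype.card V := Fintype.card_pos_iff.mpr ⟨r⟩
    omega
  have hif : ∀ n : Line → ℤ, (if G.IsConserved p (G.matsubara T n) then
      ∏ i, lineFourier (c i) (d i) (E i) (G.matsubara T n i) else 0) =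
      (T : ℂ) ^ Fintype.card {v : V // v ≠ r} * ∫ τ in timeBox r (1 / T),
        Complex.exp (Complex.I * (∑ v, p v * rootExt r τ v : ℝ)) *
        ∏ i, (lineFourier (c i) (d i) (E i) (freq T (G.shift i) (n i)) *
          Complex.exp (Complex.I * freq T (G.shift i) (n i) * edgeDiff G.src G.tgt r τ i)) := by
    intro n
    simp_rw [Finset.prod_mul_distrib, matsubara_eq, mul_left_comm (Complex.exp _)]
    rw [integral_const_mul, mul_left_comm, ← G.indicator_isConserved hT hp hM r n]
    split_ifs <;> simp
  simp_rw [hif]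
  have hint : ∀ n : Line → ℤ, IntegrableOn (fun τ : {v : V // v ≠ r} → ℝ =>
      Complex.exp (Complex.I * (∑ v, p v * rootExt r τ v : ℝ)) *
        ∏ i, (lineFourier (c i) (d i) (E i) (freq T (G.shift i) (n i)) *
          Complex.exp (Complex.I * freq T (G.shift i) (n i) * edgeDiff G.src G.tgt r τ i)))
      (timeBox r (1 / T)) := by
    intro n
    have hcont : Continuous fun τ : {v : V // v ≠ r} → ℝ =>
      Complex.exp (Complex.I * (∑ v, p v * rootExt r τ v : ℝ)) *
        ∏ i, (lineFourier (c i) (d i) (E i) (freq T (G.shift i) (n i)) *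
          Complex.exp (Complex.I * freq T (G.shift i) (n i) * edgeDiff G.src G.tgt r τ i)) := by
      refine (continuous_phase r p).mul (continuous_finsetProd _ fun i _ => ?_)
      have := continuous_edgeDiff_apply r G.src G.tgt i
      fun_prop
    refine IntegrableOn.mono_set (t := Set.Icc (fun _ => 0) (fun _ => 1 / T))
      (hcont.continuousOn.integrableOn_compact isCompact_Icc) ?_
    rw [← Set.pi_univ_Icc]
    exact Set.pi_mono fun _ _ => Set.Ioo_subset_Icc_self
  rw [← Finset.mul_sum, ← mul_assoc, hpow, ← integral_finsetSum _ fun n _ => hint n,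
    ← integral_const_mul]
  refine integral_congr_ae (Eventually.of_forall fun τ => ?_)
  simp only [timeFun, thermalCutoff]
  rw [← Finset.mul_sum, mul_left_comm, Finset.prod_mul_distrib, Finset.prod_const,
    Finset.card_univ, Finset.prod_univ_sum]

-- Time differences of points of the box lie strictly between -1/T and 1/T, where the cutoff sums
-- converge pointwise. Their uniform bounds are integrable because the box has finite measure.
include hT hE in
theorem tendsto_integral_thermalCutoff :
    Tendsto (fun M => ∫ τ in timeBox r (1 / T),
        G.timeFun r p (fun i => thermalCutoff (c i) (d i) T (G.shift i) (E i) M) τ) atTop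
      (𝓝 (∫ τ in timeBox r (1 / T),
        G.timeFun r p (fun i => thermalFun (c i) (d i) T (G.statSign i) (E i)) τ)) := by
  have := isFiniteMeasure_timeBox r (1 / T)
  choose C hC using fun i => exists_norm_thermalCutoff_le (c i) (d i) (hE i).ne' hT (G.shift i)
  refine tendsto_integral_filter_of_dominated_convergence (fun _ => ∏ i, C i) ?_ ?_
    (integrable_const _) ?_
  · refine Eventually.of_forall fun M => Continuous.aestronglyMeasurable ?_
    refine (continuous_phase r p).mul (continuous_finsetProd _ fun i _ => ?_)
    exact (continuous_thermalCutoff _ _ _ _ _ _).comp (continuous_edgeDiff_apply r G.src G.tgt i)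
  · refine Eventually.of_forall fun M => Eventually.of_forall fun τ => ?_
    rw [timeFun, norm_mul, norm_exp_I_ofReal, one_mul, norm_prod]
    exact Finset.prod_le_prod (fun _ _ => norm_nonneg _) fun i _ => hC i M _
  · filter_upwards [ae_restrict_mem (measurableSet_timeBox r (1 / T))] with τ hτ
    refine Tendsto.const_mul _ (tendsto_finsetProd Finset.univ fun i _ => ?_)
    exact tendsto_thermalCutoff (G.isStatistics i) (G.shift_eq i) _ _ (hE i) hT
      (abs_edgeDiff_lt (by positivity) hτ _ _ _)

include hT hp hM hcard hE in
theorem tendsto_partialD : Tendsto (G.partialD T p E) atTop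
    (𝓝 (∑ s, G.spin s * ∫ τ in timeBox r (1 / T), G.timeFun r p
      (fun i => thermalFun (G.numConst s i) (G.numLin s i) T (G.statSign i) (E i)) τ)) := by
  classical
  have h := tendsto_finsetSum Finset.univ fun s _ =>
    (tendsto_integral_thermalCutoff (p := p) G hT r (G.numConst s) (G.numLin s) hE).const_mul
      (G.spin s)
  refine h.congr fun M => ?_
  have h1 : G.partialD T p E M = (T : ℂ) ^ G.loops *
      ∑ n ∈ Fintype.piFinset fun _ : Line => Finset.Icc (-(M : ℤ)) (M : ℤ),
        ∑ s, G.spin s * (if G.IsConserved p (G.matsubara T n) then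
          ∏ i, lineFourier (G.numConst s i) (G.numLin s i) (E i) (G.matsubara T n i) else 0) := by
    rw [partialD, mul_comm (G.gammaE E), mul_assoc, Finset.mul_sum]
    congr 1
    refine Finset.sum_congr rfl fun n _ => ?_
    simp only [mul_ite, mul_zero]
    split_ifs
    · exact G.gammaE_mul_propagators _ _
    · simp
  rw [h1, Finset.sum_comm, Finset.mul_sum]
  refine Finset.sum_congr rfl fun s _ => ?_
  rw [← G.sum_isConserved hT hp hM r hcard, ← Finset.mul_sum]
  ring

end PositiveTemperature

end FeynmanGraph

end

noncomputable section

namespace FeynmanGraph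

open MeasureTheory Filter Topology

/-! ### Exponential integrals over simplices -/

/-- The corner `x > 0`, `∑ x < β`. -/
def corner (n : ℕ) (β : ℝ) : Set (Fin n → ℝ) := {x | (∀ j, 0 < x j) ∧ ∑ j, x j < β}

theorem measurableSet_corner (n : ℕ) (β : ℝ) : MeasurableSet (corner n β) := by
  have h1 : MeasurableSet {x : Fin n → ℝ | ∀ j, 0 < x j} := by
    rw [Set.ofPred_forall]
    exact MeasurableSet.iInter fun j => measurableSet_lt measurable_const (measurable_pi_apply j)
  refine h1.inter (measurableSet_lt (f := fun x : Fin n → ℝ => ∑ j, x j) (g := fun _ => β) ?_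
    measurable_const)
  exact Finset.measurable_sum _ fun j _ => measurable_pi_apply j

theorem corner_subset_Icc (n : ℕ) (β : ℝ) : corner n β ⊆ Set.Icc (fun _ => 0) (fun _ => β) := by
  intro x hx
  refine ⟨fun j => (hx.1 j).le, fun j => ?_⟩
  exact (Finset.single_le_sum (fun i _ => (hx.1 i).le) (Finset.mem_univ j)).trans hx.2.le

/-- A partial fraction identity: the Lagrange basis polynomials of the nodes `ν` sum to 1, and this
is evaluated at `z`. -/
theorem sum_prod_erase_inv {n : ℕ} {ν : Fin n → ℂ} (hν : Function.Injective ν) {z : ℂ}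
    (hz : ∀ k, ν k ≠ z) (hn : 0 < n) :
    ∑ k, (∏ l ∈ Finset.univ.erase k, (ν l - ν k)⁻¹) * (z - ν k)⁻¹ =
      -∏ l, (ν l - z)⁻¹ := by
  have hne : (Finset.univ : Finset (Fin n)).Nonempty := ⟨⟨0, hn⟩, Finset.mem_univ _⟩
  have h1 := congrArg (Polynomial.eval z)
    (Lagrange.sum_basis (s := Finset.univ) (v := ν) hν.injOn hne)
  simp only [Polynomial.eval_finsetSum, Polynomial.eval_one, Lagrange.basis, Polynomial.eval_prod,
    Lagrange.basisDivisor, Polynomial.eval_mul, Polynomial.eval_C, Polynomial.eval_sub,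
    Polynomial.eval_X] at h1
  have hprod : ∏ l, (ν l - z) ≠ 0 :=
    Finset.prod_ne_zero_iff.mpr fun l _ => sub_ne_zero.mpr (hz l)
  have h2 : ∀ k, ∏ l ∈ Finset.univ.erase k, ((ν k - ν l)⁻¹ * (z - ν l)) =
      (∏ l ∈ Finset.univ.erase k, (ν l - ν k)⁻¹) * (z - ν k)⁻¹ * -∏ l, (ν l - z) := by
    intro k
    have hk : z - ν k ≠ 0 := sub_ne_zero.mpr (hz k).symm
    rw [← Finset.mul_prod_erase Finset.univ (fun l => (ν l - z)) (Finset.mem_univ k)]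
    have h3 : ∀ a b : ℂ, a * (z - ν k)⁻¹ * -((ν k - z) * b) = a * b := by
      intro a b
      rw [← neg_mul, neg_sub]
      field_simp
    rw [h3, ← Finset.prod_mul_distrib]
    refine Finset.prod_congr rfl fun l _ => ?_
    rw [← neg_sub (ν l) (ν k), inv_neg]
    ring
  rw [Finset.sum_congr rfl fun k _ => h2 k, ← Finset.sum_mul] at h1
  rw [Finset.prod_inv_distrib, ← inv_neg]
  exact eq_inv_of_mul_eq_one_left h1

theorem integral_exp_mul_exp {a b : ℂ} (hab : a ≠ b) (β : ℝ) :
    ∫ y in (0:ℝ)..β, Complex.exp (-(b * y)) * Complex.exp (-((β - y : ℝ) * a)) =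
      (Complex.exp (-(β * a)) - Complex.exp (-(β * b))) * (b - a)⁻¹ := by
  have hba : b - a ≠ 0 := sub_ne_zero.mpr hab.symm
  have h : ∀ y : ℝ, HasDerivAt
      (fun y : ℝ => -Complex.exp (-(β * a)) * Complex.exp (-((b - a) * y)) * (b - a)⁻¹)
      (Complex.exp (-(b * y)) * Complex.exp (-((β - y : ℝ) * a))) y := by
    intro y
    have h1 : HasDerivAt (fun y : ℝ => -((b - a) * (y : ℂ))) (-((b - a) * 1)) y :=
      ((Complex.ofRealCLM.hasDerivAt (x := y)).const_mul (b - a)).neg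
    refine ((h1.cexp.const_mul (-Complex.exp (-(β * a)))).mul_const (b - a)⁻¹).congr_deriv ?_
    rw [← Complex.exp_add]
    have : -(b * (y : ℂ)) + -(((β - y : ℝ) : ℂ) * a) = -(β * a) + -((b - a) * y) := by
      push_cast; ring
    rw [this, Complex.exp_add]
    field_simp
  rw [intervalIntegral.integral_eq_sub_of_hasDerivAt (fun y _ => h y)
    ((by fun_prop : Continuous fun y : ℝ =>
      Complex.exp (-(b * y)) * Complex.exp (-((β - y : ℝ) * a))).intervalIntegrable _ _)]
  have : -((β:ℂ) * b) = -(β * a) + -((b - a) * β) := by ring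
  rw [this, Complex.exp_add]
  simp
  ring

theorem snoc_mem_corner {n : ℕ} {β y : ℝ} {x : Fin n → ℝ} :
    (Fin.snoc x y : Fin (n + 1) → ℝ) ∈ corner (n + 1) β ↔ y ∈ Set.Ioo 0 β ∧ x ∈ corner n (β - y) := by
  simp only [corner, Set.mem_ofPred_eq, Fin.forall_fin_succ', Fin.snoc_castSucc, Fin.snoc_last,
    Fin.sum_univ_castSucc, Set.mem_Ioo]
  constructor
  · rintro ⟨⟨h1, h2⟩, h3⟩
    have := Finset.sum_nonneg fun j (_ : j ∈ Finset.univ) => (h1 j).le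
    exact ⟨⟨h2, by linarith⟩, h1, by linarith⟩
  · rintro ⟨⟨h2, _⟩, h1, h3⟩
    exact ⟨⟨h1, h2⟩, by linarith⟩

theorem continuous_prod_exp {n : ℕ} (ν : Fin n → ℂ) :
    Continuous fun x : Fin n → ℝ => ∏ j, Complex.exp (-(ν j * x j)) :=
  continuous_finsetProd _ fun j _ => by fun_prop

theorem integrableOn_corner_prod_exp {n : ℕ} (ν : Fin n → ℂ) (β : ℝ) :
    IntegrableOn (fun x : Fin n → ℝ => ∏ j, Complex.exp (-(ν j * x j))) (corner n β) :=
  ((continuous_prod_exp ν).continuousOn.integrableOn_compact isCompact_Icc).mono_set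
    (corner_subset_Icc n β)

/-- The sum is a divided difference of exp(-β ·). The slack β - ∑ x acts as an additional coordinate
with exponent `μ 0 = 0`. The induction integrates over the last coordinate, whose fibres are corners
of size β - y; partial fractions yield the coefficient of the new exponential. -/
theorem integral_corner : ∀ {n : ℕ} {μ : Fin (n + 1) → ℂ}, Function.Injective μ → μ 0 = 0 →
    ∀ {β : ℝ}, 0 < β → ∫ x in corner n β, ∏ j : Fin n, Complex.exp (-(μ j.succ * x j)) =
      ∑ k, Complex.exp (-(β * μ k)) * ∏ l ∈ Finset.univ.erase k, (μ l - μ k)⁻¹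
  | 0, μ, _, h0, β, hβ => by
    have : corner 0 β = Set.univ := by
      ext x; simp [corner, hβ]
    simp [this, h0, integral_const, Measure.real]
    rw [volume_pi, Measure.pi_of_empty]
    simp
  | n + 1, μ, hμ, h0, β, hβ => by
    set f : (Fin (n + 1) → ℝ) → ℂ := fun x => ∏ j : Fin (n + 1), Complex.exp (-(μ j.succ * x j))
      with hf
    set μ' : Fin (n + 1) → ℂ := fun j => μ j.castSucc with hμ'
    set z := μ (Fin.last (n + 1)) with hz
    have hμ'inj : Function.Injective μ' := hμ.comp (Fin.castSucc_injective _)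
    have hμz : ∀ k, μ' k ≠ z := fun k h => (Fin.castSucc_lt_last k).ne (hμ h)
    have hint := integrableOn_corner_prod_exp (fun j : Fin (n + 1) => μ j.succ) β
    rw [← integrable_indicator_iff (measurableSet_corner _ _)] at hint
    have hmp := (volume_preserving_piFinSuccAbove (fun _ : Fin (n + 1) => ℝ) (Fin.last n)).symm
    rw [← integral_indicator (measurableSet_corner _ _), ← hmp.integral_comp
      (MeasurableEquiv.measurableEmbedding _)]
    have hint' := (hmp.integrable_comp_emb (MeasurableEquiv.measurableEmbedding _)).mpr hint
    rw [Measure.volume_eq_prod] at hint' ⊢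
    refine (integral_prod _ hint').trans ?_
    simp only [Function.comp_apply]
    change ∫ y : ℝ, ∫ x : Fin n → ℝ, (corner (n + 1) β).indicator f
      ((MeasurableEquiv.piFinSuccAbove (fun _ : Fin (n + 1) => ℝ) (Fin.last n)).symm (y, x)) = _
    have hval : ∀ y : ℝ, ∀ x : Fin n → ℝ, (corner (n + 1) β).indicator f
        ((MeasurableEquiv.piFinSuccAbove (fun _ : Fin (n + 1) => ℝ) (Fin.last n)).symm (y, x)) =
        (Set.Ioo 0 β).indicator (fun y => Complex.exp (-(z * y)) *
          (corner n (β - y)).indicator (fun x => ∏ j : Fin n, Complex.exp (-(μ' j.succ * x j))) x)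
          y := by
      intro y x
      have he : (MeasurableEquiv.piFinSuccAbove (fun _ : Fin (n + 1) => ℝ) (Fin.last n)).symm (y, x)
          = (Fin.snoc x y : Fin (n + 1) → ℝ) := by
        simp [MeasurableEquiv.piFinSuccAbove, Fin.insertNthEquiv, Fin.insertNth_last']
      rw [he]
      by_cases hm : (Fin.snoc x y : Fin (n + 1) → ℝ) ∈ corner (n + 1) β
      · have hm' := snoc_mem_corner.mp hm
        rw [Set.indicator_of_mem hm, Set.indicator_of_mem hm'.1, Set.indicator_of_mem hm'.2]
        simp only [hf, Fin.prod_univ_castSucc, Fin.snoc_castSucc, Fin.snoc_last, hz, hμ',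
          Fin.succ_castSucc, Fin.succ_last]
        ring
      · rw [Set.indicator_of_notMem hm]
        rw [snoc_mem_corner] at hm
        by_cases hy : y ∈ Set.Ioo 0 β
        · rw [Set.indicator_of_mem hy, Set.indicator_of_notMem fun h => hm ⟨hy, h⟩, mul_zero]
        · rw [Set.indicator_of_notMem hy]
    have hval' : ∀ y : ℝ, ∫ x : Fin n → ℝ, (corner (n + 1) β).indicator f
        ((MeasurableEquiv.piFinSuccAbove (fun _ : Fin (n + 1) => ℝ) (Fin.last n)).symm (y, x)) =
        (Set.Ioo 0 β).indicator (fun y => ∑ k, (Complex.exp (-(z * y)) *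
          Complex.exp (-((β - y : ℝ) * μ' k))) * ∏ l ∈ Finset.univ.erase k, (μ' l - μ' k)⁻¹) y := by
      intro y
      simp_rw [hval]
      by_cases hy : y ∈ Set.Ioo 0 β
      · simp only [Set.indicator_of_mem hy]
        rw [integral_const_mul, integral_indicator (measurableSet_corner _ _),
          integral_corner hμ'inj h0 (sub_pos.mpr hy.2), Finset.mul_sum]
        exact Finset.sum_congr rfl fun k _ => by ring
      · simp [Set.indicator_of_notMem hy]
    simp only [hval']
    rw [integral_indicator measurableSet_Ioo, ← integral_Ioc_eq_integral_Ioo,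
      ← intervalIntegral.integral_of_le hβ.le, intervalIntegral.integral_finsetSum]
    · simp_rw [intervalIntegral.integral_mul_const, integral_exp_mul_exp (hμz _)]
      rw [Fin.sum_univ_castSucc (n := n + 1)]
      have hL := sum_prod_erase_inv hμ'inj hμz (Nat.succ_pos n)
      have hlast : ∏ l ∈ Finset.univ.erase (Fin.last (n + 1)), (μ l - μ (Fin.last (n + 1)))⁻¹ =
          ∏ l, (μ' l - z)⁻¹ := by
        have : Finset.univ.erase (Fin.last (n + 1)) = Finset.univ.map Fin.castSuccEmb := by
          ext l
          simp only [Finset.mem_erase, Finset.mem_univ, and_true, Finset.mem_map, true_and,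
            Fin.castSuccEmb_apply]
          exact ⟨fun h => ⟨l.castPred h, by simp⟩, fun ⟨a, h⟩ => h ▸ (Fin.castSucc_lt_last a).ne⟩
        rw [this, Finset.prod_map]
        rfl
      have hk : ∀ k : Fin (n + 1), ∏ l ∈ Finset.univ.erase k.castSucc, (μ l - μ k.castSucc)⁻¹ =
          (∏ l ∈ Finset.univ.erase k, (μ' l - μ' k)⁻¹) * (z - μ' k)⁻¹ := by
        intro k
        have : Finset.univ.erase k.castSucc = insert (Fin.last (n + 1))
            ((Finset.univ.erase k).map Fin.castSuccEmb) := by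
          ext l
          induction l using Fin.lastCases with
          | last => simp [Fin.castSucc_ne_last, eq_comm]
          | cast l => simp [Fin.castSucc_ne_last]
        rw [this, Finset.prod_insert (by simp [Fin.castSucc_ne_last]), Finset.prod_map, mul_comm]
        rfl
      rw [hlast, ← neg_neg (∏ l, (μ' l - z)⁻¹), ← hL, mul_neg, Finset.mul_sum, ← sub_eq_add_neg,
        ← Finset.sum_sub_distrib]
      refine Finset.sum_congr rfl fun k _ => ?_
      rw [hk]
      ring
    · intro k _
      exact (by fun_prop : Continuous _).intervalIntegrable _ _

end FeynmanGraph

end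

noncomputable section

namespace FeynmanGraph

open MeasureTheory Filter Topology

set_option linter.unusedSectionVars false

variable {V Line : Type*} [Fintype V] [DecidableEq V] [Fintype Line] [DecidableEq Line]

/-! ### Time orderings of the vertices -/

/-- The energy of a cut: `a i` for the lines `i` leaving `X`, `b i` for the lines entering `X`, and
`P v` for the vertices of `X`. -/
def cutE (s t : Line → V) (a b : Line → ℂ) (P : V → ℂ) (X : Finset V) : ℂ :=
  ∑ i, (if s i ∈ X ∧ t i ∉ X then a i else if t i ∈ X ∧ s i ∉ X then b i else 0) + ∑ v ∈ X, P v

/-- The vertices before position `k` in the ordering `σ`. -/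
def pre {n : ℕ} (σ : Fin (n + 1) ≃ V) (k : Fin (n + 1)) : Finset V :=
  Finset.univ.filter fun v => σ.symm v < k

theorem mem_pre {n : ℕ} {σ : Fin (n + 1) ≃ V} {k : Fin (n + 1)} {v : V} :
    v ∈ pre σ k ↔ σ.symm v < k := by simp [pre]

/-- The numerator belonging to an ordering: `u i` for the lines pointing forward in time, `u' i`
for those pointing backward, `w i` for self-loops. -/
def ordCoef {n : ℕ} (s t : Line → V) (u u' w : Line → ℂ) (σ : Fin (n + 1) ≃ V) : ℂ :=
  ∏ i, if σ.symm (s i) < σ.symm (t i) then u i else if σ.symm (t i) < σ.symm (s i) then u' i else w i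

/-- The sum over the orderings of time-ordered perturbation theory. -/
def ordSum (n : ℕ) (s t : Line → V) (a b u u' w : Line → ℂ) (P : V → ℂ) : ℂ :=
  ∑ σ : Fin (n + 1) ≃ V, ordCoef s t u u' w σ * ∏ j : Fin n, (cutE s t a b P (pre σ j.succ))⁻¹

/-- The integrand of time-ordered perturbation theory in terms of consecutive time differences. -/
def ordExp {n : ℕ} (s t : Line → V) (a b : Line → ℂ) (P : V → ℂ) (σ : Fin (n + 1) ≃ V)
    (x : Fin n → ℝ) : ℂ :=
  ∏ j : Fin n, Complex.exp (-(cutE s t a b P (pre σ j.succ) * x j))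

theorem eq_last_sub_sum : ∀ {n : ℕ} (g : Fin (n + 1) → ℝ) (k : Fin (n + 1)),
    g k = g (Fin.last n) - ∑ j : Fin n, if k < j.succ then g j.succ - g j.castSucc else 0
  | 0, g, k => by
    obtain rfl : k = Fin.last 0 := Fin.ext (by omega)
    simp
  | n + 1, g, k => by
    rw [Fin.sum_univ_succ]
    have ih := eq_last_sub_sum (fun j : Fin (n + 1) => g j.succ)
    induction k using Fin.cases with
    | zero =>
      have h := ih 0
      simp only [Fin.succ_pos, if_true, Fin.succ_last] at h ⊢
      simp only [← Fin.succ_castSucc]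
      simp only [Fin.castSucc_zero] at h ⊢
      linarith
    | succ k =>
      have h := ih k
      have h0 : ¬ k.succ < (0 : Fin (n + 1)).succ := by simp
      simp only [Fin.succ_last] at h
      simp only [Fin.succ_lt_succ_iff, ← Fin.succ_castSucc, Fin.succ_zero_eq_one] at h0 ⊢
      rw [h]
      simp

theorem time_eq {n : ℕ} (σ : Fin (n + 1) ≃ V) (T : V → ℝ) (v : V) :
    T v = T (σ (Fin.last n)) -
      ∑ j : Fin n, if v ∈ pre σ j.succ then T (σ j.succ) - T (σ j.castSucc) else 0 := by
  have := eq_last_sub_sum (fun k => T (σ k)) (σ.symm v)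
  simpa [mem_pre] using this

/-- A time difference is the sum of those steps whose cut separates the two vertices. Consequently
the exponent belonging to a step collects the energies of exactly the lines crossing its cut. -/
theorem abs_time_sub {n : ℕ} (σ : Fin (n + 1) ≃ V) {T : V → ℝ} (hT : StrictMono (T ∘ σ)) (v w : V) :
    |T w - T v| = ∑ j : Fin n, if v ∈ pre σ j.succ ∧ w ∉ pre σ j.succ ∨
      w ∈ pre σ j.succ ∧ v ∉ pre σ j.succ then T (σ j.succ) - T (σ j.castSucc) else 0 := by
  wlog h : σ.symm v ≤ σ.symm w generalizing v w
  · rw [abs_sub_comm, this w v (le_of_not_ge h)]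
    simp only [or_comm]
  have hle : T v ≤ T w := by
    have := hT.monotone h
    simpa using this
  rw [abs_of_nonneg (sub_nonneg.mpr hle), time_eq σ T v, time_eq σ T w, sub_sub_sub_cancel_left,
    ← Finset.sum_sub_distrib]
  refine Finset.sum_congr rfl fun j _ => ?_
  simp only [mem_pre]
  by_cases h1 : σ.symm w < j.succ
  · simp [h1, h.trans_lt h1]
  · by_cases h2 : σ.symm v < j.succ <;> simp [h1, h2]

variable (G : FeynmanGraph V Line) (r : V)

/-- The times in the order `σ`. -/
def cone {n : ℕ} (σ : Fin (n + 1) ≃ V) : Set ({v : V // v ≠ r} → ℝ) :=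
  {τ | StrictMono (rootExt r τ ∘ σ)}

/-- The consecutive time differences. -/
def steps {n : ℕ} (σ : Fin (n + 1) ≃ V) : ({v : V // v ≠ r} → ℝ) → Fin n → ℝ :=
  edgeDiff (fun j : Fin n => σ j.castSucc) (fun j => σ j.succ) r

theorem mem_cone {n : ℕ} {σ : Fin (n + 1) ≃ V} {τ : {v : V // v ≠ r} → ℝ} :
    τ ∈ cone r σ ↔ ∀ j, 0 < steps r σ τ j := by
  simp [cone, Fin.strictMono_iff_lt_succ, steps, edgeDiff]

theorem cone_eq_preimage {n : ℕ} (σ : Fin (n + 1) ≃ V) :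
    cone r σ = steps r σ ⁻¹' (Set.univ.pi fun _ => Set.Ioi 0) := by
  ext τ
  simp [mem_cone]

theorem joins_path {n : ℕ} (σ : Fin (n + 1) ≃ V) :
    Joins (fun j : Fin n => σ j.castSucc) (fun j => σ j.succ) := by
  intro K f hf
  have h : ∀ k : Fin (n + 1), f (σ k) = f (σ 0) := by
    intro k
    induction k using Fin.induction with
    | zero => rfl
    | succ j ih => rw [← ih]; exact (hf j).symm
  intro v w
  have h1 := h (σ.symm v)
  have h2 := h (σ.symm w)
  simp only [Equiv.apply_symm_apply] at h1 h2
  rw [h1, h2]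

theorem card_eq_of_equiv {n : ℕ} (σ : Fin (n + 1) ≃ V) :
    Fintype.card (Fin n) + 1 = Fintype.card V := by
  rw [← Fintype.card_congr σ]; simp

theorem measurePreserving_steps {n : ℕ} (σ : Fin (n + 1) ≃ V) :
    MeasurePreserving (steps r σ) volume volume :=
  measurePreserving_edgeDiff (joins_path σ) (card_eq_of_equiv σ) r

theorem measurableEmbedding_steps {n : ℕ} (σ : Fin (n + 1) ≃ V) :
    MeasurableEmbedding (steps r σ) :=
  measurableEmbedding_edgeDiff (joins_path σ) r

theorem measurableSet_cone {n : ℕ} (σ : Fin (n + 1) ≃ V) : MeasurableSet (cone r σ) := by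
  rw [cone_eq_preimage]
  exact (measurableEmbedding_steps r σ).measurable
    (MeasurableSet.univ_pi fun _ => measurableSet_Ioi)

theorem disjoint_cone {n : ℕ} : Pairwise (Function.onFun Disjoint
    (cone (V := V) r : (Fin (n + 1) ≃ V) → Set _)) := by
  intro σ σ' hne
  refine Set.disjoint_left.mpr fun τ h h' => hne ?_
  have hr : Set.range (rootExt r τ ∘ σ) = Set.range (rootExt r τ ∘ σ') := by
    rw [Set.range_comp, Set.range_comp, σ.range_eq_univ, σ'.range_eq_univ]
  have heq := (StrictMono.range_inj h h').mp hr
  have hinj : Function.Injective (rootExt r τ) := by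
    have := h.injective
    rwa [Function.Injective.of_comp_iff' _ σ.bijective] at this
  exact Equiv.ext fun k => hinj (congrFun heq k)

theorem ae_injective_rootExt : ∀ᵐ τ : {v : V // v ≠ r} → ℝ, Function.Injective (rootExt r τ) := by
  have h : ∀ v w : V, v ≠ w → ∀ᵐ τ : {v : V // v ≠ r} → ℝ, rootExt r τ v ≠ rootExt r τ w := by
    intro v w hvw
    let W : Submodule ℝ ({v : V // v ≠ r} → ℝ) :=
      { carrier := {τ | rootExt r τ v = rootExt r τ w}
        add_mem' := by
          intro a b ha hb
          simp only [Set.mem_ofPred_eq, rootExt, Pi.add_apply] at ha hb ⊢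
          split_ifs at ha hb ⊢ <;> linarith
        zero_mem' := by simp [rootExt]
        smul_mem' := by
          intro c a ha
          have : ∀ u, rootExt r (c • a) u = c * rootExt r a u := fun u => by
            unfold rootExt; split_ifs <;> simp
          simp only [Set.mem_ofPred_eq, this] at ha ⊢
          rw [ha] }
    have hW : W ≠ ⊤ := by
      intro htop
      -- The values 0 at the root, 1 at `v` and 2 elsewhere distinguish `v` from `w` even if one of
      -- them is the root.
      have : (fun x : {v : V // v ≠ r} => if x.1 = v then (1:ℝ) else 2) ∈ W := htop ▸ trivial
      change rootExt r _ v = rootExt r _ w at this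
      simp only [rootExt] at this
      split_ifs at this with h1 h2 h2 h3 h4
      · exact hvw (h1.trans h2.symm)
      all_goals first | exact hvw h4.symm | norm_num at this
    have := Measure.addHaar_submodule volume W hW
    rw [ae_iff]
    simp only [ne_eq, not_not]
    exact this
  have h' : ∀ᵐ τ : {v : V // v ≠ r} → ℝ, ∀ v w : V, v ≠ w → rootExt r τ v ≠ rootExt r τ w := by
    simp only [Filter.eventually_all]
    exact h
  filter_upwards [h'] with τ hτ v w hvw
  by_contra hne
  exact hτ v w hne hvw

theorem exists_mem_cone {n : ℕ} (hn : Fintype.card V = n + 1) {τ : {v : V // v ≠ r} → ℝ}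
    (hτ : Function.Injective (rootExt r τ)) : ∃ σ : Fin (n + 1) ≃ V, τ ∈ cone r σ := by
  let e : Fin (n + 1) ≃ V := (finCongr hn.symm).trans (Fintype.equivFin V).symm
  refine ⟨(Tuple.sort (rootExt r τ ∘ e)).trans e, ?_⟩
  have h := Tuple.monotone_sort (rootExt r τ ∘ e)
  refine h.strictMono_of_injective ?_
  exact (hτ.comp e.injective).comp (Equiv.injective _)

theorem integral_eq_sum_cone {n : ℕ} (hn : Fintype.card V = n + 1)
    {f : ({v : V // v ≠ r} → ℝ) → ℂ} {B : Set ({v : V // v ≠ r} → ℝ)} (hB : MeasurableSet B)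
    (hf : ∀ σ : Fin (n + 1) ≃ V, IntegrableOn f (B ∩ cone r σ)) :
    ∫ τ in B, f τ = ∑ σ : Fin (n + 1) ≃ V, ∫ τ in B ∩ cone r σ, f τ := by
  rw [← integral_iUnion_fintype (fun σ => hB.inter (measurableSet_cone r σ))
    (fun σ σ' h => (disjoint_cone r h).mono Set.inter_subset_right Set.inter_subset_right) hf]
  refine setIntegral_congr_set ?_
  rw [← Set.inter_iUnion]
  filter_upwards [ae_injective_rootExt r] with τ hτ
  have : τ ∈ ⋃ σ : Fin (n + 1) ≃ V, cone r σ := Set.mem_iUnion.mpr (exists_mem_cone r hn hτ)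
  exact propext ⟨fun h => ⟨h, this⟩, fun h => h.1⟩

/-! ### The integrand on a cone -/

variable {p : V → ℝ} (hp : ∑ v, p v = 0) (c d : Line → ℂ) (e : Line → ℝ)

/-- The external energies as contributions to the cut energies. -/
def extE (p : V → ℝ) (v : V) : ℂ := Complex.I * p v

-- In a fixed order the numerators are constant and the exponents regroup by steps. Each vertex time
-- is the last time minus later steps; the last time drops out of the external phase because the
-- total external energy is 0.
include hp in
theorem timeFun_of_mem_cone {n : ℕ} {σ : Fin (n + 1) ≃ V} {τ : {v : V // v ≠ r} → ℝ}
    (hτ : τ ∈ cone r σ) :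
    G.timeFun r p (fun i => lineFun (c i) (d i) (e i)) τ =
      ordCoef G.src G.tgt (fun i => c i - e i * d i) (fun i => c i + e i * d i) c σ *
        ordExp G.src G.tgt (fun i => (e i : ℂ)) (fun i => (e i : ℂ)) (extE p) σ (steps r σ τ) := by
  have hmono : StrictMono (rootExt r τ ∘ σ) := hτ
  have hlt : ∀ v w, σ.symm v < σ.symm w ↔ rootExt r τ v < rootExt r τ w := by
    intro v w
    rw [← hmono.lt_iff_lt]
    simp
  have hline : ∀ i, lineFun (c i) (d i) (e i) (edgeDiff G.src G.tgt r τ i) =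
      (if σ.symm (G.src i) < σ.symm (G.tgt i) then c i - e i * d i
        else if σ.symm (G.tgt i) < σ.symm (G.src i) then c i + e i * d i else c i) *
        Complex.exp (-(e i * |edgeDiff G.src G.tgt r τ i| : ℝ)) := by
    intro i
    simp only [hlt, lineFun, edgeDiff, sub_pos, sub_neg, Complex.ofReal_exp, Complex.ofReal_neg]
  rw [timeFun, Finset.prod_congr rfl fun i _ => hline i, Finset.prod_mul_distrib, ordCoef,
    mul_left_comm]
  congr 1
  rw [← Complex.exp_sum, ← Complex.exp_add, ordExp, ← Complex.exp_sum]
  congr 1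
  have hphase : ∑ v, p v * rootExt r τ v =
      -∑ j : Fin n, (∑ v ∈ pre σ j.succ, p v) * steps r σ τ j := by
    have h1 : ∀ v, p v * rootExt r τ v = p v * rootExt r τ (σ (Fin.last n)) -
        ∑ j : Fin n, if v ∈ pre σ j.succ then p v * steps r σ τ j else 0 := by
      intro v
      rw [time_eq σ (rootExt r τ) v, mul_sub, Finset.mul_sum]
      simp only [mul_ite, mul_zero]
      rfl
    rw [Finset.sum_congr rfl fun v _ => h1 v, Finset.sum_sub_distrib, ← Finset.sum_mul, hp, zero_mul,
      zero_sub, Finset.sum_comm]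
    congr 1
    refine Finset.sum_congr rfl fun j _ => ?_
    rw [← Finset.sum_filter, Finset.sum_mul]
    refine Finset.sum_congr ?_ fun _ _ => rfl
    ext v; simp
  have habs : ∀ i, |edgeDiff G.src G.tgt r τ i| = ∑ j : Fin n,
      if G.src i ∈ pre σ j.succ ∧ G.tgt i ∉ pre σ j.succ ∨
        G.tgt i ∈ pre σ j.succ ∧ G.src i ∉ pre σ j.succ then steps r σ τ j else 0 := fun i =>
    abs_time_sub σ hmono (G.src i) (G.tgt i)
  have hcut : ∀ j : Fin n, cutE G.src G.tgt (fun i => (e i : ℂ)) (fun i => (e i : ℂ)) (extE p)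
      (pre σ j.succ) * steps r σ τ j =
      (∑ i, (if G.src i ∈ pre σ j.succ ∧ G.tgt i ∉ pre σ j.succ ∨
        G.tgt i ∈ pre σ j.succ ∧ G.src i ∉ pre σ j.succ then e i * steps r σ τ j else 0 : ℝ)) +
      Complex.I * (((∑ v ∈ pre σ j.succ, p v) * steps r σ τ j : ℝ) : ℂ) := by
    intro j
    simp only [cutE, extE, add_mul]
    congr 1
    · rw [Finset.sum_mul, Complex.ofReal_sum]
      refine Finset.sum_congr rfl fun i _ => ?_
      by_cases h1 : G.src i ∈ pre σ j.succ <;> by_cases h2 : G.tgt i ∈ pre σ j.succ <;> simp [h1, h2]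
    · push_cast
      rw [← Finset.mul_sum, mul_assoc]
  simp only [hcut, Finset.sum_neg_distrib, Finset.sum_add_distrib, hphase, habs]
  rw [add_comm, ← Finset.mul_sum, ← Complex.ofReal_sum, ← Complex.ofReal_sum, ← Complex.ofReal_sum]
  simp only [Complex.ofReal_neg]
  rw [neg_add, mul_neg]
  congr 2
  · congr 1
    simp only [Finset.mul_sum]
    rw [Finset.sum_comm]
    refine Finset.sum_congr rfl fun i _ => Finset.sum_congr rfl fun j _ => ?_
    split_ifs <;> simp

end FeynmanGraph

end

noncomputable section

namespace FeynmanGraph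

open MeasureTheory Filter Topology

set_option linter.unusedSectionVars false

variable {V Line : Type*} [Fintype V] [DecidableEq V] [Fintype Line] [DecidableEq Line]
  (G : FeynmanGraph V Line) (r : V)

/-! ### Evaluation of the time integrals -/

theorem cutE_empty (s t : Line → V) (a b : Line → ℂ) (P : V → ℂ) : cutE s t a b P ∅ = 0 := by
  simp [cutE]

theorem pre_zero {n : ℕ} (σ : Fin (n + 1) ≃ V) : pre σ 0 = ∅ := by
  simp [pre]

theorem exists_crossing {G : FeynmanGraph V Line} {t : Finset Line} (ht : G.ConnectedBy t)
    {X : Finset V} {v w : V} (hv : v ∈ X) (hw : w ∉ X) :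
    ∃ i ∈ t, G.src i ∈ X ∧ G.tgt i ∉ X ∨ G.tgt i ∈ X ∧ G.src i ∉ X := by
  by_contra! h
  have := ht.joins Prop (fun v => v ∈ X) (fun j => by
    have := h j j.2
    exact propext ⟨this.1, this.2⟩) v w
  exact hw (this ▸ hv)

/-- External energies contribute only to the imaginary part, and connectedness supplies at least one
line of positive energy across the cut. -/
theorem cutE_re_pos {G : FeynmanGraph V Line} {t : Finset Line} (ht : G.ConnectedBy t)
    {e : Line → ℝ} (he : ∀ i, 0 < e i) (p : V → ℝ)
    {X : Finset V} {v w : V} (hv : v ∈ X) (hw : w ∉ X) :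
    0 < (cutE G.src G.tgt (fun i => (e i : ℂ)) (fun i => (e i : ℂ)) (extE p) X).re := by
  obtain ⟨i, -, hi⟩ := exists_crossing ht hv hw
  have hre : ∀ i, 0 ≤ (if G.src i ∈ X ∧ G.tgt i ∉ X then (e i : ℂ) else
      if G.tgt i ∈ X ∧ G.src i ∉ X then (e i : ℂ) else 0).re := by
    intro i
    split_ifs <;> simp [(he i).le]
  simp only [cutE, Complex.add_re, Complex.re_sum, extE]
  have h0 : ∑ v ∈ X, (Complex.I * (p v : ℂ)).re = 0 := by simp
  rw [h0, add_zero]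
  refine Finset.sum_pos' (fun i _ => hre i) ⟨i, Finset.mem_univ _, ?_⟩
  rcases hi with hi | hi
  · simp [hi, he i]
  · simp [hi, he i]

section Integrals

variable {p : V → ℝ} (hp : ∑ v, p v = 0) (c d : Line → ℂ) (e : Line → ℝ)

theorem ordExp_integrable {n : ℕ} {lam : Fin n → ℂ} (h : ∀ j, 0 < (lam j).re) :
    IntegrableOn (fun x : Fin n → ℝ => ∏ j, Complex.exp (-(lam j * x j)))
      (Set.univ.pi fun _ => Set.Ioi 0) ∧
    ∫ x in (Set.univ.pi fun _ => Set.Ioi 0), ∏ j : Fin n, Complex.exp (-(lam j * (x j : ℝ))) =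
      ∏ j, (lam j)⁻¹ := by
  have hneg : ∀ j, (-lam j).re < 0 := fun j => by simpa using h j
  simp only [← neg_mul]
  rw [IntegrableOn, volume_pi, Measure.restrict_pi_pi]
  refine ⟨Integrable.fintype_prod (f := fun j (x : ℝ) => Complex.exp (-lam j * x)) fun j =>
    integrableOn_exp_mul_complex_Ioi (hneg j) 0, ?_⟩
  rw [integral_fintype_prod_eq_prod (fun j (x : ℝ) => Complex.exp (-lam j * x))]
  refine Finset.prod_congr rfl fun j _ => ?_
  rw [integral_exp_mul_complex_Ioi (hneg j) 0]
  simp [neg_div_neg_eq]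

-- The set of steps is left general so that the same change of variables serves the orthant at zero
-- temperature and the corner at positive temperature.
include hp in
theorem integrableOn_integral_cone {n : ℕ} (σ : Fin (n + 1) ≃ V) {A : Set (Fin n → ℝ)}
    (hA : MeasurableSet A) (hpos : A ⊆ Set.univ.pi fun _ => Set.Ioi 0)
    (hint : IntegrableOn (ordExp G.src G.tgt (fun i => (e i : ℂ)) (fun i => (e i : ℂ))
      (extE p) σ) A) :
    IntegrableOn (G.timeFun r p fun i => lineFun (c i) (d i) (e i)) (steps r σ ⁻¹' A) ∧
    ∫ τ in steps r σ ⁻¹' A, G.timeFun r p (fun i => lineFun (c i) (d i) (e i)) τ =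
      ordCoef G.src G.tgt (fun i => c i - e i * d i) (fun i => c i + e i * d i) c σ *
      ∫ x in A, ordExp G.src G.tgt (fun i => (e i : ℂ)) (fun i => (e i : ℂ)) (extE p) σ x := by
  have hm := (measurableEmbedding_steps r σ).measurable hA
  have heq : Set.EqOn (G.timeFun r p fun i => lineFun (c i) (d i) (e i))
      ((fun x => ordCoef G.src G.tgt (fun i => c i - e i * d i) (fun i => c i + e i * d i) c σ *
        ordExp G.src G.tgt (fun i => (e i : ℂ)) (fun i => (e i : ℂ)) (extE p) σ x) ∘ steps r σ)
      (steps r σ ⁻¹' A) := by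
    intro τ hτ
    refine timeFun_of_mem_cone G r hp c d e ?_
    rw [cone_eq_preimage]
    exact hpos hτ
  constructor
  · refine IntegrableOn.congr_fun ?_ heq.symm hm
    rw [(measurePreserving_steps r σ).integrableOn_comp_preimage (measurableEmbedding_steps r σ)]
    exact hint.const_mul _
  · rw [setIntegral_congr_fun hm heq]
    refine ((measurePreserving_steps r σ).setIntegral_preimage_emb
      (measurableEmbedding_steps r σ) _ _).trans (integral_const_mul _ _)

-- On each cone the steps are independent positive variables, and every exponential integral yields
-- one inverse cut energy.
include hp in
theorem integral_timeFun_lineFun {t : Finset Line} (ht : G.ConnectedBy t) {n : ℕ}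
    (hn : Fintype.card V = n + 1) (he : ∀ i, 0 < e i) :
    ∫ τ, G.timeFun r p (fun i => lineFun (c i) (d i) (e i)) τ =
      ordSum n G.src G.tgt (fun i => (e i : ℂ)) (fun i => (e i : ℂ)) (fun i => c i - e i * d i)
        (fun i => c i + e i * d i) c (extE p) := by
  have hre : ∀ (σ : Fin (n + 1) ≃ V) (j : Fin n), 0 < (cutE G.src G.tgt (fun i => (e i : ℂ))
      (fun i => (e i : ℂ)) (extE p) (pre σ j.succ)).re := by
    intro σ j
    refine cutE_re_pos ht he p (v := σ 0) (w := σ (Fin.last n)) ?_ ?_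
    · simp [mem_pre]
    · simp [mem_pre, Fin.le_last]
  have hcone : ∀ σ : Fin (n + 1) ≃ V, _ := fun σ => integrableOn_integral_cone G r hp c d e σ
    (MeasurableSet.univ_pi fun _ => measurableSet_Ioi) subset_rfl (ordExp_integrable (hre σ)).1
  rw [← setIntegral_univ, integral_eq_sum_cone r hn MeasurableSet.univ, ordSum]
  · refine Finset.sum_congr rfl fun σ _ => ?_
    rw [Set.univ_inter, cone_eq_preimage, (hcone σ).2, ← (ordExp_integrable (hre σ)).2]
    rfl
  · intro σ
    rw [Set.univ_inter, cone_eq_preimage]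
    exact (hcone σ).1

theorem timeBox_inter_cone_of_ne {n : ℕ} {σ : Fin (n + 1) ≃ V} (hσ : σ 0 ≠ r) (β : ℝ) :
    timeBox r β ∩ cone r σ = ∅ := by
  refine Set.eq_empty_of_forall_notMem fun τ ⟨h, hc⟩ => ?_
  have h1 : rootExt r τ (σ 0) ≤ rootExt r τ (σ (σ.symm r)) :=
    StrictMono.monotone (show StrictMono (rootExt r τ ∘ σ) from hc) (Fin.zero_le _)
  rw [Equiv.apply_symm_apply, rootExt_root] at h1
  have h2 := h ⟨σ 0, hσ⟩ (Set.mem_univ _)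
  rw [← rootExt_coe r τ] at h2
  exact absurd h2.1 (not_lt.mpr h1)

theorem sum_steps {n : ℕ} (σ : Fin (n + 1) ≃ V) (hσ : σ 0 = r) (τ : {v : V // v ≠ r} → ℝ) :
    ∑ j, steps r σ τ j = rootExt r τ (σ (Fin.last n)) := by
  have h := time_eq σ (rootExt r τ) (σ 0)
  simp only [mem_pre, Equiv.symm_apply_apply, Fin.succ_pos, if_true] at h
  rw [hσ, rootExt_root] at h
  have h2 : ∑ j, steps r σ τ j = ∑ j : Fin n, (rootExt r τ (σ j.succ) - rootExt r τ (σ j.castSucc)) :=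
    rfl
  linarith

theorem timeBox_inter_cone {n : ℕ} {σ : Fin (n + 1) ≃ V} (hσ : σ 0 = r) {β : ℝ} (hβ : 0 < β) :
    timeBox r β ∩ cone r σ = steps r σ ⁻¹' corner n β := by
  ext τ
  simp only [Set.mem_inter_iff, mem_cone, Set.mem_preimage, corner, Set.mem_ofPred_eq,
    sum_steps r σ hσ]
  rw [and_comm]
  refine and_congr_right fun hc => ?_
  have hmono : StrictMono (rootExt r τ ∘ σ) := (mem_cone r).mpr hc
  constructor
  · intro h
    by_cases hl : σ (Fin.last n) = r
    · rwa [hl, rootExt_root]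
    · have := h ⟨_, hl⟩ (Set.mem_univ _)
      rw [← rootExt_coe r τ] at this
      exact this.2
  · intro h v _
    rw [← rootExt_coe r τ]
    constructor
    · have hv : 0 < σ.symm v := by
        rw [Fin.pos_iff_ne_zero]
        intro h0
        rw [Equiv.symm_apply_eq] at h0
        exact v.2 (h0.trans hσ)
      have := hmono hv
      simpa [hσ, rootExt_root] using this
    · have := hmono.monotone (Fin.le_last (σ.symm v))
      simp only [Function.comp_apply, Equiv.apply_symm_apply] at this
      exact this.trans_lt h

-- Only orderings starting at the root meet the box. As the region is bounded, no sign condition on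
-- the energies is needed, which permits reflected energies; distinct cut energies replace
-- positivity.
include hp in
theorem integral_timeBox_lineFun {n : ℕ} (hn : Fintype.card V = n + 1) {β : ℝ} (hβ : 0 < β)
    (hinj : ∀ σ : Fin (n + 1) ≃ V, Function.Injective fun k => cutE G.src G.tgt
      (fun i => (e i : ℂ)) (fun i => (e i : ℂ)) (extE p) (pre σ k)) :
    ∫ τ in timeBox r β, G.timeFun r p (fun i => lineFun (c i) (d i) (e i)) τ =
      ∑ σ : Fin (n + 1) ≃ V with σ 0 = r,
        ordCoef G.src G.tgt (fun i => c i - e i * d i) (fun i => c i + e i * d i) c σ *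
        ∑ k, Complex.exp (-(β * cutE G.src G.tgt
          (fun i => (e i : ℂ)) (fun i => (e i : ℂ)) (extE p) (pre σ k))) *
          ∏ l ∈ Finset.univ.erase k,
            (cutE G.src G.tgt (fun i => (e i : ℂ)) (fun i => (e i : ℂ)) (extE p) (pre σ l) -
            cutE G.src G.tgt (fun i => (e i : ℂ)) (fun i => (e i : ℂ)) (extE p) (pre σ k))⁻¹ := by
  have hcone : ∀ σ : Fin (n + 1) ≃ V, _ := fun σ => integrableOn_integral_cone G r hp c d e σ
    (measurableSet_corner n β) (fun x hx j _ => hx.1 j) (integrableOn_corner_prod_exp _ β)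
  rw [integral_eq_sum_cone r hn (measurableSet_timeBox r β), Finset.sum_filter]
  · refine Finset.sum_congr rfl fun σ _ => ?_
    by_cases hσ : σ 0 = r
    · rw [if_pos hσ, timeBox_inter_cone r hσ hβ, (hcone σ).2,
        ← integral_corner (hinj σ) (by rw [pre_zero, cutE_empty]) hβ]
      rfl
    · rw [if_neg hσ, timeBox_inter_cone_of_ne r hσ, setIntegral_empty]
  · intro σ
    by_cases hσ : σ 0 = r
    · rw [timeBox_inter_cone r hσ hβ]
      exact (hcone σ).1
    · rw [timeBox_inter_cone_of_ne r hσ]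
      exact integrableOn_empty

end Integrals

end FeynmanGraph

end

noncomputable section

namespace FeynmanGraph

open MeasureTheory Filter Topology

set_option linter.unusedSectionVars false

variable {V Line : Type*} [Fintype V] [DecidableEq V] [Fintype Line] [DecidableEq Line]
  (G : FeynmanGraph V Line) (r : V)

/-! ### Periodicity in Euclidean time -/

/-- The energies with the signs reversed on the lines in `u`. -/
def reflect (u : Finset Line) (E : Line → ℝ) (i : Line) : ℝ := if i ∈ u then -E i else E i

theorem reflect_of_mem {u : Finset Line} {i : Line} (h : i ∈ u) (E : Line → ℝ) :
    reflect u E i = -E i := if_pos h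

theorem reflect_of_notMem {u : Finset Line} {i : Line} (h : i ∉ u) (E : Line → ℝ) :
    reflect u E i = E i := if_neg h

/-- The lines with exactly one end in `X`. -/
def boundary (s t : Line → V) (X : Finset V) : Finset Line :=
  Finset.univ.filter fun i => s i ∈ X ∧ t i ∉ X ∨ t i ∈ X ∧ s i ∉ X

theorem mem_boundary {s t : Line → V} {X : Finset V} {i : Line} :
    i ∈ boundary s t X ↔ (s i ∈ X ∧ t i ∉ X ∨ t i ∈ X ∧ s i ∉ X) := by simp [boundary]

theorem cutE_self (s t : Line → V) (a : Line → ℂ) (P : V → ℂ) (X : Finset V) :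
    cutE s t a a P X = ∑ i, (if i ∈ boundary s t X then a i else 0) + ∑ v ∈ X, P v := by
  rw [cutE]
  congr 1
  refine Finset.sum_congr rfl fun i _ => ?_
  by_cases h1 : s i ∈ X <;> by_cases h2 : t i ∈ X <;> simp [mem_boundary, h1, h2]

theorem reflect_symmDiff (u B : Finset Line) (E : Line → ℝ) :
    reflect (symmDiff u B) E = reflect B (reflect u E) := by
  funext i
  simp only [reflect, Finset.mem_symmDiff]
  by_cases h1 : i ∈ u <;> by_cases h2 : i ∈ B <;> simp [h1, h2]

/-- The summand of time-ordered perturbation theory belonging to one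
ordering of the vertices. -/
def ordTerm {n : ℕ} (c d : Line → ℂ) (p : V → ℝ) (e : Line → ℝ) (σ : Fin (n + 1) ≃ V) : ℂ :=
  ordCoef G.src G.tgt (fun i => c i - e i * d i) (fun i => c i + e i * d i) c σ *
    ∏ j : Fin n, (cutE G.src G.tgt (fun i => (e i : ℂ)) (fun i => (e i : ℂ)) (extE p)
      (pre σ j.succ))⁻¹

/-- The cyclic rotation of an ordering. -/
def rotate {n : ℕ} (k : Fin (n + 1)) (σ : Fin (n + 1) ≃ V) : Fin (n + 1) ≃ V :=
  (Equiv.addRight k).trans σ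

theorem rotate_symm {n : ℕ} (k : Fin (n + 1)) (σ : Fin (n + 1) ≃ V) (v : V) :
    (rotate k σ).symm v = σ.symm v - k := by
  simp [rotate, sub_eq_add_neg]

theorem sum_rotate {n : ℕ} (F : (Fin (n + 1) ≃ V) → ℂ) :
    ∑ σ : Fin (n + 1) ≃ V with σ 0 = r, ∑ k, F (rotate k σ) = ∑ σ, F σ := by
  rw [← Finset.sum_product']
  -- Every ordering has exactly one rotation that brings the root to the first position.
  refine Finset.sum_nbij' (fun x => rotate x.2 x.1)
    (fun σ => (rotate (σ.symm r) σ, -σ.symm r)) ?_ ?_ ?_ ?_ ?_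
  · simp
  · simp [rotate]
  · rintro ⟨σ, k⟩ h
    have h0 : σ 0 = r := by simpa using h
    have h1 : σ.symm r = 0 := by rw [← h0, Equiv.symm_apply_apply]
    ext1
    · refine Equiv.ext fun j => ?_
      simp [rotate, h1]
    · simp [rotate_symm, h1]
  · intro σ _
    refine Equiv.ext fun j => ?_
    simp [rotate]
  · simp

/-- Subtraction wraps around: after rotation by k the positions from k on come first, followed by
those below k. -/
theorem Fin.sub_lt_sub_iff {n : ℕ} (a k l : Fin (n + 1)) :
    a - k < l - k ↔ if k ≤ l then k ≤ a ∧ a < l else (a < l ∨ k ≤ a) := by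
  have hs : ∀ x : Fin (n + 1), ((x - k : Fin (n + 1)) : ℕ) =
      if k ≤ x then (x : ℕ) - k else n + 1 + x - k := by
    intro x
    split_ifs with h
    · exact Fin.coe_sub_iff_le.mpr h
    · exact Fin.coe_sub_iff_lt.mpr (not_le.mp h)
  rw [Fin.lt_def, hs a, hs l]
  have := a.2
  have := k.2
  have := l.2
  simp only [Fin.le_def, Fin.lt_def]
  split_ifs <;> omega

theorem prod_erase_sub {n : ℕ} (k : Fin (n + 1)) (F : Fin (n + 1) → ℂ) :
    ∏ l ∈ Finset.univ.erase k, F (l - k) = ∏ j : Fin n, F j.succ := by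
  have h1 : ∏ l ∈ Finset.univ.erase k, F (l - k) = ∏ l ∈ Finset.univ.erase 0, F l := by
    refine Finset.prod_nbij' (fun l => l - k) (fun l => l + k) ?_ ?_ ?_ ?_ ?_
    · simp [sub_eq_zero]
    · simp
    · simp
    · simp
    · simp
  have h2 : (Finset.univ.erase 0 : Finset (Fin (n + 1))) = Finset.univ.map (Fin.succEmb n) := by
    ext l
    simp only [Finset.mem_erase, Finset.mem_univ, and_true, Finset.mem_map, true_and,
      Fin.coe_succEmb]
    exact ⟨fun h => ⟨l.pred h, by simp⟩, fun ⟨a, h⟩ => h ▸ Fin.succ_ne_zero a⟩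
  rw [h1, h2, Finset.prod_map]
  rfl

/-! ### Effect of a cyclic rotation on numerators and cut energies -/

section Rotation

variable {p : V → ℝ} (c d : Line → ℂ) (e : Line → ℝ) {n : ℕ} (σ : Fin (n + 1) ≃ V)
  (k : Fin (n + 1))

/-- Rotation by k moves the initial segment `pre σ k` behind the rest, reversing the time order of
exactly the lines across that cut. Reversing a line amounts to changing the sign of its energy in
the numerator. -/
theorem ordCoef_reflect_boundary :
    ordCoef G.src G.tgt
      (fun i => c i - (reflect (boundary G.src G.tgt (pre σ k)) e i : ℝ) * d i)
      (fun i => c i + (reflect (boundary G.src G.tgt (pre σ k)) e i : ℝ) * d i) c σ =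
    ordCoef G.src G.tgt (fun i => c i - e i * d i) (fun i => c i + e i * d i) c (rotate k σ) := by
  refine Finset.prod_congr rfl fun i _ => ?_
  simp only [rotate_symm, Fin.sub_lt_sub_iff, reflect, mem_boundary, mem_pre]
  generalize σ.symm (G.src i) = a
  generalize σ.symm (G.tgt i) = b
  by_cases h1 : a < k <;> by_cases h2 : b < k
  · simp [h1, h2, not_le.mpr h1, not_le.mpr h2]
  · have h3 : a < b := h1.trans_le (not_lt.mp h2)
    simp [h1, h2, h3, not_le.mpr h1, not_lt.mp h2, h3.not_gt]
  · have h3 : b < a := h2.trans_le (not_lt.mp h1)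
    simp [h1, h2, h3, not_le.mpr h2, not_lt.mp h1, h3.not_gt, ← sub_eq_add_neg]
  · simp [h1, h2, not_lt.mp h1, not_lt.mp h2]

/-- For l > k the difference of the two cuts is the cut around the block of vertices from k to l: a
line crossing both cuts cancels, and one crossing only the k-th gets the right sign from its
reflection. For l < k the rotated segment is the complement of a block, with the same lines, and the
external energies agree because they sum to 0. -/
theorem cutE_sub_reflect_boundary (hp : ∑ v, p v = 0) {l : Fin (n + 1)} (hl : l ≠ k) :
    cutE G.src G.tgt (fun i => ((reflect (boundary G.src G.tgt (pre σ k)) e i : ℝ) : ℂ))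
        (fun i => ((reflect (boundary G.src G.tgt (pre σ k)) e i : ℝ) : ℂ)) (extE p) (pre σ l) -
      cutE G.src G.tgt (fun i => ((reflect (boundary G.src G.tgt (pre σ k)) e i : ℝ) : ℂ))
        (fun i => ((reflect (boundary G.src G.tgt (pre σ k)) e i : ℝ) : ℂ)) (extE p) (pre σ k) =
      cutE G.src G.tgt (fun i => (e i : ℂ)) (fun i => (e i : ℂ)) (extE p)
        (pre (rotate k σ) (l - k)) := by
  simp only [cutE_self]
  rw [add_sub_add_comm, ← Finset.sum_sub_distrib]
  have hP : ∑ v, extE p v = 0 := by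
    simp only [extE, ← Finset.mul_sum, ← Complex.ofReal_sum, hp]
    simp
  have hind : ∀ X : Finset V, ∑ v ∈ X, extE p v = ∑ v, if v ∈ X then extE p v else 0 := by
    intro X; rw [← Finset.sum_filter]; simp
  congr 1
  · refine Finset.sum_congr rfl fun i _ => ?_
    simp only [rotate_symm, Fin.sub_lt_sub_iff, reflect, mem_boundary, mem_pre]
    generalize σ.symm (G.src i) = a
    generalize σ.symm (G.tgt i) = b
    rcases lt_or_gt_of_ne hl with h | h
    · simp only [not_le.mpr h, if_false]
      by_cases h1 : a < k <;> by_cases h2 : b < k <;> by_cases h3 : a < l <;> by_cases h4 : b < l <;>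
        first
        | exact absurd (h3.trans h) h1
        | exact absurd (h4.trans h) h2
        | simp [h1, h2, h3, h4, ← not_lt]
    · simp only [h.le, if_true]
      by_cases h1 : a < k <;> by_cases h2 : b < k <;> by_cases h3 : a < l <;> by_cases h4 : b < l <;>
        first
        | exact absurd (h1.trans h) h3
        | exact absurd (h2.trans h) h4
        | simp [h1, h2, h3, h4, ← not_lt]
  · simp only [hind, mem_pre, rotate_symm, Fin.sub_lt_sub_iff]
    rcases lt_or_gt_of_ne hl with h | h
    · rw [← add_zero (_ - _), ← hP, ← Finset.sum_sub_distrib, ← Finset.sum_add_distrib]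
      refine Finset.sum_congr rfl fun v _ => ?_
      generalize σ.symm v = a
      simp only [not_le.mpr h, if_false]
      by_cases h1 : a < k <;> by_cases h3 : a < l <;>
        first
        | exact absurd (h3.trans h) h1
        | simp [h1, h3, ← not_lt]
    · rw [← Finset.sum_sub_distrib]
      refine Finset.sum_congr rfl fun v _ => ?_
      generalize σ.symm v = a
      simp only [h.le, if_true]
      by_cases h1 : a < k <;> by_cases h3 : a < l <;>
        first
        | exact absurd (h1.trans h) h3
        | simp [h1, h3, ← not_lt]

theorem ordTerm_rotate (hp : ∑ v, p v = 0) :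
    ordCoef G.src G.tgt
      (fun i => c i - (reflect (boundary G.src G.tgt (pre σ k)) e i : ℝ) * d i)
      (fun i => c i + (reflect (boundary G.src G.tgt (pre σ k)) e i : ℝ) * d i) c σ *
    ∏ l ∈ Finset.univ.erase k,
      (cutE G.src G.tgt (fun i => ((reflect (boundary G.src G.tgt (pre σ k)) e i : ℝ) : ℂ))
        (fun i => ((reflect (boundary G.src G.tgt (pre σ k)) e i : ℝ) : ℂ)) (extE p) (pre σ l) -
      cutE G.src G.tgt (fun i => ((reflect (boundary G.src G.tgt (pre σ k)) e i : ℝ) : ℂ))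
        (fun i => ((reflect (boundary G.src G.tgt (pre σ k)) e i : ℝ) : ℂ)) (extE p) (pre σ k))⁻¹ =
    G.ordTerm c d p e (rotate k σ) := by
  rw [ordTerm, ordCoef_reflect_boundary]
  congr 1
  rw [← prod_erase_sub k fun m => (cutE G.src G.tgt (fun i => (e i : ℂ)) (fun i => (e i : ℂ))
    (extE p) (pre (rotate k σ) m))⁻¹]
  refine Finset.prod_congr rfl fun l hl => ?_
  rw [cutE_sub_reflect_boundary G e σ k hp (Finset.ne_of_mem_erase hl)]

end Rotation

/-! ### The KMS relation for a whole cut -/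

section Periodicity

variable {T : ℝ} {p : V → ℝ}

/-- For Matsubara external energies the factor of `X` is (-1) to the number of fermionic line ends
in `X`. A line with both ends in `X` counts twice and drops out, leaving one sign for each line of
the boundary. -/
theorem exp_extE (hT : 0 < T) (hM : G.IsMatsubaraExternal T p) (X : Finset V) :
    Complex.exp (-((1 / T : ℝ) * ∑ v ∈ X, extE p v)) =
      ∏ i, if i ∈ boundary G.src G.tgt X then (G.statSign i : ℂ) else 1 := by
  have hprod : ∀ (f : Line → V) (v : V), ∏ i, (if f i = v then (G.statSign i : ℂ) else 1) =
      (-1) ^ (G.fermionic.filter fun i => f i = v).card := by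
    intro f v
    rw [← Finset.prod_const, Finset.prod_filter, ← Finset.prod_filter_mul_prod_filter_not
      Finset.univ (· ∈ G.fermionic)]
    rw [Finset.prod_eq_one (s := Finset.univ.filter (· ∉ G.fermionic)), mul_one]
    · refine Finset.prod_congr (by ext; simp) fun i hi => ?_
      simp [statSign, (by simpa using hi : i ∈ G.fermionic)]
    · intro i hi
      simp [statSign, (by simpa using hi : i ∉ G.fermionic)]
  have hv : ∀ v, Complex.exp (-((1 / T : ℝ) * extE p v)) =
      ∏ i, ((if G.src i = v then (G.statSign i : ℂ) else 1) *
        (if G.tgt i = v then (G.statSign i : ℂ) else 1)) := by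
    intro v
    obtain ⟨m, hm⟩ := hM v
    rw [Finset.prod_mul_distrib, hprod, hprod, ← pow_add]
    set N := (G.fermionic.filter fun i => G.src i = v).card +
      (G.fermionic.filter fun i => G.tgt i = v).card
    have : -(((1 / T : ℝ) : ℂ) * extE p v) = ((-m : ℤ) : ℂ) * (2 * Real.pi * Complex.I) +
        -((N : ℕ) * (Real.pi * Complex.I)) := by
      have hT' : (T : ℂ) ≠ 0 := by exact_mod_cast hT.ne'
      rw [extE, hm]
      push_cast
      field_simp
      ring
    rw [this, Complex.exp_add, Complex.exp_int_mul_two_pi_mul_I, one_mul, Complex.exp_neg,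
      Complex.exp_nat_mul, Complex.exp_pi_mul_I, ← inv_pow, inv_neg, inv_one]
  rw [Finset.mul_sum, ← Finset.sum_neg_distrib, Complex.exp_sum, Finset.prod_congr rfl fun v _ => hv v,
    Finset.prod_comm]
  refine Finset.prod_congr rfl fun i _ => ?_
  have hsq : (G.statSign i : ℂ) * G.statSign i = 1 := by
    exact_mod_cast (G.isStatistics i).sq_eq
  rw [Finset.prod_mul_distrib, Finset.prod_ite_eq, Finset.prod_ite_eq]
  simp only [mem_boundary]
  by_cases h1 : G.src i ∈ X <;> by_cases h2 : G.tgt i ∈ X <;> simp [h1, h2, hsq]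

/-- The coefficient of the energies reversed on `u` in the thermal propagators. -/
def thermalWeight (T : ℝ) (E : Line → ℝ) (u : Finset Line) : ℂ :=
  ∏ i, if i ∈ u then (occ (G.statSign i) T (E i) : ℂ) else 1 + occ (G.statSign i) T (E i)

/-- Line by line, flipping a boundary line exchanges N and 1 + N. The KMS relation undoes this with
the Boltzmann factor of the reflected energy, and the statistics sign is cancelled by the external
energies. -/
theorem thermalWeight_symmDiff_boundary (hT : 0 < T) (hM : G.IsMatsubaraExternal T p)
    {E : Line → ℝ} (hE : ∀ i, E i ≠ 0) (u : Finset Line) (X : Finset V) :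
    G.thermalWeight T E (symmDiff u (boundary G.src G.tgt X)) *
      Complex.exp (-((1 / T : ℝ) * cutE G.src G.tgt
        (fun i => ((reflect (symmDiff u (boundary G.src G.tgt X)) E i : ℝ) : ℂ))
        (fun i => ((reflect (symmDiff u (boundary G.src G.tgt X)) E i : ℝ) : ℂ)) (extE p) X)) =
      G.thermalWeight T E u := by
  rw [cutE_self, mul_add, neg_add, Complex.exp_add, exp_extE G hT hM, Finset.mul_sum,
    ← Finset.sum_neg_distrib, Complex.exp_sum, thermalWeight, ← Finset.prod_mul_distrib,
    ← Finset.prod_mul_distrib, thermalWeight]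
  refine Finset.prod_congr rfl fun i _ => ?_
  have hst := G.isStatistics i
  have hsq : G.statSign i * G.statSign i = 1 := hst.sq_eq
  have h1 := occ_kms hsq hT (hE i)
  have h2 := occ_kms' hsq hT (hE i)
  by_cases hB : i ∈ boundary G.src G.tgt X
  · by_cases hu : i ∈ u
    · have h3 : (1 + occ (G.statSign i) T (E i)) * (Real.exp (-(E i / T)) * G.statSign i) =
          occ (G.statSign i) T (E i) := by
        rw [← mul_assoc, h2, mul_right_comm, hsq, one_mul]
      simp only [Finset.mem_symmDiff, hB, hu, reflect, not_true, and_false, or_self, if_false, if_true]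
      refine Eq.trans ?_ (congrArg Complex.ofReal h3)
      push_cast
      congr 4
      field_simp
    · have h3 : occ (G.statSign i) T (E i) * (Real.exp (E i / T) * G.statSign i) =
          1 + occ (G.statSign i) T (E i) := by
        rw [← mul_assoc, h1, mul_right_comm, hsq, one_mul]
      simp only [Finset.mem_symmDiff, hB, hu, reflect, not_true, not_false_eq_true, and_self,
        or_true, if_false, if_true]
      rw [← Complex.ofReal_one, ← Complex.ofReal_add]
      refine Eq.trans ?_ (congrArg Complex.ofReal h3)
      push_cast
      congr 3
      field_simp
  · simp [Finset.mem_symmDiff, hB]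

end Periodicity

end FeynmanGraph

end

noncomputable section

namespace FeynmanGraph

open MeasureTheory Filter Topology

set_option linter.unusedSectionVars false

variable {V Line : Type*} [Fintype V] [DecidableEq V] [Fintype Line] [DecidableEq Line]
  (G : FeynmanGraph V Line) (r : V)

/-! ### The thermal function as a sum over reflected energies -/

/-- Allows for exponential growth, since reflected energies may be negative; on the bounded time box
this still gives domination. -/
theorem norm_lineFun_le (c d : ℂ) (e x : ℝ) :
    ‖lineFun c d e x‖ ≤ (‖c‖ + |e| * ‖d‖) * Real.exp (|e| * |x|) := by
  have h1 : ‖(Real.exp (-(e * |x|)) : ℂ)‖ ≤ Real.exp (|e| * |x|) := by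
    rw [Complex.norm_real, Real.norm_of_nonneg (Real.exp_pos _).le]
    refine Real.exp_le_exp.mpr ?_
    have := neg_abs_le (e * |x|)
    rw [abs_mul, abs_abs] at this
    linarith [neg_abs_le (e * |x|)]
  have hed : ‖(e : ℂ) * d‖ = |e| * ‖d‖ := by rw [norm_mul, Complex.norm_real, Real.norm_eq_abs]
  have h2 : ‖if 0 < x then c - e * d else if x < 0 then c + e * d else c‖ ≤ ‖c‖ + |e| * ‖d‖ := by
    rw [← hed]
    split_ifs
    · exact norm_sub_le _ _
    · exact norm_add_le _ _
    · exact le_add_of_nonneg_right (norm_nonneg _)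
  rw [lineFun, norm_mul]
  exact mul_le_mul h2 h1 (norm_nonneg _) (by positivity)

theorem measurable_timeFun (p : V → ℝ) {g : Line → ℝ → ℂ} (hg : ∀ i, Measurable (g i)) :
    Measurable (G.timeFun r p g) := by
  unfold timeFun
  refine (continuous_phase r p).measurable.mul (Finset.measurable_fun_prod _ fun i _ => ?_)
  exact (hg i).comp (continuous_edgeDiff_apply r G.src G.tgt i).measurable

theorem norm_timeFun_lineFun_le (p : V → ℝ) (c d : Line → ℂ) {e M : Line → ℝ}
    (hM : ∀ i, |e i| ≤ M i) {β : ℝ} (hβ : 0 < β) {τ : {v : V // v ≠ r} → ℝ} (hτ : τ ∈ timeBox r β) :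
    ‖G.timeFun r p (fun i => lineFun (c i) (d i) (e i)) τ‖ ≤
      ∏ i, (‖c i‖ + M i * ‖d i‖) * Real.exp (M i * β) := by
  rw [timeFun, norm_mul, norm_exp_I_ofReal, one_mul, norm_prod]
  refine Finset.prod_le_prod (fun _ _ => norm_nonneg _) fun i _ => (norm_lineFun_le _ _ _ _).trans ?_
  have h0 : 0 ≤ M i := (abs_nonneg _).trans (hM i)
  have h1 := (abs_edgeDiff_lt hβ hτ G.src G.tgt i).le
  gcongr
  · exact hM i
  · exact hM i

theorem integrableOn_timeBox (p : V → ℝ) (c d : Line → ℂ) (e : Line → ℝ) {β : ℝ}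
    (hβ : 0 < β) : IntegrableOn (G.timeFun r p fun i => lineFun (c i) (d i) (e i)) (timeBox r β) := by
  have := isFiniteMeasure_timeBox r β
  refine Integrable.of_bound (measurable_timeFun G r p fun i =>
    measurable_lineFun _ _ _).aestronglyMeasurable
    (∏ i, (‖c i‖ + |e i| * ‖d i‖) * Real.exp (|e i| * β)) ?_
  filter_upwards [ae_restrict_mem (measurableSet_timeBox r β)] with τ hτ
  exact norm_timeFun_lineFun_le G r p c d (fun i => le_rfl) hβ hτ

theorem timeFun_thermalFun (p : V → ℝ) (c d : Line → ℂ) (T : ℝ) (E : Line → ℝ)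
    (τ : {v : V // v ≠ r} → ℝ) :
    G.timeFun r p (fun i => thermalFun (c i) (d i) T (G.statSign i) (E i)) τ =
      ∑ u, G.thermalWeight T E u * G.timeFun r p (fun i => lineFun (c i) (d i) (reflect u E i)) τ := by
  simp only [timeFun, thermalFun]
  rw [Finset.prod_congr rfl fun i _ => add_comm _ _, Finset.prod_add, Finset.powerset_univ,
    Finset.mul_sum]
  refine Finset.sum_congr rfl fun u _ => ?_
  rw [mul_left_comm (thermalWeight _ _ _ _), thermalWeight]
  congr 1
  rw [← Finset.prod_mul_distrib]
  refine Eq.trans ?_ (Eq.trans (Finset.prod_piecewise Finset.univ u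
    (fun i => (occ (G.statSign i) T (E i) : ℂ) * lineFun (c i) (d i) (-E i)
      (edgeDiff G.src G.tgt r τ i))
    (fun i => ((1 + occ (G.statSign i) T (E i) : ℝ) : ℂ) * lineFun (c i) (d i) (E i)
      (edgeDiff G.src G.tgt r τ i))).symm ?_)
  · rw [Finset.univ_inter]
  refine Finset.prod_congr rfl fun i _ => ?_
  by_cases h : i ∈ u <;> simp [h, reflect]

theorem integral_timeBox_thermalFun (p : V → ℝ) (c d : Line → ℂ) (T : ℝ) {β : ℝ}
    (hβ : 0 < β) (E : Line → ℝ) :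
    ∫ τ in timeBox r β, G.timeFun r p
        (fun i => thermalFun (c i) (d i) T (G.statSign i) (E i)) τ =
      ∑ u, G.thermalWeight T E u *
        ∫ τ in timeBox r β, G.timeFun r p (fun i => lineFun (c i) (d i) (reflect u E i)) τ := by
  simp only [timeFun_thermalFun]
  rw [integral_finsetSum _ fun u _ => (integrableOn_timeBox G r p c d _ hβ).const_mul _]
  simp only [integral_const_mul]

/-- The sum of time-ordered perturbation theory as a function of the line energies. -/
def lineOrdSum (n : ℕ) (c d : Line → ℂ) (p : V → ℝ) (e : Line → ℝ) : ℂ :=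
  ∑ σ : Fin (n + 1) ≃ V, G.ordTerm c d p e σ

/-- The box integrals and the zero-temperature terms do not agree for an individual u. They agree
after summation over u, the k-th exponential term for u being matched with the rotation by k for u
with the lines across the k-th cut flipped. -/
theorem integral_timeBox_thermalFun_eq {n : ℕ} (hn : Fintype.card V = n + 1) {p : V → ℝ}
    (hp : ∑ v, p v = 0) (c d : Line → ℂ) {T : ℝ} (hT : 0 < T) (hM : G.IsMatsubaraExternal T p)
    {E : Line → ℝ} (hE : ∀ i, E i ≠ 0)
    (hinj : ∀ (u : Finset Line) (σ : Fin (n + 1) ≃ V), Function.Injective fun k =>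
      cutE G.src G.tgt (fun i => ((reflect u E i : ℝ) : ℂ)) (fun i => ((reflect u E i : ℝ) : ℂ)) (extE p)
        (pre σ k)) :
    ∫ τ in timeBox r (1 / T), G.timeFun r p
        (fun i => thermalFun (c i) (d i) T (G.statSign i) (E i)) τ =
      ∑ u, G.thermalWeight T E u * G.lineOrdSum n c d p (reflect u E) := by
  have h1 : ∀ u : Finset Line, G.thermalWeight T E u *
      ∫ τ in timeBox r (1 / T), G.timeFun r p (fun i => lineFun (c i) (d i) (reflect u E i)) τ =
      ∑ σ : Fin (n + 1) ≃ V with σ 0 = r, ∑ k, (G.thermalWeight T E u * Complex.exp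
        (-((1 / T : ℝ) * cutE G.src G.tgt (fun i => ((reflect u E i : ℝ) : ℂ))
          (fun i => ((reflect u E i : ℝ) : ℂ)) (extE p) (pre σ k)))) *
        (ordCoef G.src G.tgt (fun i => c i - reflect u E i * d i) (fun i => c i + reflect u E i * d i) c σ *
          ∏ l ∈ Finset.univ.erase k,
            (cutE G.src G.tgt (fun i => ((reflect u E i : ℝ) : ℂ)) (fun i => ((reflect u E i : ℝ) : ℂ))
              (extE p) (pre σ l) -
            cutE G.src G.tgt (fun i => ((reflect u E i : ℝ) : ℂ)) (fun i => ((reflect u E i : ℝ) : ℂ))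
              (extE p) (pre σ k))⁻¹) := by
    intro u
    rw [integral_timeBox_lineFun G r hp c d (reflect u E) hn (one_div_pos.mpr hT) (hinj u),
      Finset.mul_sum]
    refine Finset.sum_congr rfl fun σ _ => ?_
    rw [Finset.mul_sum, Finset.mul_sum]
    refine Finset.sum_congr rfl fun k _ => ?_
    ring
  rw [integral_timeBox_thermalFun G r p c d T (one_div_pos.mpr hT), Finset.sum_congr rfl fun u _ => h1 u, Finset.sum_comm]
  have h2 : ∀ u : Finset Line, G.thermalWeight T E u * G.lineOrdSum n c d p (reflect u E) =
      ∑ σ : Fin (n + 1) ≃ V with σ 0 = r, ∑ k,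
        G.thermalWeight T E u * G.ordTerm c d p (reflect u E) (rotate k σ) := by
    intro u
    rw [lineOrdSum, ← sum_rotate r, Finset.mul_sum]
    simp only [Finset.mul_sum]
  rw [Finset.sum_congr rfl fun u _ => h2 u, Finset.sum_comm (s := Finset.univ (α := Finset Line))]
  refine Finset.sum_congr rfl fun σ _ => ?_
  rw [Finset.sum_comm, Finset.sum_comm (s := Finset.univ (α := Finset Line))]
  refine Finset.sum_congr rfl fun k _ => ?_
  -- With σ and k fixed, u ↦ u ∆ B is an involution of the sets of reflected lines; after this
  -- substitution the sums agree term by term.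
  let B := boundary G.src G.tgt (pre σ k)
  have hinv : Function.Involutive fun u : Finset Line => symmDiff u B := fun u =>
    symmDiff_symmDiff_cancel_right B u
  rw [← Equiv.sum_comp hinv.toPerm]
  refine Finset.sum_congr rfl fun u _ => ?_
  simp only [Function.Involutive.coe_toPerm]
  rw [thermalWeight_symmDiff_boundary G hT hM hE, reflect_symmDiff, ordTerm_rotate G c d _ σ k hp]

end FeynmanGraph

end

noncomputable section

namespace FeynmanGraph

open MeasureTheory Filter Topology

set_option linter.unusedSectionVars false

variable {V Line : Type*} [Fintype V] [DecidableEq V] [Fintype Line] [DecidableEq Line]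

/-! ### Factorization of sums over orderings -/

/-- The sum over the orderings of the set `X` of the product of the factors `F Y v` for a vertex `v`
following the set `Y`. -/
def ordW (F : Finset V → V → ℂ) (m : ℕ) (X : Finset V) : ℂ :=
  ∑ g : Fin m → V with (Function.Injective g ∧ Finset.univ.image g = X),
    ∏ k, F ((Finset.univ.filter (· < k)).image g) (g k)

theorem ordW_zero (F : Finset V → V → ℂ) : ordW F 0 ∅ = 1 := by
  simp [ordW, Function.injective_of_subsingleton]

theorem image_snoc {m : ℕ} (g : Fin m → V) (v : V) :
    Finset.univ.image (Fin.snoc g v : Fin (m + 1) → V) = insert v (Finset.univ.image g) := by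
  ext w
  simp only [Finset.mem_image, Finset.mem_univ, true_and, Finset.mem_insert, Fin.exists_fin_succ',
    Fin.snoc_castSucc, Fin.snoc_last]
  rw [or_comm, eq_comm]

theorem image_filter_snoc_castSucc {m : ℕ} (g : Fin m → V) (v : V) (k : Fin m) :
    (Finset.univ.filter (· < k.castSucc)).image (Fin.snoc g v : Fin (m + 1) → V) =
      (Finset.univ.filter (· < k)).image g := by
  ext w
  simp only [Finset.mem_image, Finset.mem_filter, Finset.mem_univ, true_and, Fin.exists_fin_succ',
    Fin.snoc_castSucc, Fin.snoc_last, Fin.castSucc_lt_castSucc_iff]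
  simp [(Fin.castSucc_lt_last k).not_gt]

theorem image_filter_snoc_last {m : ℕ} (g : Fin m → V) (v : V) :
    (Finset.univ.filter (· < Fin.last m)).image (Fin.snoc g v : Fin (m + 1) → V) =
      Finset.univ.image g := by
  ext w
  simp only [Finset.mem_image, Finset.mem_filter, Finset.mem_univ, true_and, Fin.exists_fin_succ',
    Fin.snoc_castSucc, Fin.snoc_last, Fin.castSucc_lt_last, lt_irrefl, false_and, or_false]

theorem snoc_injective_and {m : ℕ} (g : Fin m → V) (v : V) (X : Finset V) :
    (Function.Injective (Fin.snoc g v : Fin (m + 1) → V) ∧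
      Finset.univ.image (Fin.snoc g v : Fin (m + 1) → V) = X) ↔
    v ∈ X ∧ (Function.Injective g ∧ Finset.univ.image g = X.erase v) := by
  rw [image_snoc, Fin.snoc_injective_iff]
  have hmem : v ∉ Set.range g ↔ v ∉ Finset.univ.image g := by simp
  rw [hmem]
  constructor
  · rintro ⟨⟨h1, h2⟩, rfl⟩
    exact ⟨Finset.mem_insert_self _ _, h1, (Finset.erase_insert h2).symm⟩
  · rintro ⟨h1, h2, h3⟩
    rw [h3]
    exact ⟨⟨h2, Finset.notMem_erase v X⟩, Finset.insert_erase h1⟩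

theorem ordW_succ (F : Finset V → V → ℂ) (m : ℕ) (X : Finset V) :
    ordW F (m + 1) X = ∑ v ∈ X, F (X.erase v) v * ordW F m (X.erase v) := by
  have h1 : ∀ v, ordW F m (X.erase v) = ∑ g : Fin m → V,
      if Function.Injective g ∧ Finset.univ.image g = X.erase v then
        ∏ k, F ((Finset.univ.filter (· < k)).image g) (g k) else 0 := by
    intro v; rw [ordW, Finset.sum_filter]
  rw [ordW, Finset.sum_filter, ← Equiv.sum_comp (Fin.snocEquiv fun _ : Fin (m + 1) => V),
    Fintype.sum_prod_type, ← Finset.sum_filter_add_sum_filter_not Finset.univ (· ∈ X)]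
  rw [Finset.sum_eq_zero (s := Finset.univ.filter (· ∉ X)), add_zero]
  · refine Finset.sum_congr (by ext; simp) fun v hv => ?_
    have hv' : v ∈ X := by simpa using hv
    rw [h1, Finset.mul_sum]
    refine Finset.sum_congr rfl fun g _ => ?_
    change (if Function.Injective (Fin.snoc g v : Fin (m + 1) → V) ∧
      Finset.univ.image (Fin.snoc g v : Fin (m + 1) → V) = X then
      ∏ k, F ((Finset.univ.filter (· < k)).image (Fin.snoc g v : Fin (m + 1) → V))
        ((Fin.snoc g v : Fin (m + 1) → V) k) else 0) = _
    simp only [snoc_injective_and, hv', true_and]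
    rw [mul_ite, mul_zero]
    refine if_ctx_congr Iff.rfl (fun h => ?_) fun _ => rfl
    rw [Fin.prod_univ_castSucc, image_filter_snoc_last, Fin.snoc_last, h.2, mul_comm]
    simp only [image_filter_snoc_castSucc, Fin.snoc_castSucc]
  · intro v hv
    have hv' : v ∉ X := by simpa using hv
    refine Finset.sum_eq_zero fun g _ => if_neg ?_
    change ¬(Function.Injective (Fin.snoc g v : Fin (m + 1) → V) ∧
      Finset.univ.image (Fin.snoc g v : Fin (m + 1) → V) = X)
    rw [snoc_injective_and]
    exact fun h => hv' h.1

theorem sum_equiv_eq_ordW {n : ℕ} (hn : Fintype.card V = n + 1) (F : Finset V → V → ℂ) :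
    ∑ σ : Fin (n + 1) ≃ V, ∏ k, F (pre σ k) (σ k) = ordW F (n + 1) Finset.univ := by
  rw [ordW]
  refine Finset.sum_bij (fun σ _ => σ) ?_ ?_ ?_ ?_
  · intro σ _
    simpa using σ.injective
  · intro σ _ σ' _ h
    exact DFunLike.coe_injective h
  · intro g hg
    have hg' : Function.Injective g := by simpa using (Finset.mem_filter.mp hg).2.1
    have hb : Function.Bijective g :=
      (Fintype.bijective_iff_injective_and_card g).mpr ⟨hg', by simp [hn]⟩
    exact ⟨Equiv.ofBijective g hb, Finset.mem_univ _, rfl⟩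
  · intro σ _
    refine Finset.prod_congr rfl fun k _ => ?_
    congr 1
    ext v
    simp only [mem_pre, Finset.mem_image, Finset.mem_filter, Finset.mem_univ, true_and]
    exact ⟨fun h => ⟨_, h, by simp⟩, by rintro ⟨l, hl, rfl⟩; simpa using hl⟩

/-- Sums over orderings of all vertices vanish if the cut energies are additive over a partition of
the vertices and the total energy is zero. -/
theorem ordW_univ_eq_zero {n : ℕ} (hn : Fintype.card V = n + 1) {A : Finset V}
    (hA : A.Nonempty) (hA' : A ≠ Finset.univ) {lam : Finset V → ℂ} {γ : Finset V → V → ℂ}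
    (hlam : ∀ X, lam X = lam (X ∩ A) + lam (X \ A)) (hlam0 : lam Finset.univ = 0)
    (hne : ∀ X : Finset V, X.Nonempty → X ≠ Finset.univ → lam X ≠ 0)
    (hγ : ∀ Y, ∀ v ∈ A, γ Y v = γ (Y ∩ A) v) (hγ' : ∀ Y, ∀ v ∉ A, γ Y v = γ (Y \ A) v) :
    ordW (fun Y v => γ Y v * if insert v Y = Finset.univ then 1 else (lam (insert v Y))⁻¹) (n + 1)
      Finset.univ = 0 := by
  set F : Finset V → V → ℂ :=
    fun Y v => γ Y v * if insert v Y = Finset.univ then 1 else (lam (insert v Y))⁻¹ with hF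
  let W : Finset V → ℂ := fun X => ordW F X.card X
  have hlamE : lam ∅ = 0 := by
    have := hlam ∅
    simp only [Finset.empty_inter, Finset.empty_sdiff] at this
    simpa using this
  -- Multiplication by `lam X` clears the last denominator of every ordering of X, leaving a sum
  -- over the last vertex.
  have hrec : ∀ X : Finset V, X ≠ Finset.univ →
      lam X * W X = ∑ v ∈ X, γ (X.erase v) v * W (X.erase v) := by
    intro X hX
    rcases X.eq_empty_or_nonempty with rfl | hX'
    · simp [hlamE]
    · obtain ⟨m, hm⟩ : ∃ m, X.card = m + 1 := ⟨X.card - 1, by have := hX'.card_pos; omega⟩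
      simp only [W]
      rw [hm, ordW_succ, Finset.mul_sum]
      refine Finset.sum_congr rfl fun v hv => ?_
      rw [Finset.card_erase_of_mem hv, hm, Nat.add_sub_cancel]
      simp only [hF, Finset.insert_erase hv, if_neg hX]
      have := hne X hX' hX
      field_simp
  -- Sort by whether the last vertex lies in A. Factorization on smaller sets and `hrec` on the two
  -- parts give `lam (X ∩ A)` and `lam (X \ A)` times the same product, and additivity combines
  -- them.
  have hsum : ∀ X : Finset V, (∀ Y ⊂ X, W Y = W (Y ∩ A) * W (Y \ A)) →
      ∑ v ∈ X, γ (X.erase v) v * W (X.erase v) = lam X * (W (X ∩ A) * W (X \ A)) := by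
    intro X hX
    have hXA : X ∩ A ≠ Finset.univ := fun h =>
      hA' (Finset.eq_univ_of_forall fun v => (Finset.mem_inter.mp (h ▸ Finset.mem_univ v)).2)
    have hXA' : X \ A ≠ Finset.univ := fun h => by
      obtain ⟨v, hv⟩ := hA
      exact (Finset.mem_sdiff.mp (h ▸ Finset.mem_univ v)).2 hv
    rw [← Finset.sum_inter_add_sum_sdiff X A, hlam X, add_mul]
    congr 1
    · rw [← mul_assoc, hrec _ hXA, Finset.sum_mul]
      refine Finset.sum_congr rfl fun v hv => ?_
      obtain ⟨hvX, hvA⟩ := Finset.mem_inter.mp hv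
      rw [hX _ (Finset.erase_ssubset hvX), hγ _ v hvA, Finset.erase_inter,
        Finset.erase_sdiff_comm, Finset.erase_eq_of_notMem (s := X \ A) (by simp [hvA])]
      ring
    · rw [mul_left_comm, hrec _ hXA', Finset.mul_sum]
      refine Finset.sum_congr rfl fun v hv => ?_
      obtain ⟨hvX, hvA⟩ := Finset.mem_sdiff.mp hv
      rw [hX _ (Finset.erase_ssubset hvX), hγ' _ v hvA, Finset.erase_inter,
        Finset.erase_sdiff_comm, Finset.erase_eq_of_notMem (s := X ∩ A) (by simp [hvA])]
      ring
  have hfac : ∀ X : Finset V, X ≠ Finset.univ → W X = W (X ∩ A) * W (X \ A) := by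
    intro X
    induction X using Finset.strongInduction with
    | H X ih =>
      intro hX
      rcases X.eq_empty_or_nonempty with rfl | hX'
      · simp [W, ordW_zero]
      · refine mul_left_cancel₀ (hne X hX' hX) ?_
        rw [hrec X hX, hsum X fun Y hY => ih Y hY fun h => by
          subst h; exact absurd (Finset.subset_univ X) hY.2]
  -- The full vertex set carries no denominator, so `hsum` applies to it directly and its prefactor
  -- `lam Finset.univ = 0` kills the sum.
  rw [ordW_succ]
  have h0 := hsum Finset.univ fun Y hY => hfac Y hY.ne
  rw [hlam0, zero_mul] at h0
  rw [← h0]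
  refine Finset.sum_congr rfl fun v hv => ?_
  simp only [hF, W]
  rw [Finset.insert_erase hv, if_pos rfl, mul_one, Finset.card_erase_of_mem hv, Finset.card_univ, hn,
    Nat.add_sub_cancel]

/-- The factor of the lines which join `v` to itself or to a vertex of `Y`. -/
def vertexCoef (s t : Line → V) (u u' w : Line → ℂ) (Y : Finset V) (v : V) : ℂ :=
  ∏ i, if s i = v ∧ t i = v then w i else if s i = v ∧ t i ∈ Y then u' i
    else if t i = v ∧ s i ∈ Y then u i else 1

/-- Each line is charged to its later end, or to its only end if it is a self-loop. -/
theorem ordCoef_eq_prod {n : ℕ} (s t : Line → V) (u u' w : Line → ℂ) (σ : Fin (n + 1) ≃ V) :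
    ordCoef s t u u' w σ = ∏ k, vertexCoef s t u u' w (pre σ k) (σ k) := by
  simp only [ordCoef, vertexCoef]
  rw [Finset.prod_comm]
  refine Finset.prod_congr rfl fun i _ => ?_
  simp only [mem_pre, ← Equiv.symm_apply_eq]
  generalize σ.symm (s i) = a
  generalize σ.symm (t i) = b
  rcases lt_trichotomy a b with h | h | h
  · rw [Finset.prod_eq_single b]
    · simp [h, h.ne]
    · intro k _ hk
      simp only [Ne.symm hk, and_false, false_and, if_false]
      rw [if_neg]
      rintro ⟨rfl, h'⟩
      exact absurd h h'.not_gt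
    · simp
  · subst h
    rw [Finset.prod_eq_single a]
    · simp
    · intro k _ hk
      simp [Ne.symm hk]
    · simp
  · rw [Finset.prod_eq_single a]
    · simp [h, h.ne, h.not_gt]
    · intro k _ hk
      simp only [Ne.symm hk, false_and, if_false]
      rw [if_neg]
      rintro ⟨rfl, h'⟩
      exact absurd h h'.not_gt
    · simp

theorem prod_pre_succ {n : ℕ} (σ : Fin (n + 1) ≃ V) (f : Finset V → ℂ) :
    ∏ j : Fin n, f (pre σ j.succ) =
      ∏ k, if insert (σ k) (pre σ k) = Finset.univ then 1 else f (insert (σ k) (pre σ k)) := by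
  have hins : ∀ k : Fin (n + 1), ∀ v, v ∈ insert (σ k) (pre σ k) ↔ σ.symm v ≤ k := by
    intro k v
    rw [Finset.mem_insert, mem_pre, le_iff_eq_or_lt, Equiv.symm_apply_eq]
  rw [Fin.prod_univ_castSucc, if_pos, mul_one]
  · refine Finset.prod_congr rfl fun j _ => ?_
    have : insert (σ j.castSucc) (pre σ j.castSucc) = pre σ j.succ := by
      ext v
      rw [hins, mem_pre, Fin.le_castSucc_iff]
    rw [this, if_neg]
    intro h
    have := h ▸ Finset.mem_univ (σ (Fin.last n))
    rw [mem_pre, Equiv.symm_apply_apply] at this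
    exact absurd this (Fin.le_last _).not_gt
  · ext v
    simp [hins, Fin.le_last]

/-- If all lines across a cut are antisymmetric, the sum over the orderings vanishes. -/
theorem ordSum_eq_zero {n : ℕ} (hn : Fintype.card V = n + 1) (s t : Line → V)
    {a b u u' w : Line → ℂ} {P : V → ℂ} {A : Finset V} (hA : A.Nonempty) (hA' : A ≠ Finset.univ)
    (hab : ∀ i ∈ boundary s t A, b i = -a i) (hu : ∀ i ∈ boundary s t A, u' i = u i)
    (hP : ∑ v, P v = 0)
    (hne : ∀ X : Finset V, X.Nonempty → X ≠ Finset.univ → cutE s t a b P X ≠ 0) :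
    ordSum n s t a b u u' w P = 0 := by
  let B := boundary s t A
  -- Lines across A have the same numerator in either time order, so their product is pulled out of
  -- the sum; the remaining lines do not link A with its complement.
  let v₁ : (Line → ℂ) → Line → ℂ := fun f i => if i ∈ B then 1 else f i
  have hcoef : ∀ σ : Fin (n + 1) ≃ V, ordCoef s t u u' w σ =
      (∏ i, if i ∈ B then u i else 1) * ordCoef s t (v₁ u) (v₁ u') (v₁ w) σ := by
    intro σ
    rw [ordCoef, ordCoef, ← Finset.prod_mul_distrib]
    refine Finset.prod_congr rfl fun i _ => ?_
    by_cases hi : i ∈ B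
    · have hst : s i ≠ t i := by
        intro h
        have := mem_boundary.mp hi
        rw [h] at this
        tauto
      have hst' : σ.symm (s i) ≠ σ.symm (t i) := fun h => hst (σ.symm.injective h)
      rcases lt_or_gt_of_ne hst' with h | h
      · simp [v₁, hi, h]
      · simp [v₁, hi, h, h.not_gt, hu i hi]
    · simp [v₁, hi]
  have hsum : ordSum n s t a b u u' w P = (∏ i, if i ∈ B then u i else 1) *
      ordW (fun Y v => vertexCoef s t (v₁ u) (v₁ u') (v₁ w) Y v *
        if insert v Y = Finset.univ then 1 else (cutE s t a b P (insert v Y))⁻¹) (n + 1)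
        Finset.univ := by
    rw [← sum_equiv_eq_ordW hn, ordSum, Finset.mul_sum]
    refine Finset.sum_congr rfl fun σ _ => ?_
    rw [hcoef, Finset.prod_mul_distrib, ← ordCoef_eq_prod,
      ← prod_pre_succ σ fun X => (cutE s t a b P X)⁻¹, mul_assoc]
  rw [hsum, ordW_univ_eq_zero hn hA hA' ?_ ?_ hne, mul_zero]
  · intro Y v hv
    refine Finset.prod_congr rfl fun i _ => ?_
    by_cases hi : i ∈ B
    · simp [v₁, hi]
    · have hi' : s i ∈ A ↔ t i ∈ A := by
        have := mt mem_boundary.mpr hi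
        tauto
      by_cases h1 : s i = v
      · have : t i ∈ A := hi'.mp (h1 ▸ hv)
        simp [h1, this, hv]
      · by_cases h2 : t i = v
        · have : s i ∈ A := hi'.mpr (h2 ▸ hv)
          simp [h1, h2, this]
        · simp [h1, h2]
  · intro Y v hv
    refine Finset.prod_congr rfl fun i _ => ?_
    by_cases hi : i ∈ B
    · simp [v₁, hi]
    · have hi' : s i ∈ A ↔ t i ∈ A := by
        have := mt mem_boundary.mpr hi
        tauto
      by_cases h1 : s i = v
      · have : t i ∉ A := fun h => hv (h1 ▸ hi'.mpr h)
        simp [h1, this, hv]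
      · by_cases h2 : t i = v
        · have : s i ∉ A := fun h => hv (h2 ▸ hi'.mp h)
          simp [h1, h2, this]
        · simp [h1, h2]
  -- Additivity of the cut energies: a line across A with both ends in X contributes 0 to the left
  -- and `a i + b i = 0` to the right.
  · intro X
    simp only [cutE]
    rw [add_add_add_comm, ← Finset.sum_add_distrib, Finset.sum_inter_add_sum_sdiff]
    congr 1
    refine Finset.sum_congr rfl fun i _ => ?_
    have := hab i
    rw [mem_boundary] at this
    by_cases h1 : s i ∈ X <;> by_cases h2 : t i ∈ X <;> by_cases h3 : s i ∈ A <;>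
      by_cases h4 : t i ∈ A <;> simp_all
  · simp [cutE, hP]

end FeynmanGraph

end

noncomputable section

namespace FeynmanGraph

open MeasureTheory Filter Topology

set_option linter.unusedSectionVars false

variable {V Line : Type*} [Fintype V] [DecidableEq V] [Fintype Line] [DecidableEq Line]
  (G : FeynmanGraph V Line)

/-! ### Reflections of all lines across a cut -/

/-- No cut energy vanishes, whatever the signs of the line energies. -/
def IsGeneric (p : V → ℝ) (E : Line → ℝ) : Prop :=
  ∀ (u : Finset Line) (X : Finset V), X.Nonempty → X ≠ Finset.univ →
    cutE G.src G.tgt (fun i => (reflect u E i : ℂ)) (fun i => (reflect u E i : ℂ)) (extE p) X ≠ 0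

theorem reflect_reflect (u u' : Finset Line) (E : Line → ℝ) :
    reflect u (reflect u' E) = reflect (symmDiff u' u) E := (reflect_symmDiff u' u E).symm

theorem reflect_self (u : Finset Line) (E : Line → ℝ) : reflect u (reflect u E) = E := by
  funext i
  by_cases h : i ∈ u <;> simp [reflect, h]

theorem reflect_empty (E : Line → ℝ) : reflect ∅ E = E := by
  funext i
  simp [reflect]

variable {G} in
theorem IsGeneric.reflect {p : V → ℝ} {E : Line → ℝ} (h : G.IsGeneric p E) (u : Finset Line) :
    G.IsGeneric p (reflect u E) := by
  intro u' X hX hX'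
  rw [reflect_reflect]
  exact h _ X hX hX'

-- A difference of two cut energies along an ordering is itself a cut energy, of a rotated ordering
-- with some lines reflected, and is therefore nonzero.
variable {G} in
theorem IsGeneric.injective {p : V → ℝ} (hp : ∑ v, p v = 0) {E : Line → ℝ} (h : G.IsGeneric p E)
    {n : ℕ} (σ : Fin (n + 1) ≃ V) :
    Function.Injective fun k =>
      cutE G.src G.tgt (fun i => (E i : ℂ)) (fun i => (E i : ℂ)) (extE p) (pre σ k) := by
  intro l k hlk
  by_contra hne
  have h1 := cutE_sub_reflect_boundary G (FeynmanGraph.reflect (boundary G.src G.tgt (pre σ k)) E) σ k hp hne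
  rw [reflect_self, sub_eq_zero.mpr hlk] at h1
  refine h _ _ ?_ ?_ h1.symm
  · refine ⟨rotate k σ 0, ?_⟩
    rw [mem_pre, Equiv.symm_apply_apply, Fin.pos_iff_ne_zero]
    exact sub_ne_zero.mpr hne
  · intro huniv
    have := huniv ▸ Finset.mem_univ (rotate k σ (l - k))
    rw [mem_pre, Equiv.symm_apply_apply] at this
    exact lt_irrefl _ this

theorem extE_sum {p : V → ℝ} (hp : ∑ v, p v = 0) : ∑ v, extE p v = 0 := by
  simp only [extE, ← Finset.mul_sum, ← Complex.ofReal_sum, hp]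
  simp

/-- All sign choices on the boundary lines are summed, so they may be permuted independently for
each ordering. Flipping exactly the lines that run backward in time makes every boundary line
antisymmetric, and `ordSum_eq_zero` applies for each fixed choice of signs. -/
theorem sum_powerset_lineOrdSum_eq_zero {n : ℕ} (hn : Fintype.card V = n + 1) (c d : Line → ℂ)
    {p : V → ℝ} (hp : ∑ v, p v = 0) {E : Line → ℝ} (hE : G.IsGeneric p E)
    {A : Finset V} (hA : A.Nonempty) (hA' : A ≠ Finset.univ) :
    ∑ u ∈ (boundary G.src G.tgt A).powerset, G.lineOrdSum n c d p (reflect u E) = 0 := by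
  set B := boundary G.src G.tgt A with hB
  let b : Finset Line → Line → ℂ := fun u i => if i ∈ B then -(reflect u E i : ℂ) else reflect u E i
  let w : Finset Line → Line → ℂ := fun u i =>
    if i ∈ B then c i - reflect u E i * d i else c i + reflect u E i * d i
  let K : (Fin (n + 1) ≃ V) → Finset Line := fun σ =>
    B.filter fun i => σ.symm (G.tgt i) < σ.symm (G.src i)
  have hterm : ∀ (σ : Fin (n + 1) ≃ V) (u : Finset Line), G.ordTerm c d p (reflect u E) σ =
      ordCoef G.src G.tgt (fun i => c i - reflect (symmDiff u (K σ)) E i * d i)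
        (w (symmDiff u (K σ))) c σ *
      ∏ j : Fin n, (cutE G.src G.tgt (fun i => (reflect (symmDiff u (K σ)) E i : ℂ))
        (b (symmDiff u (K σ))) (extE p) (pre σ j.succ))⁻¹ := by
    intro σ u
    rw [ordTerm]
    congr 1
    · refine Finset.prod_congr rfl fun i _ => ?_
      rw [reflect_symmDiff]
      by_cases h1 : σ.symm (G.src i) < σ.symm (G.tgt i)
      · have : i ∉ K σ := by simp [K, h1.le]
        simp [h1, reflect, this]
      · by_cases h2 : σ.symm (G.tgt i) < σ.symm (G.src i)
        · by_cases hi : i ∈ B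
          · have : i ∈ K σ := by simp [K, h2, hi]
            simp only [h1, h2, if_true, if_false, w, hi, reflect_symmDiff]
            rw [reflect_of_mem this]
            push_cast
            ring
          · have : i ∉ K σ := by simp [K, hi]
            simp only [h1, h2, if_true, if_false, w, hi, reflect_symmDiff]
            rw [reflect_of_notMem this]
        · simp [h1, h2]
    · refine Finset.prod_congr rfl fun j _ => ?_
      rw [cutE, cutE]
      congr 2
      refine Finset.sum_congr rfl fun i _ => ?_
      simp only [reflect_symmDiff, mem_pre, b]
      by_cases h1 : σ.symm (G.src i) < j.succ <;> by_cases h2 : σ.symm (G.tgt i) < j.succ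
      · simp [h1, h2]
      · have : i ∉ K σ := by simp [K, (h1.trans_le (not_lt.mp h2)).le]
        simp only [h1, h2, not_false_eq_true, and_self, if_true]
        rw [reflect_of_notMem this]
      · simp only [h1, h2, not_false_eq_true, and_self, if_true, if_false, false_and]
        by_cases hi : i ∈ B
        · have : i ∈ K σ := by simp [K, hi, h2.trans_le (not_lt.mp h1)]
          rw [if_pos hi, reflect_of_mem this]
          push_cast
          ring
        · have : i ∉ K σ := by simp [K, hi]
          rw [if_neg hi, reflect_of_notMem this]
      · simp [h1, h2]
  simp only [lineOrdSum]
  rw [Finset.sum_comm]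
  have hreidx : ∀ σ : Fin (n + 1) ≃ V, ∑ u ∈ B.powerset, G.ordTerm c d p (reflect u E) σ =
      ∑ u ∈ B.powerset, ordCoef G.src G.tgt (fun i => c i - reflect u E i * d i) (w u) c σ *
        ∏ j : Fin n, (cutE G.src G.tgt (fun i => (reflect u E i : ℂ)) (b u) (extE p)
          (pre σ j.succ))⁻¹ := by
    intro σ
    have hK : K σ ⊆ B := Finset.filter_subset _ _
    have hmem : ∀ u ∈ B.powerset, symmDiff u (K σ) ∈ B.powerset := by
      intro u hu
      rw [Finset.mem_powerset] at hu ⊢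
      intro i hi
      rcases Finset.mem_symmDiff.mp hi with h | h
      · exact hu h.1
      · exact hK h.1
    refine Finset.sum_nbij' (fun u => symmDiff u (K σ)) (fun u => symmDiff u (K σ)) hmem hmem
      (fun u _ => symmDiff_symmDiff_cancel_right _ _)
      (fun u _ => symmDiff_symmDiff_cancel_right _ _) fun u _ => hterm σ u
  rw [Finset.sum_congr rfl fun σ _ => hreidx σ, Finset.sum_comm]
  refine Finset.sum_eq_zero fun u _ => ?_
  refine ordSum_eq_zero hn G.src G.tgt hA hA' (fun i hi => ?_) (fun i hi => ?_) (extE_sum hp)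
    fun X hX hX' => ?_
  · simp only [b]
    rw [if_pos hi]
  · simp only [w]
    rw [if_pos hi]
  -- The antisymmetric cut energy is an ordinary one after reflecting the lines of B that enter X,
  -- so genericity applies.
  · let u' := B.filter fun i => G.tgt i ∈ X ∧ G.src i ∉ X
    have : cutE G.src G.tgt (fun i => (reflect u E i : ℂ)) (b u) (extE p) X =
        cutE G.src G.tgt (fun i => (reflect u' (reflect u E) i : ℂ))
          (fun i => (reflect u' (reflect u E) i : ℂ)) (extE p) X := by
      unfold cutE
      congr 1
      refine Finset.sum_congr rfl fun i _ => ?_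
      by_cases h1 : G.src i ∈ X <;> by_cases h2 : G.tgt i ∈ X <;> by_cases hi : i ∈ B <;>
        simp [h1, h2, hi, reflect, u', b]
    rw [this]
    exact hE.reflect u u' X hX hX'

end FeynmanGraph

end

noncomputable section

namespace FeynmanGraph

open MeasureTheory Filter Topology

set_option linter.unusedSectionVars false

variable {V Line : Type*} [Fintype V] [DecidableEq V] [Fintype Line] [DecidableEq Line]
  (G : FeynmanGraph V Line)

/-! ### The thermal operators as sums over reflections -/

theorem update_neg_eq_reflect (i : Line) (E : Line → ℝ) :
    Function.update E i (-E i) = reflect {i} E := by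
  funext j
  by_cases h : j = i
  · subst h; simp [reflect]
  · simp [reflect, h]

theorem reflect_reflect_singleton {u : Finset Line} {i : Line} (h : i ∉ u) (E : Line → ℝ) :
    reflect u (reflect {i} E) = reflect (insert i u) E := by
  funext j
  by_cases hj : j = i
  · subst hj; simp [reflect, h]
  · simp [reflect, hj]

theorem lineOpProd_insert (T : ℝ) {s : Finset Line} {i : Line} (h : i ∉ s) :
    G.lineOpProd T (insert i s) = G.lineOp T i * G.lineOpProd T s :=
  Finset.noncommProd_insert_of_notMem _ _ _ _ h

theorem lineOpProd_empty (T : ℝ) : G.lineOpProd T ∅ = 1 := Finset.noncommProd_empty _ _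

theorem lineOpProd_apply (T : ℝ) (s : Finset Line) (F : (Line → ℝ) → ℂ) (E : Line → ℝ) :
    G.lineOpProd T s F E = (∏ i ∈ s, (G.occupation T i (E i) : ℂ)) *
      ∑ u ∈ s.powerset, F (reflect u E) := by
  induction s using Finset.induction_on generalizing E with
  | empty => simp [lineOpProd_empty, reflect_empty]
  | insert i s hi ih =>
    rw [lineOpProd_insert G T hi, Module.End.mul_apply, lineOp_apply, ih, ih,
      Finset.prod_insert hi, Finset.sum_powerset_insert hi, update_neg_eq_reflect]
    have h1 : ∏ j ∈ s, (G.occupation T j (reflect {i} E j) : ℂ) =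
        ∏ j ∈ s, (G.occupation T j (E j) : ℂ) := by
      refine Finset.prod_congr rfl fun j hj => ?_
      rw [reflect_of_notMem]
      rw [Finset.mem_singleton]
      rintro rfl
      exact hi hj
    have h2 : ∑ u ∈ s.powerset, F (reflect u (reflect {i} E)) =
        ∑ u ∈ s.powerset, F (reflect (insert i u) E) := by
      refine Finset.sum_congr rfl fun u hu => ?_
      rw [reflect_reflect_singleton fun h => hi (Finset.mem_powerset.mp hu h)]
    rw [h1, h2]
    ring

theorem pairwise_commute_one_add_lineOp (T : ℝ) (s : Set Line) :
    s.Pairwise (Function.onFun Commute fun i => 1 + G.lineOp T i) := fun _ _ _ _ h =>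
  (Commute.one_left _).add_left ((Commute.one_right _).add_right (G.lineOp_commute T h))

theorem thermalOpStar_eq_sum (T : ℝ) :
    G.thermalOpStar T = ∑ s : Finset Line, G.lineOpProd T s := by
  have h : ∀ s : Finset Line, s.noncommProd (fun i => 1 + G.lineOp T i)
      (G.pairwise_commute_one_add_lineOp T s) =
      ∑ u ∈ s.powerset, G.lineOpProd T u := by
    intro s
    induction s using Finset.induction_on with
    | empty => simp [lineOpProd_empty]
    | insert i s hi ih =>
      rw [Finset.noncommProd_insert_of_notMem _ _ _ _ hi, ih, Finset.sum_powerset_insert hi, add_mul,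
        one_mul, Finset.mul_sum]
      congr 1
      refine Finset.sum_congr rfl fun u hu => ?_
      rw [lineOpProd_insert G T fun h => hi (Finset.mem_powerset.mp hu h)]
  exact (h Finset.univ).trans (by rw [Finset.powerset_univ])

/-- A reflection pattern u arises from every set s ⊇ u with weight ∏ N over s. Summing over s leaves
N for the lines of u and 1 + N for all others. -/
theorem thermalOpStar_apply (T : ℝ) (F : (Line → ℝ) → ℂ) (E : Line → ℝ) :
    G.thermalOpStar T F E = ∑ u, G.thermalWeight T E u * F (reflect u E) := by
  simp only [thermalOpStar_eq_sum, LinearMap.sum_apply, Finset.sum_apply, lineOpProd_apply,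
    Finset.mul_sum]
  have h1 : ∀ s : Finset Line, ∑ u ∈ s.powerset, (∏ i ∈ s, (G.occupation T i (E i) : ℂ)) *
      F (reflect u E) = ∑ u : Finset Line, if u ⊆ s then (∏ i ∈ s, (G.occupation T i (E i) : ℂ)) *
      F (reflect u E) else 0 := by
    intro s
    rw [← Finset.sum_filter]
    refine Finset.sum_congr ?_ fun _ _ => rfl
    ext u; simp
  rw [Finset.sum_congr rfl fun s _ => h1 s, Finset.sum_comm]
  refine Finset.sum_congr rfl fun u _ => ?_
  have h2 : ∀ i, (if i ∈ u then (occ (G.statSign i) T (E i) : ℂ) else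
      1 + occ (G.statSign i) T (E i)) = (if i ∈ u then 0 else 1) + G.occupation T i (E i) := by
    intro i
    rw [occupation_eq]
    split_ifs <;> ring
  rw [thermalWeight, Finset.prod_congr rfl fun i _ => (h2 i).trans (add_comm _ _), Finset.prod_add,
    Finset.powerset_univ, Finset.sum_mul]
  refine Finset.sum_congr rfl fun s _ => ?_
  by_cases h : u ⊆ s
  · rw [if_pos h, Finset.prod_eq_one (s := Finset.univ \ s), mul_one]
    intro i hi
    exact if_neg fun hu => (Finset.mem_sdiff.mp hi).2 (h hu)
  · obtain ⟨i, hu, hs⟩ := Finset.not_subset.mp h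
    have hz : ∏ j ∈ Finset.univ \ s, (if j ∈ u then (0 : ℂ) else 1) = 0 :=
      Finset.prod_eq_zero (Finset.mem_sdiff.mpr ⟨Finset.mem_univ i, hs⟩) (if_pos hu)
    rw [if_neg h, hz, mul_zero, zero_mul]

theorem card_le_of_connectedBy {t : Finset Line} (ht : G.ConnectedBy t) :
    Fintype.card V ≤ t.card + 1 := by
  have h := ht.card_vert_le_card_edgeSet_add_one
  rw [Nat.card_eq_fintype_card] at h
  refine h.trans (Nat.add_le_add_right ?_ 1)
  rw [Nat.card_coe_set_eq, ← Set.ncard_coe_finset t]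
  refine (Set.ncard_le_ncard (t := (fun i => s(G.src i, G.tgt i)) '' (t : Set Line)) ?_).trans
    (Set.ncard_image_le t.finite_toSet)
  rintro ⟨v, w⟩ hvw
  have hadj := (SimpleGraph.fromRel_adj _ _ _).mp ((SimpleGraph.mem_edgeSet _).mp hvw)
  rcases hadj.2 with ⟨i, hi, rfl, rfl⟩ | ⟨i, hi, rfl, rfl⟩
  · exact ⟨i, hi, rfl⟩
  · exact ⟨i, hi, Sym2.eq_swap⟩

-- The bound k ≤ L is automatic, as a connecting set has at least V - 1 lines; the empty set
-- supplies the identity.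
open scoped Classical in
theorem thermalOp_eq_sum (hG : G.ConnectedBy Finset.univ) (T : ℝ) :
    G.thermalOp T = ∑ s : Finset Line with G.ConnectedBy sᶜ, G.lineOpProd T s := by
  have hmaps : ∀ s ∈ (Finset.univ.filter fun s : Finset Line => G.ConnectedBy sᶜ),
      s.card ∈ Finset.Icc 0 G.loops := by
    intro s hs
    have h := G.card_le_of_connectedBy (Finset.mem_filter.mp hs).2
    rw [Finset.card_compl] at h
    have := Finset.card_le_univ s
    simp only [Finset.mem_Icc, loops]
    omega
  rw [← Finset.sum_fiberwise_of_maps_to hmaps,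
    ← Finset.insert_Icc_add_one_left_eq_Icc (Nat.zero_le G.loops), Finset.sum_insert (by simp),
    thermalOp]
  congr 1
  · rw [Finset.sum_eq_single ∅]
    · rw [lineOpProd_empty]
    · intro s hs hne
      exact absurd (Finset.card_eq_zero.mp (Finset.mem_filter.mp hs).2) hne
    · intro h
      simp [hG] at h
  · refine Finset.sum_congr rfl fun k _ => Finset.sum_congr ?_ fun _ _ => rfl
    ext s
    simp [Finset.mem_powersetCard, and_comm]

/-- A connected component of what remains after removing `s` has no remaining line across its
boundary. -/
theorem exists_boundary_subset {s : Finset Line} [Nonempty V] (hs : ¬ G.ConnectedBy sᶜ) :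
    ∃ A : Finset V, A.Nonempty ∧ A ≠ Finset.univ ∧ boundary G.src G.tgt A ⊆ s := by
  classical
  set H := SimpleGraph.fromRel fun u v => ∃ i ∈ sᶜ, G.src i = u ∧ G.tgt i = v with hH
  have : ¬ H.Preconnected := fun h => hs ⟨h⟩
  simp only [SimpleGraph.Preconnected, not_forall] at this
  obtain ⟨v, w, hvw⟩ := this
  refine ⟨Finset.univ.filter fun x => H.Reachable v x, ⟨v, by simp⟩, fun h => ?_, fun i hi => ?_⟩
  · have := h ▸ Finset.mem_univ w
    exact hvw (Finset.mem_filter.mp this).2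
  · by_contra his
    have hadj : G.src i ≠ G.tgt i → H.Adj (G.src i) (G.tgt i) := fun hne => by
      rw [hH, SimpleGraph.fromRel_adj]
      exact ⟨hne, Or.inl ⟨i, by simpa using his, rfl, rfl⟩⟩
    simp only [mem_boundary, Finset.mem_filter, Finset.mem_univ, true_and] at hi
    rcases hi with ⟨h1, h2⟩ | ⟨h1, h2⟩
    · exact h2 (h1.trans (hadj fun h => h2 (h ▸ h1)).reachable)
    · exact h2 (h1.trans (hadj fun h => h2 (h ▸ h1)).symm.reachable)

theorem sum_powerset_reflect {s B : Finset Line} (hB : B ⊆ s) (F : (Line → ℝ) → ℂ) (E : Line → ℝ) :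
    ∑ u ∈ s.powerset, F (reflect u E) =
      ∑ u ∈ (s \ B).powerset, ∑ u' ∈ B.powerset, F (reflect u' (reflect u E)) := by
  rw [← Finset.sum_product']
  refine Finset.sum_nbij' (fun u => (u \ B, u ∩ B)) (fun x => x.1 ∪ x.2) ?_ ?_ ?_ ?_ ?_
  · intro u hu
    simp only [Finset.mem_product, Finset.mem_powerset] at hu ⊢
    exact ⟨Finset.sdiff_subset_sdiff hu subset_rfl, Finset.inter_subset_right⟩
  · rintro ⟨u, u'⟩ hu
    simp only [Finset.mem_product, Finset.mem_powerset] at hu ⊢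
    exact Finset.union_subset (hu.1.trans Finset.sdiff_subset) (hu.2.trans hB)
  · intro u _
    exact Finset.sdiff_union_inter u B
  · rintro ⟨u, u'⟩ hu
    simp only [Finset.mem_product, Finset.mem_powerset] at hu
    ext i
    · have := @hu.1 i
      have := @hu.2 i
      simp only [Finset.mem_sdiff, Finset.mem_union] at *
      tauto
    · have := @hu.1 i
      have := @hu.2 i
      simp only [Finset.mem_sdiff, Finset.mem_union, Finset.mem_inter] at *
      tauto
  · intro u _
    congr 1
    funext i
    by_cases h1 : i ∈ u <;> by_cases h2 : i ∈ B <;> simp [reflect, h1, h2]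

open scoped Classical in
/-- The thermal operator agrees with the unrestricted product on functions which are annihilated by
the reflections across every cut. -/
theorem thermalOp_eq_thermalOpStar [Nonempty V] (hG : G.ConnectedBy Finset.univ) (T : ℝ)
    {F : (Line → ℝ) → ℂ} {E : Line → ℝ}
    (hF : ∀ (A : Finset V) (u : Finset Line), A.Nonempty → A ≠ Finset.univ →
      ∑ u' ∈ (boundary G.src G.tgt A).powerset, F (reflect u' (reflect u E)) = 0) :
    G.thermalOp T F E = G.thermalOpStar T F E := by
  rw [thermalOp_eq_sum G hG, thermalOpStar_eq_sum, ← Finset.sum_filter_add_sum_filter_not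
    Finset.univ fun s : Finset Line => G.ConnectedBy sᶜ]
  rw [LinearMap.add_apply, Pi.add_apply, left_eq_add, LinearMap.sum_apply, Finset.sum_apply]
  refine Finset.sum_eq_zero fun s hs => ?_
  obtain ⟨A, hA, hA', hAs⟩ := G.exists_boundary_subset (Finset.mem_filter.mp hs).2
  rw [lineOpProd_apply, sum_powerset_reflect hAs, Finset.sum_eq_zero fun u _ => hF A u hA hA',
    mul_zero]

end FeynmanGraph

end

noncomputable section

namespace FeynmanGraph

open MeasureTheory Filter Topology

set_option linter.unusedSectionVars false

variable {V Line : Type*} [Fintype V] [DecidableEq V] [Fintype Line] [DecidableEq Line]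
  (G : FeynmanGraph V Line)

/-! ### The zero-temperature function as a rational function -/

/-- The zero-temperature function of time-ordered perturbation theory. -/
def zeroTempFun (n : ℕ) (p : V → ℝ) (E : Line → ℝ) : ℂ :=
  ∑ s, G.spin s * G.lineOrdSum n (G.numConst s) (G.numLin s) p E

theorem tendsto_zeroTempFun {t : Finset Line} (ht : G.IsSpanningTree t) {p : V → ℝ}
    (hp : ∑ v, p v = 0) {n : ℕ} (hn : Fintype.card V = n + 1) {E : Line → ℝ} (hE : ∀ i, 0 < E i) :
    Tendsto (G.partialD₀ t p E) atTop (𝓝 (G.zeroTempFun n p E)) := by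
  obtain ⟨r⟩ := ht.1.nonempty
  have h := tendsto_partialD₀ G ht hp r hE
  simp only [integral_timeFun_lineFun G r hp _ _ E ht.1 hn hE] at h
  exact h

/-- The cut energy as a polynomial in the line energies. -/
def cutPoly (p : V → ℝ) (X : Finset V) : MvPolynomial Line ℂ :=
  ∑ i, (if i ∈ boundary G.src G.tgt X then MvPolynomial.X i else 0) +
    MvPolynomial.C (∑ v ∈ X, extE p v)

theorem eval_cutPoly (p : V → ℝ) (X : Finset V) (E : Line → ℝ) :
    MvPolynomial.eval (fun i => (E i : ℂ)) (G.cutPoly p X) =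
      cutE G.src G.tgt (fun i => (E i : ℂ)) (fun i => (E i : ℂ)) (extE p) X := by
  rw [cutE_self, cutPoly, map_add, map_sum, MvPolynomial.eval_C]
  congr 1
  refine Finset.sum_congr rfl fun i _ => ?_
  split_ifs <;> simp

/-- The common denominator of time-ordered perturbation theory. -/
def ordDen (n : ℕ) (p : V → ℝ) : MvPolynomial Line ℂ :=
  ∏ σ : Fin (n + 1) ≃ V, ∏ j : Fin n, G.cutPoly p (pre σ j.succ)

theorem eval_ordDen_ne_zero {n : ℕ} {p : V → ℝ} {E : Line → ℝ}
    (h : ∀ X : Finset V, X.Nonempty → X ≠ Finset.univ →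
      cutE G.src G.tgt (fun i => (E i : ℂ)) (fun i => (E i : ℂ)) (extE p) X ≠ 0) :
    MvPolynomial.eval (fun i => (E i : ℂ)) (G.ordDen n p) ≠ 0 := by
  rw [ordDen, map_prod]
  refine Finset.prod_ne_zero_iff.mpr fun σ _ => ?_
  rw [map_prod]
  refine Finset.prod_ne_zero_iff.mpr fun j _ => ?_
  rw [eval_cutPoly]
  refine h _ ⟨σ 0, by simp [mem_pre]⟩ fun huniv => ?_
  have := huniv ▸ Finset.mem_univ (σ (Fin.last n))
  rw [mem_pre, Equiv.symm_apply_apply] at this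
  exact absurd this (Fin.le_last _).not_gt

theorem exists_ordTerm_eq {n : ℕ} (c d : Line → ℂ) (p : V → ℝ) (σ : Fin (n + 1) ≃ V) :
    ∃ num : MvPolynomial Line ℂ, ∀ E : Line → ℝ,
      MvPolynomial.eval (fun i => (E i : ℂ)) (G.ordDen n p) ≠ 0 →
      G.ordTerm c d p E σ = ratFun num (G.ordDen n p) E := by
  let co : MvPolynomial Line ℂ := ∏ i,
    if σ.symm (G.src i) < σ.symm (G.tgt i) then
      MvPolynomial.C (c i) - MvPolynomial.X i * MvPolynomial.C (d i)
    else if σ.symm (G.tgt i) < σ.symm (G.src i) then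
      MvPolynomial.C (c i) + MvPolynomial.X i * MvPolynomial.C (d i)
    else MvPolynomial.C (c i)
  have hco : ∀ E : Line → ℝ, MvPolynomial.eval (fun i => (E i : ℂ)) co =
      ordCoef G.src G.tgt (fun i => c i - E i * d i) (fun i => c i + E i * d i) c σ := by
    intro E
    rw [map_prod, ordCoef]
    refine Finset.prod_congr rfl fun i _ => ?_
    split_ifs <;> simp
  refine ⟨co * ∏ σ' ∈ Finset.univ.erase σ, ∏ j : Fin n, G.cutPoly p (pre σ' j.succ),
    fun E hE => ?_⟩
  have hden : G.ordDen n p = (∏ j : Fin n, G.cutPoly p (pre σ j.succ)) *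
      ∏ σ' ∈ Finset.univ.erase σ, ∏ j : Fin n, G.cutPoly p (pre σ' j.succ) :=
    (Finset.mul_prod_erase _ _ (Finset.mem_univ σ)).symm
  rw [hden, map_mul] at hE
  rw [ratFun, hden, map_mul, map_mul, mul_div_mul_right _ _ (right_ne_zero_of_mul hE), hco, ordTerm,
    div_eq_mul_inv, map_prod, ← Finset.prod_inv_distrib]
  simp only [eval_cutPoly]

theorem exists_zeroTempFun_eq (n : ℕ) (p : V → ℝ) :
    ∃ num : MvPolynomial Line ℂ, ∀ E : Line → ℝ,
      MvPolynomial.eval (fun i => (E i : ℂ)) (G.ordDen n p) ≠ 0 →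
      G.zeroTempFun n p E = ratFun num (G.ordDen n p) E := by
  choose num hnum using fun s (σ : Fin (n + 1) ≃ V) =>
    G.exists_ordTerm_eq (G.numConst s) (G.numLin s) p σ
  refine ⟨∑ s, MvPolynomial.C (G.spin s) * ∑ σ, num s σ, fun E hE => ?_⟩
  simp only [zeroTempFun, lineOrdSum, ratFun, map_sum, map_mul, MvPolynomial.eval_C]
  rw [Finset.sum_div]
  refine Finset.sum_congr rfl fun s _ => ?_
  rw [mul_div_assoc, Finset.sum_div]
  congr 1
  exact Finset.sum_congr rfl fun σ _ => hnum s σ E hE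

theorem eval_ordDen_ne_zero_of_pos {t : Finset Line} (ht : G.ConnectedBy t) (n : ℕ) (p : V → ℝ)
    {E : Line → ℝ} (hE : ∀ i, 0 < E i) :
    MvPolynomial.eval (fun i => (E i : ℂ)) (G.ordDen n p) ≠ 0 := by
  refine G.eval_ordDen_ne_zero fun X ⟨v, hv⟩ hX h => ?_
  obtain ⟨w, hw⟩ : ∃ w, w ∉ X := by
    by_contra! h
    exact hX (Finset.eq_univ_of_forall h)
  have := cutE_re_pos ht hE p hv hw
  rw [h] at this
  exact lt_irrefl _ this

theorem exists_isD₀ {t : Finset Line} (ht : G.IsSpanningTree t) {p : V → ℝ}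
    (hp : ∑ v, p v = 0) : ∃ num den : MvPolynomial Line ℂ, G.IsD₀ t p num den := by
  obtain ⟨num, hnum⟩ := G.exists_zeroTempFun_eq t.card p
  refine ⟨num, G.ordDen t.card p, fun E hE => ?_⟩
  have h := G.eval_ordDen_ne_zero_of_pos ht.1 t.card p hE
  refine ⟨h, ?_⟩
  rw [← hnum E h]
  exact G.tendsto_zeroTempFun ht hp ht.2.symm hE

/-- Rational functions representing the zero-temperature function agree with the sum of
time-ordered perturbation theory at all generic energies. -/
theorem IsD₀.eq_zeroTempFun {G : FeynmanGraph V Line} {t : Finset Line} (ht : G.IsSpanningTree t)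
    {p : V → ℝ} (hp : ∑ v, p v = 0) {n : ℕ} (hn : Fintype.card V = n + 1)
    {num den : MvPolynomial Line ℂ} (h : G.IsD₀ t p num den) {E : Line → ℝ}
    (hden : MvPolynomial.eval (fun i => (E i : ℂ)) den ≠ 0) (hE : G.IsGeneric p E) :
    ratFun num den E = G.zeroTempFun n p E := by
  obtain ⟨num', hnum'⟩ := G.exists_zeroTempFun_eq n p
  -- Both fractions equal the energy integral at positive energies, a product of infinite sets,
  -- which forces an identity of polynomials and hence equality at energies of any sign.
  have hpoly : num * G.ordDen n p = num' * den := by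
    refine MvPolynomial.funext_set (fun _ : Line => Complex.ofReal '' Set.Ioi 0)
      (fun i => (Set.Ioi_infinite (0 : ℝ)).image Complex.ofReal_injective.injOn) fun x hx => ?_
    choose y hy hyx using fun i => hx i (Set.mem_univ i)
    obtain rfl : (fun i => (y i : ℂ)) = x := funext hyx
    have hD := G.eval_ordDen_ne_zero_of_pos ht.1 n p hy
    have h1 := tendsto_nhds_unique (h y hy).2 (G.tendsto_zeroTempFun ht hp hn hy)
    rw [hnum' y hD, ratFun, ratFun, div_eq_div_iff (h y hy).1 hD] at h1
    rw [map_mul, map_mul, h1]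
  have hD : MvPolynomial.eval (fun i => (E i : ℂ)) (G.ordDen n p) ≠ 0 := by
    refine G.eval_ordDen_ne_zero fun X hX hX' => ?_
    have := hE ∅ X hX hX'
    rwa [reflect_empty] at this
  rw [hnum' E hD, ratFun, ratFun, div_eq_div_iff hden hD, ← map_mul, hpoly, map_mul]

/-! ### Density of the generic energies -/

theorem continuous_reflect (u : Finset Line) : Continuous (reflect u) := by
  refine continuous_pi fun i => ?_
  unfold reflect
  split_ifs <;> fun_prop

theorem continuous_cutE (p : V → ℝ) (X : Finset V) : Continuous fun E : Line → ℝ =>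
    cutE G.src G.tgt (fun i => (E i : ℂ)) (fun i => (E i : ℂ)) (extE p) X := by
  simp only [cutE_self]
  refine Continuous.add (continuous_finsetSum _ fun i _ => ?_) continuous_const
  split_ifs <;> fun_prop

/-- Finitely many open conditions are imposed. Each is dense because connectedness gives a line
across the cut, and varying its energy moves the cut energy away from 0. -/
theorem dense_isGeneric (hG : G.ConnectedBy Finset.univ) (p : V → ℝ) :
    Dense {E : Line → ℝ | G.IsGeneric p E} := by
  have heq : {E : Line → ℝ | G.IsGeneric p E} =
      ⋂ x : Finset Line × {X : Finset V // X.Nonempty ∧ X ≠ Finset.univ},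
        {E | cutE G.src G.tgt (fun i => (reflect x.1 E i : ℂ)) (fun i => (reflect x.1 E i : ℂ))
          (extE p) x.2 ≠ 0} := by
    ext E
    simp only [IsGeneric, Set.mem_ofPred_eq, Set.mem_iInter, Prod.forall, Subtype.forall, and_imp]
  rw [heq]
  refine dense_iInter_of_isOpen (fun x => ?_) fun ⟨u, X, hX, hX'⟩ E => ?_
  · exact isOpen_ne_fun ((G.continuous_cutE p x.2).comp (continuous_reflect x.1)) continuous_const
  · by_cases h0 : cutE G.src G.tgt (fun i => (reflect u E i : ℂ)) (fun i => (reflect u E i : ℂ))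
        (extE p) X = 0
    swap
    · exact subset_closure h0
    obtain ⟨v, hv⟩ := hX
    obtain ⟨w, hw⟩ : ∃ w, w ∉ X := by
      by_contra! h
      exact hX' (Finset.eq_univ_of_forall h)
    obtain ⟨i, -, hi⟩ := exists_crossing hG hv hw
    have hlim : Tendsto (fun z : ℝ => E + Pi.single i z) (𝓝[≠] 0) (𝓝 E) := by
      have : Continuous fun z : ℝ => E + Pi.single i z :=
        continuous_const.add (continuous_single (A := fun _ : Line => ℝ) i)
      have h := this.tendsto 0
      simp only [Pi.single_zero, add_zero] at h
      exact h.mono_left nhdsWithin_le_nhds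
    refine mem_closure_of_tendsto hlim ?_
    filter_upwards [self_mem_nhdsWithin] with z hz
    have hz' : z ≠ 0 := hz
    have hdiff : ∀ j, (reflect u (E + Pi.single i z) j : ℂ) =
        reflect u E j + if j = i then (if i ∈ u then -(z : ℂ) else z) else 0 := by
      intro j
      by_cases hj : j = i
      · subst hj
        by_cases hu : j ∈ u <;> simp [reflect, hu]
        ring
      · by_cases hu : j ∈ u <;> simp [reflect, hu, hj]
    simp only [cutE_self] at h0
    simp only [cutE_self, hdiff]
    have hsum : ∑ j, (if j ∈ boundary G.src G.tgt X then
        ((reflect u E j : ℂ) + if j = i then (if i ∈ u then -(z : ℂ) else z) else 0) else 0) =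
        ∑ j, (if j ∈ boundary G.src G.tgt X then (reflect u E j : ℂ) else 0) +
          (if i ∈ u then -(z : ℂ) else z) := by
      rw [← Fintype.sum_ite_eq' i fun _ => if i ∈ u then -(z : ℂ) else z, ← Finset.sum_add_distrib]
      refine Finset.sum_congr rfl fun j _ => ?_
      by_cases hj : j = i
      · subst hj
        simp [mem_boundary.mpr hi]
      · simp [hj]
    rw [hsum, add_right_comm, h0, zero_add]
    split_ifs
    · simpa using hz'
    · simpa using hz'

/-- The equality is required only near `E`, so that the comparison stays where the denominators of
the rational function are nonzero. -/
theorem eq_of_continuousAt_of_isGeneric (hG : G.ConnectedBy Finset.univ) (p : V → ℝ)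
    {E : Line → ℝ} {f g : (Line → ℝ) → ℂ} (hf : ContinuousAt f E) (hg : ContinuousAt g E)
    (hfg : ∀ᶠ E' in 𝓝 E, G.IsGeneric p E' → f E' = g E') : f E = g E := by
  have hne : (𝓝[{E | G.IsGeneric p E}] E).NeBot :=
    mem_closure_iff_nhdsWithin_neBot.mp (G.dense_isGeneric hG p E)
  refine tendsto_nhds_unique_of_eventuallyEq (l := 𝓝[{E | G.IsGeneric p E}] E)
    (hf.tendsto.mono_left nhdsWithin_le_nhds) (hg.tendsto.mono_left nhdsWithin_le_nhds) ?_
  filter_upwards [hfg.filter_mono nhdsWithin_le_nhds, self_mem_nhdsWithin] with E' h h' using h h'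

/-! ### Continuity in the line energies -/

theorem continuous_eval_ofReal (q : MvPolynomial Line ℂ) :
    Continuous fun E : Line → ℝ => MvPolynomial.eval (fun i => (E i : ℂ)) q :=
  (MvPolynomial.continuous_eval q).comp (by fun_prop)

theorem continuousAt_ratFun {num den : MvPolynomial Line ℂ} {E : Line → ℝ}
    (h : MvPolynomial.eval (fun i => (E i : ℂ)) den ≠ 0) : ContinuousAt (ratFun num den) E :=
  (continuous_eval_ofReal num).continuousAt.div (continuous_eval_ofReal den).continuousAt h

theorem continuous_integral_timeBox (r : V) (p : V → ℝ) (c d : Line → ℂ) {β : ℝ} (hβ : 0 < β) :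
    Continuous fun e : Line → ℝ =>
      ∫ τ in timeBox r β, G.timeFun r p (fun i => lineFun (c i) (d i) (e i)) τ := by
  have := isFiniteMeasure_timeBox r β
  refine continuous_iff_continuousAt.mpr fun e => ?_
  have hM : ∀ᶠ e' : Line → ℝ in 𝓝 e, ∀ i, |e' i| ≤ |e i| + 1 := by
    rw [Filter.eventually_all]
    intro i
    have h : Continuous fun e' : Line → ℝ => |e' i| := (continuous_apply i).abs
    exact (h.tendsto e).eventually (Iic_mem_nhds (lt_add_one |e i|))
  refine continuousAt_of_dominated
    (bound := fun _ => ∏ i, (‖c i‖ + (|e i| + 1) * ‖d i‖) * Real.exp ((|e i| + 1) * β)) ?_ ?_ ?_ ?_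
  · exact Eventually.of_forall fun e' => (measurable_timeFun G r p fun i =>
      measurable_lineFun _ _ _).aestronglyMeasurable
  · filter_upwards [hM] with e' he'
    filter_upwards [ae_restrict_mem (measurableSet_timeBox r β)] with τ hτ
    exact norm_timeFun_lineFun_le G r p c d he' hβ hτ
  · exact integrable_const _
  -- For fixed times the branch of `lineFun` is fixed by the time difference, so the integrand is
  -- continuous in the energies.
  · refine Eventually.of_forall fun τ => Continuous.continuousAt ?_
    unfold timeFun
    refine continuous_const.mul (continuous_finsetProd _ fun i _ => ?_)
    simp only [lineFun]
    split_ifs <;> fun_prop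

theorem continuousAt_thermalWeight {T : ℝ} (hT : 0 < T) {E : Line → ℝ} (hE : ∀ i, E i ≠ 0)
    (u : Finset Line) : ContinuousAt (fun E' => G.thermalWeight T E' u) E := by
  have h : ∀ i, ContinuousAt (fun E' : Line → ℝ => (occ (G.statSign i) T (E' i) : ℂ)) E := by
    intro i
    refine Complex.continuous_ofReal.continuousAt.comp ?_
    unfold occ
    refine ContinuousAt.div continuousAt_const (Continuous.continuousAt ?_)
      (occ_denom_ne_zero (G.isStatistics i).sq_eq hT (hE i))
    fun_prop
  unfold thermalWeight
  refine tendsto_finsetProd _ fun i _ => ?_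
  split_ifs
  · exact h i
  · exact continuousAt_const.add (h i)

/-! ### The thermal operator -/

section Main

variable {t : Finset Line} (ht : G.IsSpanningTree t) {T : ℝ} (hT : 0 < T) {p : V → ℝ}
  (hp : ∑ v, p v = 0) {num den : MvPolynomial Line ℂ} (h : G.IsD₀ t p num den) {E : Line → ℝ}
  (hE : ∀ i, 0 < E i)
  (hden : ∀ u : Finset Line, MvPolynomial.eval (fun i => (reflect u E i : ℂ)) den ≠ 0)

theorem connectedBy_univ {t : Finset Line} (ht : G.ConnectedBy t) : G.ConnectedBy Finset.univ := by
  refine ht.mono fun v w hvw => ?_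
  rw [SimpleGraph.fromRel_adj] at hvw ⊢
  refine ⟨hvw.1, hvw.2.imp ?_ ?_⟩ <;>
  · rintro ⟨i, -, hi⟩
    exact ⟨i, Finset.mem_univ i, hi⟩

include hden in
theorem eventually_eval_ne_zero (u : Finset Line) : ∀ᶠ E' in 𝓝 E,
    MvPolynomial.eval (fun i => (reflect u E' i : ℂ)) den ≠ 0 :=
  ((continuous_eval_ofReal den).comp (continuous_reflect u)).continuousAt.eventually_ne (hden u)

include hden in
theorem continuousAt_ratFun_reflect (u : Finset Line) :
    ContinuousAt (fun E' => ratFun num den (reflect u E')) E :=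
  (continuousAt_ratFun (hden u)).comp (continuous_reflect u).continuousAt

-- At `E` individual time-ordered terms may be singular although their sum has no pole there. The
-- identity is proved at nearby generic energies and extended by continuity of the fraction.
include ht hp h hden in
theorem sum_powerset_ratFun_eq_zero {A : Finset V} (hA : A.Nonempty) (hA' : A ≠ Finset.univ)
    (u : Finset Line) :
    ∑ u' ∈ (boundary G.src G.tgt A).powerset, ratFun num den (reflect u' (reflect u E)) = 0 := by
  simp only [reflect_reflect]
  refine G.eq_of_continuousAt_of_isGeneric (G.connectedBy_univ ht.1) p
    (f := fun E => ∑ u' ∈ (boundary G.src G.tgt A).powerset,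
      ratFun num den (reflect (symmDiff u u') E)) (g := fun _ => 0)
    (tendsto_finsetSum _ fun u' _ => continuousAt_ratFun_reflect hden _) continuousAt_const ?_
  have hev := Filter.eventually_all.mpr fun u' => eventually_eval_ne_zero hden u'
  filter_upwards [hev] with E' hE' hgen
  have h1 : ∀ u' : Finset Line, ratFun num den (reflect (symmDiff u u') E') =
      G.zeroTempFun t.card p (reflect u' (reflect u E')) := by
    intro u'
    rw [h.eq_zeroTempFun ht hp ht.2.symm (hE' _) (hgen.reflect _), reflect_reflect]
  simp only [h1, zeroTempFun]
  rw [Finset.sum_comm]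
  refine Finset.sum_eq_zero fun s _ => ?_
  rw [← Finset.mul_sum, G.sum_powerset_lineOrdSum_eq_zero ht.2.symm _ _ hp (hgen.reflect u) hA hA',
    mul_zero]

-- The same passage to the limit: the box integrals are continuous in the energies without
-- restriction, the thermal weights away from zero energy, and the fraction away from its
-- denominator's zeros.
include ht hT hp h hE hden in
theorem sum_integral_thermalFun_eq (hM : G.IsMatsubaraExternal T p) (r : V) :
    ∑ s, G.spin s * ∫ τ in timeBox r (1 / T), G.timeFun r p
      (fun i => thermalFun (G.numConst s i) (G.numLin s i) T (G.statSign i) (E i)) τ =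
    G.thermalOpStar T (ratFun num den) E := by
  have hβ : 0 < 1 / T := one_div_pos.mpr hT
  have hE0 : ∀ i, E i ≠ 0 := fun i => (hE i).ne'
  rw [thermalOpStar_apply]
  refine G.eq_of_continuousAt_of_isGeneric (G.connectedBy_univ ht.1) p
    (f := fun E => ∑ s, G.spin s * ∫ τ in timeBox r (1 / T), G.timeFun r p
      (fun i => thermalFun (G.numConst s i) (G.numLin s i) T (G.statSign i) (E i)) τ)
    (g := fun E => ∑ u, G.thermalWeight T E u * ratFun num den (reflect u E))
    (tendsto_finsetSum _ fun s _ => Tendsto.const_mul _ ?_)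
    (tendsto_finsetSum _ fun u _ =>
      (G.continuousAt_thermalWeight hT hE0 u).mul (continuousAt_ratFun_reflect hden u)) ?_
  · simp only [integral_timeBox_thermalFun G r p _ _ T hβ]
    exact tendsto_finsetSum _ fun u _ => (G.continuousAt_thermalWeight hT hE0 u).mul
      ((G.continuous_integral_timeBox r p _ _ hβ).comp (continuous_reflect u)).continuousAt
  · have hev := Filter.eventually_all.mpr fun u' => eventually_eval_ne_zero hden u'
    have hpos : ∀ᶠ E' : Line → ℝ in 𝓝 E, ∀ i, E' i ≠ 0 :=
      Filter.eventually_all.mpr fun i => (continuous_apply i).continuousAt.eventually_ne (hE0 i)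
    filter_upwards [hev, hpos] with E' hE' hE0' hgen
    have h1 : ∀ s, ∫ τ in timeBox r (1 / T), G.timeFun r p
        (fun i => thermalFun (G.numConst s i) (G.numLin s i) T (G.statSign i) (E' i)) τ =
        ∑ u, G.thermalWeight T E' u *
          G.lineOrdSum t.card (G.numConst s) (G.numLin s) p (reflect u E') := fun s =>
      G.integral_timeBox_thermalFun_eq r ht.2.symm hp _ _ hT hM hE0' fun u σ =>
        (hgen.reflect u).injective hp σ
    have h2 : ∀ u, ratFun num den (reflect u E') = G.zeroTempFun t.card p (reflect u E') := fun u =>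
      h.eq_zeroTempFun ht hp ht.2.symm (hE' u) (hgen.reflect u)
    simp only [h1, h2, zeroTempFun, Finset.mul_sum]
    rw [Finset.sum_comm]
    exact Finset.sum_congr rfl fun u _ => Finset.sum_congr rfl fun s _ => mul_left_comm _ _ _

end Main

end FeynmanGraph

end

/-! ### Assembly of the theorem -/

theorem theorem2 {V Line : Type*} [Fintype V] [DecidableEq V] [Fintype Line] [DecidableEq Line]
    (G : FeynmanGraph V Line) (t : Finset Line) (ht : G.IsSpanningTree t)
    (T : ℝ) (hT : 0 < T) (p : V → ℝ) (hp : ∑ v, p v = 0) :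
    (∃ num den : MvPolynomial Line ℂ, G.IsD₀ t p num den) ∧
    ∀ num den : MvPolynomial Line ℂ, G.IsD₀ t p num den →
      ∀ E : Line → ℝ, (∀ i, 0 < E i) →
        (∀ E' : Line → ℝ, (∀ i, E' i = E i ∨ E' i = -E i) →
          MvPolynomial.eval (fun i => (E' i : ℂ)) den ≠ 0) →
        G.thermalOp T (FeynmanGraph.ratFun num den) E =
            G.thermalOpStar T (FeynmanGraph.ratFun num den) E ∧
        (G.IsMatsubaraExternal T p →
          G.HasD T p E (G.thermalOpStar T (FeynmanGraph.ratFun num den) E)) := by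
  refine ⟨G.exists_isD₀ ht hp, fun num den h E hE hadm => ?_⟩
  -- Each reflected point `reflect u E` is one of the sign choices at which the denominator is
  -- assumed nonzero.
  have hden : ∀ u : Finset Line,
      MvPolynomial.eval (fun i => (FeynmanGraph.reflect u E i : ℂ)) den ≠ 0 := by
    refine fun u => hadm _ fun i => ?_
    by_cases hi : i ∈ u
    · exact Or.inr (FeynmanGraph.reflect_of_mem hi E)
    · exact Or.inl (FeynmanGraph.reflect_of_notMem hi E)
  have hV : Nonempty V := ht.1.nonempty
  refine ⟨G.thermalOp_eq_thermalOpStar (G.connectedBy_univ ht.1) T fun A u hA hA' =>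
    G.sum_powerset_ratFun_eq_zero ht hp h hden hA hA' u, fun hM => ?_⟩
  obtain ⟨r⟩ := hV
  have hcard : Fintype.card V ≤ Fintype.card Line + 1 := by
    have := t.card_le_univ
    have := ht.2
    omega
  rw [← G.sum_integral_thermalFun_eq ht hT hp h hE hden hM r]
  exact G.tendsto_partialD hT hp hM r hcard hE
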